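/- **Definitions.** An *$n$-gon* ($n\ge 3$), or polygon, is a cyclically ordered set of $n$ distinct points of $\mathbf{C}^2$; its *edges* are the ordered pairs of consecutive points. A $3$-gon is also called a triangle. A polygon is *totally degenerate* if all its vertices lie on one line, and *non-degenerate* if no three consecutive vertices are collinear. A *generalized dissection* $\mathcal{D}$ of a polygon $P$ consists of a finite set of triangles and a finite set of polygons called *constraints* such that: (i) every triangle is non-degenerate; (ii) every constraint is totally degenerate, and each of its vertices is a vertex of some triangle of $\mathcal{D}$; (iii) any two distinct constraints share at most one vertex; (iv) the $2$-complex with one abstract polygon for each triangle and each constraint, with vertices labeled by the points and with each edge $(v,w)$ of one polygon glued to the edge $(w,v)$ of another, is an oriented disk with boundary equal to $P$. Let $\mathcal{D}$ be a generalized dissection of a $4$-gon $(p,q,r,s)$, and let $V$ be the set of vertices of its triangles. A *drawing* of $\mathcal{D}$ is a map $\rho:V\to\mathbf{C}^2$ such that (1) for each constraint $C$ the points $\rho(v)$, $v\in C$, lie on a line $\ell_C$; and (2) $\rho(p)+\rho(r)=\rho(q)+\rho(s)$. It is *generic* if moreover (3) no three consecutive points of $(\rho(p),\rho(q),\rho(r),\rho(s))$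 are collinear; (4) $\rho(x),\rho(y),\rho(z)$ are not collinear for each triangle $(x,y,z)$ of $\mathcal{D}$; (5) $\rho$ is injective; and (6) $\ell_C\neq\ell_{C'}$ whenever $C\ne C'$ are constraints with a common vertex. Let $\dot X(\mathcal{D})\subset(\mathbf{C}^2)^V$ be the set of all drawings, and let the *deformation space* $X(\mathcal{D})$ be the closure, in the usual topology of $(\mathbf{C}^2)^V$, of the set of all generic drawings. **Statement.** For every generalized dissection $\mathcal{D}$ of a $4$-gon, the deformation space $X(\mathcal{D})$ is either empty, or it is a rational variety (an irreducible closed algebraic subset of $(\mathbf{C}^2)^V$ whose function field is purely transcendental over $\mathbf{C}$) and an irreducible component of $\dot X(\mathcal{D})$ (a maximal irreducible closed algebraic subset of $\dot X(\mathcal{D})$). -/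

import Mathlib

noncomputable section

/-! ## Cyclically ordered sets and cell complexes built from them -/

/-- `(v, w)` is an edge of the cyclically ordered set `c`: `w` immediately follows `v` in `c`. -/
def IsEdge {α : Type*} (c : Cycle α) (v w : α) : Prop :=
  ∃ l : List α, c = ((v :: w :: l : List α) : Cycle α)

/-- A vertex of the geometric realization, as a standard unit vector. -/
def unitVec {β : Type*} (i : β) : β → ℝ := Set.indicator {i} 1

/-- The geometric realization of the 2-complex built from a family of abstract polygons by gluing
the edge `(v, w)` of one polygon to the edge `(w, v)` of another, vertices being identified
according to their labels.  Each abstract polygon `c` is realized as the cone, with its own apex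
`Sum.inr c`, over its boundary circle: it is the union of the (geometric) triangles with vertices
`v`, `w` and the apex, for all edges `(v, w)` of `c`. -/
def complexRealization {α : Type*} (cells : Set (Cycle α)) : Set (α ⊕ Cycle α → ℝ) :=
  {x | ∃ c ∈ cells, ∃ v w : α, IsEdge c v w ∧
    x ∈ convexHull ℝ {unitVec (Sum.inl v), unitVec (Sum.inl w), unitVec (Sum.inr c)}}

/-- The 2-complex built from the abstract polygons in `cells` is an oriented disk whose
(oriented) boundary is the cyclically ordered set `bdry`. -/
structure IsOrientedDisk {α : Type*} (cells : Set (Cycle α)) (bdry : Cycle α) : Prop where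
  /-- the polygons are coherently oriented: every directed edge belongs to at most one of them -/
  coherent : ∀ c ∈ cells, ∀ c' ∈ cells, ∀ v w : α, IsEdge c v w → IsEdge c' v w → c = c'
  /-- the boundary edges (those that are not glued to another polygon) are the edges of `bdry` -/
  boundary : ∀ v w : α, IsEdge bdry v w ↔
    (∃ c ∈ cells, IsEdge c v w) ∧ ¬ ∃ c ∈ cells, IsEdge c w v
  /-- the complex is homeomorphic to the closed unit disk -/
  disk : Nonempty (complexRealization cells ≃ₜ
    Metric.closedBall (0 : EuclideanSpace ℝ (Fin 2)) 1)

/-! ## Polygons in the affine plane and generalized dissections -/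

/-- The affine plane over the complex numbers. -/
abbrev Plane : Type := Fin 2 → ℂ

/-- A polygon: a cyclically ordered set of at least three distinct points of the plane. -/
def IsPolygon (c : Cycle Plane) : Prop := c.Nodup ∧ 3 ≤ c.length

/-- All vertices of `c` lie on a line. -/
def IsTotallyDegenerate (c : Cycle Plane) : Prop := Collinear ℂ {v | v ∈ c}

/-- No three consecutive vertices of `c` are collinear. -/
def IsNondegenerate (c : Cycle Plane) : Prop :=
  ∀ (x y z : Plane) (l : List Plane), c = ((x :: y :: z :: l : List Plane) : Cycle Plane) →
    ¬ Collinear ℂ {x, y, z}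

/-- A generalized dissection of the polygon `bdry`. -/
structure GeneralizedDissection (bdry : Cycle Plane) where
  boundary_polygon : IsPolygon bdry
  /-- the (oriented) triangles of the dissection -/
  triangles : Finset (Cycle Plane)
  /-- the collinearity constraints -/
  constraints : Finset (Cycle Plane)
  triangles_spec : ∀ t ∈ triangles, IsPolygon t ∧ t.length = 3 ∧ IsNondegenerate t
  constraints_spec : ∀ C ∈ constraints, IsPolygon C ∧ IsTotallyDegenerate C
  constraints_vertices : ∀ C ∈ constraints, ∀ v ∈ C, ∃ t ∈ triangles, v ∈ t
  constraints_inter : ∀ C ∈ constraints, ∀ C' ∈ constraints, C ≠ C' →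
    ∀ v w : Plane, v ∈ C → v ∈ C' → w ∈ C → w ∈ C' → v = w
  isOrientedDisk : IsOrientedDisk {c | c ∈ triangles ∨ c ∈ constraints} bdry

/-- The cyclically ordered quadruple `(p, q, r, s)`. -/
def quad (p q r s : Plane) : Cycle Plane := (([p, q, r, s] : List Plane) : Cycle Plane)

namespace GeneralizedDissection

/-- The vertices of a generalized dissection.  (By `constraints_vertices` these are all vertices of
the associated 2-complex.) -/
def Vertex {bdry : Cycle Plane} (D : GeneralizedDissection bdry) : Type :=
  {x : Plane // ∃ t ∈ D.triangles, x ∈ t}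

theorem exists_triangle_of_edge {bdry : Cycle Plane} (D : GeneralizedDissection bdry)
    {v w : Plane} (h : IsEdge bdry v w) : ∃ t ∈ D.triangles, v ∈ t := by
  obtain ⟨c, hc, l, hl⟩ := ((D.isOrientedDisk.boundary v w).1 h).1
  have hv : v ∈ c := by rw [hl]; simp
  rcases hc with hc | hc
  · exact ⟨c, hc, hv⟩
  · exact D.constraints_vertices c hc v hv

theorem isEdge_quad (p q r s : Plane) : IsEdge (quad p q r s) p q := ⟨[r, s], rfl⟩

theorem quad_rotate (p q r s : Plane) : quad p q r s = quad q r s p :=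
  Quotient.sound ⟨1, rfl⟩

/-- The first corner, as a vertex of the dissection. -/
def cornerP {p q r s : Plane} (D : GeneralizedDissection (quad p q r s)) : D.Vertex :=
  ⟨p, D.exists_triangle_of_edge (isEdge_quad p q r s)⟩

/-- The second corner, as a vertex of the dissection. -/
def cornerQ {p q r s : Plane} (D : GeneralizedDissection (quad p q r s)) : D.Vertex :=
  ⟨q, D.exists_triangle_of_edge (w := r) (by rw [quad_rotate]; exact isEdge_quad q r s p)⟩

/-- The third corner, as a vertex of the dissection. -/
def cornerR {p q r s : Plane} (D : GeneralizedDissection (quad p q r s)) : D.Vertex :=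
  ⟨r, D.exists_triangle_of_edge (w := s)
    (by rw [quad_rotate, quad_rotate]; exact isEdge_quad r s p q)⟩

/-- The fourth corner, as a vertex of the dissection. -/
def cornerS {p q r s : Plane} (D : GeneralizedDissection (quad p q r s)) : D.Vertex :=
  ⟨s, D.exists_triangle_of_edge (w := p)
    (by rw [quad_rotate, quad_rotate, quad_rotate]; exact isEdge_quad s p q r)⟩

/-- The set of images of the vertices of the constraint `C` under `ρ`. -/
def constraintImage {bdry : Cycle Plane} (D : GeneralizedDissection bdry)
    (ρ : D.Vertex → Plane) (C : Cycle Plane) : Set Plane :=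
  ρ '' {v | v.1 ∈ C}

/-- Drawings of (the constrained triangulation associated with) `D`: maps from the vertices to the
plane under which every constraint stays on a line and the four corners form a parallelogram.
The constrained triangulation is obtained from the 2-complex of `D` by triangulating the
poofagons; this adds no vertices, its constraints are the vertex sets of the poofagons, and its
living triangles are the triangles of `D`, so all the data that enter are the ones of `D`. -/
structure IsDrawing {p q r s : Plane} (D : GeneralizedDissection (quad p q r s))
    (ρ : D.Vertex → Plane) : Prop where
  constraint_collinear : ∀ C ∈ D.constraints, Collinear ℂ (D.constraintImage ρ C)
  parallelogram : ρ D.cornerP + ρ D.cornerR = ρ D.cornerQ + ρ D.cornerS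

/-- Generic drawings of (the constrained triangulation associated with) `D`.  In the last condition,
the line of a constraint is the affine span of the images of its (at least three) vertices, which
are distinct and collinear. -/
structure IsGenericDrawing {p q r s : Plane} (D : GeneralizedDissection (quad p q r s))
    (ρ : D.Vertex → Plane) : Prop extends D.IsDrawing ρ where
  boundary_nondegenerate :
    IsNondegenerate (quad (ρ D.cornerP) (ρ D.cornerQ) (ρ D.cornerR) (ρ D.cornerS))
  living_nondegenerate : ∀ x y z : D.Vertex,
    (([x.1, y.1, z.1] : List Plane) : Cycle Plane) ∈ D.triangles →
      ¬ Collinear ℂ {ρ x, ρ y, ρ z}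
  injective : Function.Injective ρ
  lines_ne : ∀ C ∈ D.constraints, ∀ C' ∈ D.constraints, C ≠ C' → (∃ v, v ∈ C ∧ v ∈ C') →
    affineSpan ℂ (D.constraintImage ρ C) ≠ affineSpan ℂ (D.constraintImage ρ C')

/-- The space of all drawings of `D`, in the affine space of all maps from the vertices to the
plane, a map `ρ` being recorded by its coordinates `x (v, i) = ρ v i`. -/
def drawingSpace {p q r s : Plane} (D : GeneralizedDissection (quad p q r s)) :
    Set (D.Vertex × Fin 2 → ℂ) :=
  {x | D.IsDrawing (Function.curry x)}

/-- The deformation space of `D`: the closure of the set of all generic drawings, in the usual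
(Euclidean) topology. -/
def deformationSpace {p q r s : Plane} (D : GeneralizedDissection (quad p q r s)) :
    Set (D.Vertex × Fin 2 → ℂ) :=
  closure {x | D.IsGenericDrawing (Function.curry x)}

end GeneralizedDissection

/-! ## Affine varieties over the complex numbers -/

/-- `X` is the set of common zeros of some polynomials. -/
def IsZariskiClosed {σ : Type*} (X : Set (σ → ℂ)) : Prop :=
  ∃ I : Ideal (MvPolynomial σ ℂ), X = MvPolynomial.zeroLocus ℂ I

/-- `X` is an irreducible closed algebraic set. -/
structure IsIrreducibleVariety {σ : Type*} (X : Set (σ → ℂ)) : Prop where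
  isZariskiClosed : IsZariskiClosed X
  nonempty : X.Nonempty
  irreducible : ∀ A B : Set (σ → ℂ), IsZariskiClosed A → IsZariskiClosed B → X ⊆ A ∪ B →
    X ⊆ A ∨ X ⊆ B

/-- `X` is an irreducible component of `Z`: a maximal irreducible closed subset. -/
def IsIrreducibleComponent {σ : Type*} (X Z : Set (σ → ℂ)) : Prop :=
  Maximal (fun Y : Set (σ → ℂ) => IsIrreducibleVariety Y ∧ Y ⊆ Z) X

/-- The function field of an irreducible variety: the field of fractions of its coordinate ring. -/
abbrev VarietyFunctionField {σ : Type*} (X : Set (σ → ℂ)) : Type _ :=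
  FractionRing (MvPolynomial σ ℂ ⧸ MvPolynomial.vanishingIdeal ℂ X)

/-- `X` is a rational variety: it is irreducible and birational to an affine space, that is, its
function field is purely transcendental over `ℂ`. -/
def IsRationalVariety {σ : Type*} (X : Set (σ → ℂ)) : Prop :=
  IsIrreducibleVariety X ∧
    ∃ d : ℕ, Nonempty (VarietyFunctionField X ≃ₐ[ℂ] FractionRing (MvPolynomial (Fin d) ℂ))

end

/-! A point (x, y) and a non-vertical line y = mx + b are both pairs of numbers, and in the
coordinates (m, -b) for lines incidence is one symmetric equation. Suppose the vertices and
constraints can be listed, starting with the four corners, so that each new element is incident with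
at most two earlier ones. Then configurations are built freely: a new element has two free
parameters, or one, or is the join or intersection of two earlier elements and hence rational in
them. This produces a generic point whose coordinates generate a purely transcendental field and
which specializes to every sufficiently regular configuration
(`Constructible.exists_isGenericConfig`). Restricted to the vertex coordinates it defines an
irreducible variety Z. It is rational because two vertices of a constraint recover its line. All
points of Z are drawings, and Z contains every generic drawing: directly if the first coordinates of
the vertices are distinct, otherwise as a limit of sheared drawings.

The list exists because of planarity. Peeling elements off one by one requires, in each set
containing the corners and something more, a non-corner of degree at most two
(`QuadDisk.exists_card_le_two`). The incidence graph is drawn in the disk with a center for each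
constraint. Two constraints share at most one vertex, so a closed path of incidences has length at
least six, and if all non-corner degrees were at least three, Euler's formula would fail. The
corners, whose degrees are not controlled, are handled by adding the boundary edges to the graph and
by the fact that no constraint contains three consecutive corners once a generic drawing exists.
Euler's formula is used in homological form: the cycle space is spanned by the face boundaries
(`QuadDisk.span_faceCycle`). This is dual to the vanishing of the first cohomology of the disk,
which is proved by lifting circle-valued maps to the real line (`exists_potential`).

Finally, genericity is open: a generic drawing x₀ provides a polynomial h with h(x₀) ≠ 0 such that
every drawing with h ≠ 0 is generic. A nonempty Zariski open subset of an irreducible variety is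
dense in the usual topology (`MvPolynomial.zeroLocus_subset_closure`), so the deformation space
equals Z. An irreducible closed set of drawings containing Z lies in the union of Z and {h = 0}, but
not in {h = 0}, hence in Z. -/

noncomputable section

/-! ## Edges of cyclically ordered sets -/

section Edges
variable {α : Type*} {c : Cycle α} {v w : α}

theorem IsEdge.left_mem (h : IsEdge c v w) : v ∈ c := by
  obtain ⟨l, rfl⟩ := h; simp

theorem IsEdge.right_mem (h : IsEdge c v w) : w ∈ c := by
  obtain ⟨l, rfl⟩ := h; simp

theorem IsEdge.ne (hc : c.Nodup) (h : IsEdge c v w) : v ≠ w := by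
  obtain ⟨l, rfl⟩ := h
  rw [Cycle.nodup_coe_iff] at hc
  rintro rfl
  simp at hc

variable [DecidableEq α]

theorem IsEdge.next_eq (hc : c.Nodup) (h : IsEdge c v w) : c.next hc v h.left_mem = w := by
  obtain ⟨l, rfl⟩ := h
  exact List.next_cons_cons_eq (x := v) (l := l) w (by simp)

theorem isEdge_next (hc : c.Nodup) (h2 : 2 ≤ c.length) (hv : v ∈ c) :
    IsEdge c v (c.next hc v hv) := by
  induction c using Quotient.inductionOn with | _ l
  change v ∈ l at hv
  obtain ⟨l', hl⟩ : ∃ l', l ~r v :: l' := by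
    obtain ⟨s, t, rfl⟩ := List.append_of_mem hv
    exact ⟨t ++ s, List.isRotated_append⟩
  have hq : (Quotient.mk _ l : Cycle α) = ((v :: l' : List α) : Cycle α) := Quotient.sound hl
  obtain _ | ⟨u, m⟩ := l'
  · rw [hq] at h2; simp at h2
  · have he : IsEdge (Quotient.mk _ l : Cycle α) v u := ⟨m, hq⟩
    rw [he.next_eq hc]; exact he

end Edges

/-! ## Integral cellular cocycles on a disk are coboundaries -/

section Topology
open scoped Classical
variable {α : Type*}

/-- The points of a triangle of the realization, described by their coordinates. -/
theorem mem_convexHull_unitVec {β : Type*} {i j k : β} (hij : i ≠ j) (hik : i ≠ k) (hjk : j ≠ k)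
    {x : β → ℝ} (hx : x ∈ convexHull ℝ {unitVec i, unitVec j, unitVec k}) :
    (∀ m, m ≠ i → m ≠ j → m ≠ k → x m = 0) ∧ x i + x j + x k = 1 := by
  have hconv : Convex ℝ {x : β → ℝ | (∀ m, m ≠ i → m ≠ j → m ≠ k → x m = 0) ∧
      x i + x j + x k = 1} := by
    rintro x ⟨hx, hx'⟩ y ⟨hy, hy'⟩ a b - - hab
    refine ⟨fun m h1 h2 h3 => by simp [hx m h1 h2 h3, hy m h1 h2 h3], ?_⟩
    simp only [Pi.add_apply, Pi.smul_apply, smul_eq_mul]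
    linear_combination a * hx' + b * hy' + hab
  refine convexHull_min ?_ hconv hx
  rintro y (rfl | rfl | rfl) <;>
    refine ⟨fun m h1 h2 h3 => ?_, ?_⟩ <;> simp [unitVec, Set.indicator, *, Ne.symm, hij.symm, hik.symm, hjk.symm]

/-- The linear extension to the cell `c` of integers attached to its vertices. -/
def cellExtension (a : Cycle α → α → ℤ) (c : Cycle α) (x : α ⊕ Cycle α → ℝ) : ℝ :=
  ∑ v ∈ c.toFinset, a c v * x (Sum.inl v)

/-- The triangle of the realization over the edge `(v, w)` of the cell `c`. -/
def edgeTriangle (c : Cycle α) (v w : α) : Set (α ⊕ Cycle α → ℝ) :=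
  convexHull ℝ {unitVec (Sum.inl v), unitVec (Sum.inl w), unitVec (Sum.inr c)}

theorem mem_edgeTriangle {c : Cycle α} {v w : α} (hvw : v ≠ w) {x : α ⊕ Cycle α → ℝ}
    (hx : x ∈ edgeTriangle c v w) :
    (∀ m, m ≠ Sum.inl v → m ≠ Sum.inl w → m ≠ Sum.inr c → x m = 0) ∧
      x (Sum.inl v) + x (Sum.inl w) + x (Sum.inr c) = 1 :=
  mem_convexHull_unitVec (by simpa using hvw) (by simp) (by simp) hx

theorem cellExtension_eq (a : Cycle α → α → ℤ) {c : Cycle α} {v w : α} (hc : c.Nodup)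
    (he : IsEdge c v w) {x : α ⊕ Cycle α → ℝ} (hx : x ∈ edgeTriangle c v w) :
    cellExtension a c x = a c v * x (Sum.inl v) + a c w * x (Sum.inl w) := by
  have hvw := he.ne hc
  have hx' := (mem_edgeTriangle hvw hx).1
  unfold cellExtension
  have hmem : ∀ u, u ∈ c.toFinset ↔ u ∈ c := fun u => by
    induction c using Quotient.inductionOn with | _ l
    exact List.mem_toFinset
  refine Finset.sum_eq_add v w hvw (fun u _ hu => ?_) (fun h => absurd ((hmem v).2 he.left_mem) h)
    (fun h => absurd ((hmem w).2 he.right_mem) h)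
  rw [hx' (Sum.inl u) (by simpa using hu.1) (by simpa using hu.2) (by simp), mul_zero]

theorem continuous_cellExtension (a : Cycle α → α → ℤ) (c : Cycle α) :
    Continuous (cellExtension a c) := by
  unfold cellExtension; fun_prop

/-- At a common point of two distinct cells both apex coordinates vanish, so the point is a vertex
or lies inside a common edge. At a vertex both extensions are integers. Along an edge, coherence
forces opposite directions and `ha` makes the difference constant, equal to its integer value at an
end. Thus the extensions glue to a map into the circle. -/
theorem cellExtension_sub_mem_int (cells : Set (Cycle α)) (hnd : ∀ c ∈ cells, c.Nodup)
    (hcoh : ∀ c ∈ cells, ∀ c' ∈ cells, ∀ v w : α, IsEdge c v w → IsEdge c' v w → c = c')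
    (a : Cycle α → α → ℤ)
    (ha : ∀ c ∈ cells, ∀ c' ∈ cells, ∀ v w : α, IsEdge c v w → IsEdge c' w v →
      a c w - a c v = a c' w - a c' v)
    {c c' : Cycle α} (hc : c ∈ cells) (hc' : c' ∈ cells) {v w v' w' : α}
    (he : IsEdge c v w) (he' : IsEdge c' v' w') {x : α ⊕ Cycle α → ℝ}
    (hx : x ∈ edgeTriangle c v w) (hx' : x ∈ edgeTriangle c' v' w') :
    ∃ n : ℤ, cellExtension a c x - cellExtension a c' x = n := by
  by_cases hcc : c = c'
  · subst hcc; exact ⟨0, by simp⟩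
  rw [cellExtension_eq a (hnd c hc) he hx, cellExtension_eq a (hnd c' hc') he' hx']
  have hne := he.ne (hnd c hc)
  have hne' := he'.ne (hnd c' hc')
  obtain ⟨h0, h1⟩ := mem_edgeTriangle hne hx
  obtain ⟨h0', h1'⟩ := mem_edgeTriangle hne' hx'
  have hxc : x (Sum.inr c) = 0 := h0' _ (by simp) (by simp) (by simpa using hcc)
  have hxc' : x (Sum.inr c') = 0 := h0 _ (by simp) (by simp) (by simpa using Ne.symm hcc)
  rw [hxc, add_zero] at h1
  rw [hxc', add_zero] at h1'
  have key : ∀ u, u ≠ v → u ≠ w → x (Sum.inl u) = 0 := fun u h1 h2 =>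
    h0 _ (by simpa using h1) (by simpa using h2) (by simp)
  have key' : ∀ u, u ≠ v' → u ≠ w' → x (Sum.inl u) = 0 := fun u h1 h2 =>
    h0' _ (by simpa using h1) (by simpa using h2) (by simp)
  by_cases hv : x (Sum.inl v) = 0
  · have hw : x (Sum.inl w) = 1 := by linarith
    have : w = v' ∨ w = w' := by
      by_contra! h; simp [key' w h.1 h.2] at hw
    obtain rfl | rfl := this
    · refine ⟨a c w - a c' w, ?_⟩
      have : x (Sum.inl w') = 0 := by linarith
      rw [hv, hw, this]; push_cast; ring
    · refine ⟨a c w - a c' w, ?_⟩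
      have : x (Sum.inl v') = 0 := by linarith
      rw [hv, hw, this]; push_cast; ring
  by_cases hw : x (Sum.inl w) = 0
  · have hv : x (Sum.inl v) = 1 := by linarith
    have : v = v' ∨ v = w' := by
      by_contra! h; simp [key' v h.1 h.2] at hv
    obtain rfl | rfl := this
    · refine ⟨a c v - a c' v, ?_⟩
      have : x (Sum.inl w') = 0 := by linarith
      rw [hv, hw, this]; push_cast; ring
    · refine ⟨a c v - a c' v, ?_⟩
      have : x (Sum.inl v') = 0 := by linarith
      rw [hv, hw, this]; push_cast; ring
  have hv' : v = v' ∨ v = w' := by by_contra! h; exact hv (key' v h.1 h.2)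
  have hw' : w = v' ∨ w = w' := by by_contra! h; exact hw (key' w h.1 h.2)
  obtain rfl | rfl := hv'
  · obtain rfl | rfl := hw'
    · exact absurd rfl hne
    · exact absurd (hcoh c hc c' hc' _ _ he he') hcc
  · obtain rfl | rfl := hw'
    · refine ⟨a c v - a c' v, ?_⟩
      have h2 := ha c hc c' hc' _ _ he he'
      have h3 : (a c w : ℝ) - a c v = a c' w - a c' v := by exact_mod_cast h2
      have h4 : x (Sum.inl w) = 1 - x (Sum.inl v) := by linarith
      rw [h4]; push_cast
      linear_combination (1 - x (Sum.inl v)) * h3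
    · exact absurd rfl hne

theorem isClosed_edgeTriangle (c : Cycle α) (v w : α) : IsClosed (edgeTriangle c v w) :=
  ((Set.toFinite _).isCompact_convexHull ℝ).isClosed

theorem finite_setOf_isEdge {c : Cycle α} (hc : c.Nodup) : {e : α × α | IsEdge c e.1 e.2}.Finite := by
  have hmem : ∀ u, u ∈ c → u ∈ c.toFinset := fun u hu => by
    induction c using Quotient.inductionOn with | _ l
    exact List.mem_toFinset.2 hu
  refine (c.toFinset ×ˢ c.toFinset).finite_toSet.subset fun e he => ?_
  simpa using ⟨hmem _ (IsEdge.left_mem he), hmem _ (IsEdge.right_mem he)⟩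

/-- A compatible system of integers on the vertices of the cells of a disk comes from a function
on the vertices, up to a constant on each cell. -/
theorem exists_potential (cells : Set (Cycle α)) (hfin : cells.Finite)
    (hnd : ∀ c ∈ cells, c.Nodup)
    (hcoh : ∀ c ∈ cells, ∀ c' ∈ cells, ∀ v w : α, IsEdge c v w → IsEdge c' v w → c = c')
    (hdisk : Nonempty (complexRealization cells ≃ₜ
      Metric.closedBall (0 : EuclideanSpace ℝ (Fin 2)) 1))
    (a : Cycle α → α → ℤ)
    (ha : ∀ c ∈ cells, ∀ c' ∈ cells, ∀ v w : α, IsEdge c v w → IsEdge c' w v →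
      a c w - a c v = a c' w - a c' v) :
    ∃ (κ : Cycle α → ℤ) (H : α → ℤ), ∀ c ∈ cells, ∀ v w, IsEdge c v w → a c v = κ c + H v := by
  obtain ⟨e⟩ := hdisk
  set K := complexRealization cells
  have hex : ∀ x : K, ∃ c ∈ cells, ∃ v w : α, IsEdge c v w ∧ x.1 ∈ edgeTriangle c v w :=
    fun x => x.2
  choose! γ hγ vv ww hE hxE using hex
  let f : K → UnitAddCircle := fun x => ((cellExtension a (γ x) x.1 : ℝ) : UnitAddCircle)
  have hf : ∀ (x : K) (c) (_ : c ∈ cells) (v w) (_ : IsEdge c v w) (_ : x.1 ∈ edgeTriangle c v w),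
      f x = ((cellExtension a c x.1 : ℝ) : UnitAddCircle) := by
    intro x c hc v w he hx
    obtain ⟨n, hn⟩ := cellExtension_sub_mem_int cells hnd hcoh a ha hc (hγ x) he (hE x) hx (hxE x)
    have hz : ((n : ℝ) : UnitAddCircle) = 0 := AddCircle.coe_eq_zero_iff 1 |>.2 ⟨n, by simp⟩
    rw [← hn, AddCircle.coe_sub, sub_eq_zero] at hz
    exact hz.symm
  have hcont : Continuous f := by
    have := hfin.to_subtype
    let F : cells → Set K := fun c => ⋃ p ∈ {p : α × α | IsEdge c.1 p.1 p.2},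
      Subtype.val ⁻¹' edgeTriangle c.1 p.1 p.2
    refine (locallyFinite_of_finite F).continuous ?_ (fun c => ?_) (fun c => ?_)
    · refine Set.eq_univ_of_forall fun x => Set.mem_iUnion.2 ⟨⟨γ x, hγ x⟩, ?_⟩
      exact Set.mem_biUnion (x := (vv x, ww x)) (hE x) (hxE x)
    · exact (finite_setOf_isEdge (hnd c c.2)).isClosed_biUnion fun p _ =>
        (isClosed_edgeTriangle _ _ _).preimage continuous_subtype_val
    · have h1 : Continuous fun x : K => ((cellExtension a c.1 x.1 : ℝ) : UnitAddCircle) :=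
        (AddCircle.continuous_mk' 1).comp
          ((continuous_cellExtension a c.1).comp continuous_subtype_val)
      refine h1.continuousOn.congr fun x hx => ?_
      obtain ⟨p, hp, hx⟩ := Set.mem_iUnion₂.1 hx
      exact hf x c c.2 p.1 p.2 hp hx
  have hcov : IsCoveringMap ((↑) : ℝ → UnitAddCircle) := AddCircle.isCoveringMap_coe 1
  have : ContractibleSpace (Metric.closedBall (0 : EuclideanSpace ℝ (Fin 2)) 1) :=
    Metric.contractibleSpace_closedBall zero_le_one
  have : LocallyPathConnectedSpace (Metric.closedBall (0 : EuclideanSpace ℝ (Fin 2)) 1) :=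
    (convex_closedBall _ _).locallyPathConnectedSpace
  let f' : C(Metric.closedBall (0 : EuclideanSpace ℝ (Fin 2)) 1, UnitAddCircle) :=
    ⟨fun y => f (e.symm y), hcont.comp e.symm.continuous⟩
  -- The disk is contractible and locally path connected, so the circle-valued map lifts through the
  -- covering ℝ → ℝ/ℤ.
  obtain ⟨e₀, he₀⟩ := QuotientAddGroup.mk_surjective (f' ⟨0, by simp⟩)
  obtain ⟨G', ⟨-, hG'⟩, -⟩ := hcov.existsUnique_continuousMap_lifts f' ⟨0, by simp⟩ e₀ he₀
  let G : K → ℝ := fun x => G' (e x)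
  have hGc : Continuous G := G'.continuous.comp e.continuous
  have hG : ∀ x, ((G x : ℝ) : UnitAddCircle) = f x := fun x => by
    have := congrFun hG' (e x)
    simpa [f'] using this
  -- The value 0 outside `K` is never used. At apexes and vertices of cells the lift turns out to be
  -- an integer, so `round` merely reads that integer off.
  let E : (α ⊕ Cycle α → ℝ) → ℝ := fun y => if h : y ∈ K then G ⟨y, h⟩ else 0
  refine ⟨fun c => -round (E (unitVec (Sum.inr c))), fun v => round (E (unitVec (Sum.inl v))),
    fun c hc v w he => ?_⟩
  have hsub : edgeTriangle c v w ⊆ K := fun y hy => ⟨c, hc, v, w, he, hy⟩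
  have hv : unitVec (Sum.inl v) ∈ edgeTriangle c v w := subset_convexHull ℝ _ (by simp)
  have hap : unitVec (Sum.inr c) ∈ edgeTriangle c v w := subset_convexHull ℝ _ (by simp)
  have hvw := he.ne (hnd c hc)
  have hgap : cellExtension a c (unitVec (Sum.inr c)) = 0 := by
    rw [cellExtension_eq a (hnd c hc) he hap]; simp [unitVec]
  have hgv : cellExtension a c (unitVec (Sum.inl v)) = a c v := by
    rw [cellExtension_eq a (hnd c hc) he hv]; simp [unitVec, hvw.symm]
  obtain ⟨n, hn⟩ : ∃ n : ℤ, (n : ℝ) = G ⟨_, hsub hap⟩ := by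
    have := hG ⟨_, hsub hap⟩
    rw [hf _ c hc v w he hap, hgap] at this
    obtain ⟨n, hn⟩ := (AddCircle.coe_eq_zero_iff 1).1 (this.trans (by simp))
    exact ⟨n, by simpa using hn⟩
  have : PreconnectedSpace (edgeTriangle c v w) :=
    Subtype.preconnectedSpace (convex_convexHull ℝ _).isPreconnected
  -- Both functions lift the same map on a connected triangle and agree at the apex, so they agree
  -- at the vertex `v`, where the lift is therefore `a c v + n`.
  have hlift := hcov.eq_of_comp_eq (A := edgeTriangle c v w)
    (g₁ := fun y => G ⟨y.1, hsub y.2⟩) (g₂ := fun y => cellExtension a c y.1 + n)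
    (hGc.comp (by fun_prop)) (by have := continuous_cellExtension a c; fun_prop)
    (by
      ext y
      have hz : ((n : ℝ) : UnitAddCircle) = 0 := AddCircle.coe_eq_zero_iff 1 |>.2 ⟨n, by simp⟩
      simp only [Function.comp_apply]
      rw [hG, hf _ c hc v w he y.2, AddCircle.coe_add, hz, add_zero]) ⟨_, hap⟩
    (by simp [hgap, hn])
  have h1 := congrFun hlift ⟨_, hv⟩
  simp only [hgv] at h1
  have hEv : E (unitVec (Sum.inl v)) = ((a c v + n : ℤ) : ℝ) := by
    simp only [E, dif_pos (hsub hv), h1]; push_cast; rfl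
  have hEc : E (unitVec (Sum.inr c)) = (n : ℤ) := by
    simp only [E, dif_pos (hsub hap), hn]
  beta_reduce
  rw [hEv, hEc, round_intCast, round_intCast]; ring

end Topology
end

noncomputable section

/-! ## Combinatorial disks bounded by a quadrilateral -/

open scoped Classical in
/-- Combinatorial data of a disk glued from polygons along edges, with a quadrilateral as boundary.
An element of `Φ` is a flag: a cell with one of its vertices, or equivalently with the edge that
starts there. The permutation `nx` passes to the next flag of the cell, and `rev` to the flag of the
reversed edge in the adjacent cell; its fixed points are the flags of the boundary edges. -/
structure QuadDisk (Φ V C : Type*) where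
  vert : Φ → V
  cell : Φ → C
  nx : Equiv.Perm Φ
  rev : Φ → Φ
  bd : Fin 4 → Φ
  corner : Fin 4 → V
  cell_nx : ∀ x, cell (nx x) = cell x
  ext : ∀ x y, vert x = vert y → cell x = cell y → x = y
  rev_rev : ∀ x, rev (rev x) = x
  vert_rev : ∀ x, rev x ≠ x → vert (rev x) = vert (nx x)
  rev_eq_self : ∀ x, rev x = x ↔ ∃ i, x = bd i
  vert_bd : ∀ i, vert (bd i) = corner i
  vert_nx_bd : ∀ i, vert (nx (bd i)) = corner (i + 1)
  corner_injective : Function.Injective corner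
  /-- cellular 1-cocycles are coboundaries -/
  exact : ∀ α : Φ → ℚ, (∀ x, rev x ≠ x → α (nx x) - α x = α (rev x) - α (nx (rev x))) →
    ∃ (κ : C → ℚ) (H : V → ℚ), ∀ x, α x = κ (cell x) + H (vert x)

namespace QuadDisk

open scoped Classical

variable {Φ V C : Type*} (D : QuadDisk Φ V C)

theorem bd_injective : Function.Injective D.bd := fun i j h =>
  D.corner_injective (by rw [← D.vert_bd, h, D.vert_bd])

variable [Fintype Φ]

/-- The incidence of the boundary edge `i` with the vertex `v`. -/
def bdIncidence (i : Fin 4) (v : V) : ℚ :=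
  (if D.corner i = v then 1 else 0) - if D.corner (i + 1) = v then 1 else 0

/-- The boundary of a chain on the spokes (one for each flag) and the boundary edges, at `v`. -/
def vertexSum (z : Φ ⊕ Fin 4 → ℚ) (v : V) : ℚ :=
  ∑ x with D.vert x = v, z (Sum.inl x) + ∑ i, z (Sum.inr i) * D.bdIncidence i v

/-- The boundary of a chain on the spokes and the boundary edges, at the center of a cell. -/
def cellSum (z : Φ ⊕ Fin 4 → ℚ) (c : C) : ℚ := ∑ x with D.cell x = c, z (Sum.inl x)

/-- The boundary of a 2-chain that is constant along the interior edges. -/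
def bdry (b : Φ → ℚ) : Φ ⊕ Fin 4 → ℚ :=
  Sum.elim (fun x => b (D.nx.symm x) - b x) fun i => b (D.bd i)

/-- Cycles on the spokes and the boundary edges are boundaries. -/
theorem exists_bdry_eq [Fintype V] [Fintype C] (z : Φ ⊕ Fin 4 → ℚ)
    (hv : ∀ v, D.vertexSum z v = 0) (hc : ∀ c, D.cellSum z c = 0) :
    ∃ b : Φ → ℚ, (∀ x, b (D.rev x) = b x) ∧ D.bdry b = z := by
  -- The first component measures the jump of `b` across edges, so the claim is that `(0, z)` lies
  -- in the range. Otherwise some functional kills the range but not `(0, z)`; its coefficients on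
  -- the spokes will be a cocycle.
  let L : (Φ → ℚ) →ₗ[ℚ] (Φ → ℚ) × (Φ ⊕ Fin 4 → ℚ) :=
    { toFun := fun b => (fun x => b x - b (D.rev x), D.bdry b)
      map_add' := fun b b' => by
        ext x
        · simp; ring
        · obtain x | i := x <;> simp [bdry]; ring
      map_smul' := fun r b => by
        ext x
        · simp; ring
        · obtain x | i := x <;> simp [bdry]; ring }
  suffices h : ((0, z) : (Φ → ℚ) × (Φ ⊕ Fin 4 → ℚ)) ∈ LinearMap.range L by
    obtain ⟨b, hb⟩ := h
    refine ⟨b, fun x => ?_, congrArg Prod.snd hb⟩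
    have := congrFun (congrArg Prod.fst hb) x
    simp [L] at this
    linarith
  by_contra hz
  obtain ⟨f, hf, hL⟩ := Submodule.exists_le_ker_of_notMem hz
  let β : Φ → ℚ := fun x => f (Pi.single x 1, 0)
  let γ : Φ ⊕ Fin 4 → ℚ := fun e => f (0, Pi.single e 1)
  have hfeq : ∀ u w, f (u, w) = ∑ x, u x * β x + ∑ e, w e * γ e := by
    intro u w
    have h1 : (u, w) = ∑ x, u x • ((Pi.single x 1, 0) : (Φ → ℚ) × (Φ ⊕ Fin 4 → ℚ)) +
        ∑ e, w e • ((0, Pi.single e 1) : (Φ → ℚ) × (Φ ⊕ Fin 4 → ℚ)) := by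
      ext y
      · simp [Prod.fst_sum, Finset.sum_apply, Pi.single_apply]
      · simp [Prod.snd_sum, Finset.sum_apply, Pi.single_apply, -Fintype.sum_sum_type]
    rw [h1, map_add, map_sum, map_sum]
    simp only [map_smul, smul_eq_mul, β, γ]
  have hL' : ∀ b : Φ → ℚ, ∑ x, (b x - b (D.rev x)) * β x + (∑ x, (b (D.nx.symm x) - b x) * γ (Sum.inl x) +
      ∑ i, b (D.bd i) * γ (Sum.inr i)) = 0 := by
    intro b
    have : f (L b) = 0 := hL ⟨b, rfl⟩
    rw [show L b = (fun x => b x - b (D.rev x), D.bdry b) from rfl, hfeq,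
      Fintype.sum_sum_type] at this
    exact this
  have hrevinv : Function.Involutive D.rev := D.rev_rev
  -- This is the coefficient of `f ∘ L` at `y`. Adding the relations at `x` and `rev x` cancels `β`
  -- and leaves the cocycle condition for `γ` on the spokes. On a boundary edge `β` cancels by
  -- itself, which determines `γ` there.
  have hcoef : ∀ y, β y - β (D.rev y) + (γ (Sum.inl (D.nx y)) - γ (Sum.inl y) +
      ∑ i, if D.bd i = y then γ (Sum.inr i) else 0) = 0 := by
    intro y
    have := hL' (Pi.single y 1)
    simp only [sub_mul, Finset.sum_sub_distrib, Pi.single_apply, ite_mul, one_mul, zero_mul] at this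
    simpa [hrevinv.eq_iff, Equiv.symm_apply_eq] using this
  obtain ⟨κ, H, hα⟩ := D.exact (fun x => γ (Sum.inl x)) (fun x hx => by
    have h1 := hcoef x
    have h2 := hcoef (D.rev x)
    have e1 : ∀ i, D.bd i ≠ x := fun i h => hx ((D.rev_eq_self x).2 ⟨i, h.symm⟩)
    have e2 : ∀ i, D.bd i ≠ D.rev x := fun i h =>
      hx (by have := (D.rev_eq_self (D.rev x)).2 ⟨i, h.symm⟩; rw [D.rev_rev] at this; exact this.symm)
    simp only [e1, e2, if_false, Finset.sum_const_zero, D.rev_rev] at h1 h2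
    linarith)
  have hγ : ∀ i, γ (Sum.inr i) = H (D.corner i) - H (D.corner (i + 1)) := by
    intro i
    have h1 := hcoef (D.bd i)
    have e1 : D.rev (D.bd i) = D.bd i := (D.rev_eq_self _).2 ⟨i, rfl⟩
    simp only [e1, hα, D.bd_injective.eq_iff, Finset.sum_ite_eq', Finset.mem_univ, if_true,
      D.cell_nx, D.vert_bd, D.vert_nx_bd] at h1
    linarith
  refine hf ?_
  rw [hfeq, Fintype.sum_sum_type]
  simp only [hα, hγ, Pi.zero_apply, zero_mul, Finset.sum_const_zero, zero_add, mul_add,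
    Finset.sum_add_distrib]
  have s1 : ∑ x, z (Sum.inl x) * κ (D.cell x) = 0 := by
    rw [← Finset.sum_fiberwise (s := Finset.univ) (g := D.cell)]
    refine Finset.sum_eq_zero fun c _ => ?_
    rw [Finset.sum_congr rfl (g := fun x => z (Sum.inl x) * κ c)
      (fun x hx => by rw [(Finset.mem_filter.1 hx).2]), ← Finset.sum_mul]
    have := hc c
    rw [cellSum] at this
    rw [this, zero_mul]
  -- With `γ` a coboundary, pairing it with `z` amounts to pairing the potentials `κ` and `H` with
  -- the boundary of `z`, which is zero.
  have s2 : ∑ x, z (Sum.inl x) * H (D.vert x) +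
      ∑ i, z (Sum.inr i) * (H (D.corner i) - H (D.corner (i + 1))) = ∑ v, D.vertexSum z v * H v := by
    simp only [vertexSum, add_mul, Finset.sum_add_distrib]
    congr 1
    · rw [← Finset.sum_fiberwise (s := Finset.univ) (g := D.vert)]
      refine Finset.sum_congr rfl fun v _ => ?_
      rw [Finset.sum_mul]
      exact Finset.sum_congr rfl fun x hx => by rw [(Finset.mem_filter.1 hx).2]
    · simp only [Finset.sum_mul]
      rw [Finset.sum_comm]
      refine Finset.sum_congr rfl fun i _ => ?_
      simp [bdIncidence, mul_assoc, ← Finset.mul_sum, sub_mul]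
  rw [s1, zero_add, s2]
  simp [hv]

end QuadDisk
end

/-! ### Cycle space and faces of a graph of spokes and boundary edges -/

noncomputable section

namespace QuadDisk

open scoped Classical

variable {Φ V C : Type*} (D : QuadDisk Φ V C) [Fintype Φ]

/-- The cycles on the graph formed by the spokes in `I` and the boundary edges in `J`. -/
def cycles (I : Finset Φ) (J : Finset (Fin 4)) : Submodule ℚ (Φ ⊕ Fin 4 → ℚ) where
  carrier := {z | (∀ x, x ∉ I → z (Sum.inl x) = 0) ∧ (∀ i, i ∉ J → z (Sum.inr i) = 0) ∧
    (∀ v, D.vertexSum z v = 0) ∧ ∀ c, D.cellSum z c = 0}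
  zero_mem' := by simp [vertexSum, cellSum]
  add_mem' := by
    rintro z z' ⟨h1, h2, h3, h4⟩ ⟨h1', h2', h3', h4'⟩
    refine ⟨fun x hx => by simp [h1 x hx, h1' x hx], fun x hx => by simp [h2 x hx, h2' x hx],
      fun v => ?_, fun c => ?_⟩
    · have := congrArg₂ (· + ·) (h3 v) (h3' v)
      simp only [vertexSum, Pi.add_apply, add_mul, Finset.sum_add_distrib, add_zero] at this ⊢
      linarith
    · have := congrArg₂ (· + ·) (h4 c) (h4' c)
      simpa only [cellSum, Pi.add_apply, Finset.sum_add_distrib, add_zero] using this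
  smul_mem' := by
    rintro r z ⟨h1, h2, h3, h4⟩
    refine ⟨fun x hx => by simp [h1 x hx], fun x hx => by simp [h2 x hx], fun v => ?_, fun c => ?_⟩
    · have := congrArg (r * ·) (h3 v)
      simpa only [vertexSum, Pi.smul_apply, smul_eq_mul, mul_assoc, ← Finset.mul_sum, ← mul_add,
        mul_zero] using this
    · have := congrArg (r * ·) (h4 c)
      simpa only [cellSum, Pi.smul_apply, smul_eq_mul, ← Finset.mul_sum, mul_zero] using this

/-- Adjacency of flags within a face of the graph formed by the spokes in `I` and the boundary edges
in `J`; `none` stands for the exterior. -/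
inductive FaceAdj (I : Finset Φ) (J : Finset (Fin 4)) : Option Φ → Option Φ → Prop
  | spoke (x : Φ) (h : x ∉ I) : FaceAdj I J (some (D.nx.symm x)) (some x)
  | edge (x : Φ) : FaceAdj I J (some (D.rev x)) (some x)
  | exterior (i : Fin 4) (h : i ∉ J) : FaceAdj I J (some (D.bd i)) none

variable (I : Finset Φ) (J : Finset (Fin 4))

/-- The faces of the graph formed by the spokes in `I` and the boundary edges in `J`. -/
def Face : Type _ := Quot (D.FaceAdj I J)

instance : Finite (D.Face I J) := Quot.finite _

instance : Fintype (D.Face I J) := Fintype.ofFinite _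

/-- The face of a flag, or of the exterior. -/
def face (x : Option Φ) : D.Face I J := Quot.mk _ x

/-- The boundary of a face. -/
def faceCycle (f : D.Face I J) : Φ ⊕ Fin 4 → ℚ :=
  D.bdry fun x => if D.face I J (some x) = f then 1 else 0

variable {I J}

omit [Fintype Φ] in
theorem faceCycle_inl_ne_zero {f : D.Face I J} {x : Φ} (h : D.faceCycle I J f (Sum.inl x) ≠ 0) :
    D.face I J (some (D.nx.symm x)) = f ∨ D.face I J (some x) = f := by
  by_contra! hn
  simp [faceCycle, bdry, hn.1, hn.2] at h

omit [Fintype Φ] in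
theorem faceCycle_inr_ne_zero {f : D.Face I J} {i : Fin 4}
    (h : D.faceCycle I J f (Sum.inr i) ≠ 0) : D.face I J (some (D.bd i)) = f := by
  by_contra hn
  simp [faceCycle, bdry, hn] at h

/-- At a vertex, a flag ending there contributes `b` and a flag starting there contributes `-b`.
Interior flags cancel in pairs under `rev`, and boundary flags cancel against the boundary edge
terms. At a center the sum vanishes because `nx` permutes the flags of the cell. -/
theorem bdry_mem_cycles (b : Φ → ℚ) (hI : ∀ x, x ∉ I → b (D.nx.symm x) = b x)
    (hrev : ∀ x, b (D.rev x) = b x) (hJ : ∀ i, i ∉ J → b (D.bd i) = 0) :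
    D.bdry b ∈ D.cycles I J := by
  refine ⟨fun x hx => by simp [bdry, hI x hx], fun i hi => by simp [bdry, hJ i hi],
    fun v => ?_, fun c => ?_⟩
  · have h1 : ∑ x with D.vert x = v, b (D.nx.symm x) = ∑ y with D.vert (D.nx y) = v, b y := by
      simp only [Finset.sum_filter]
      exact Fintype.sum_equiv D.nx.symm _ _ fun x => by simp
    have h2 : ∑ y with D.vert (D.nx y) = v, b y =
        ∑ y with D.vert (D.nx y) = v ∧ D.rev y ≠ y, b y +
          ∑ i with D.corner (i + 1) = v, b (D.bd i) := by
      rw [← Finset.sum_filter_not_add_sum_filter _ (fun y => D.rev y = y)]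
      rw [Finset.filter_filter, Finset.filter_filter]
      congr 1
      refine (Finset.sum_bij (fun i _ => D.bd i) ?_ (fun i _ j _ h => D.bd_injective h) ?_
        fun _ _ => rfl).symm
      · intro i hi
        simp only [Finset.mem_filter, Finset.mem_univ, true_and] at hi ⊢
        exact ⟨by rw [D.vert_nx_bd, hi], (D.rev_eq_self _).2 ⟨i, rfl⟩⟩
      · intro y hy
        simp only [Finset.mem_filter, Finset.mem_univ, true_and] at hy
        obtain ⟨i, rfl⟩ := (D.rev_eq_self _).1 hy.2
        exact ⟨i, by simpa [D.vert_nx_bd] using hy.1, rfl⟩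
    have h3 : ∑ y with D.vert y = v, b y =
        ∑ y with D.vert y = v ∧ D.rev y ≠ y, b y +
          ∑ i with D.corner i = v, b (D.bd i) := by
      rw [← Finset.sum_filter_not_add_sum_filter _ (fun y => D.rev y = y)]
      rw [Finset.filter_filter, Finset.filter_filter]
      congr 1
      refine (Finset.sum_bij (fun i _ => D.bd i) ?_ (fun i _ j _ h => D.bd_injective h) ?_
        fun _ _ => rfl).symm
      · intro i hi
        simp only [Finset.mem_filter, Finset.mem_univ, true_and] at hi ⊢
        exact ⟨by rw [D.vert_bd, hi], (D.rev_eq_self _).2 ⟨i, rfl⟩⟩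
      · intro y hy
        simp only [Finset.mem_filter, Finset.mem_univ, true_and] at hy
        obtain ⟨i, rfl⟩ := (D.rev_eq_self _).1 hy.2
        exact ⟨i, by simpa [D.vert_bd] using hy.1, rfl⟩
    have h4 : ∑ y with D.vert (D.nx y) = v ∧ D.rev y ≠ y, b y =
        ∑ y with D.vert y = v ∧ D.rev y ≠ y, b y := by
      refine Finset.sum_bij (fun y _ => D.rev y) ?_
        (fun x _ y _ h => by simpa [D.rev_rev] using congrArg D.rev h) ?_
        fun y _ => (hrev y).symm
      · intro y hy
        simp only [Finset.mem_filter, Finset.mem_univ, true_and] at hy ⊢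
        exact ⟨by rw [D.vert_rev y hy.2, hy.1], fun h => hy.2 (by rw [D.rev_rev] at h; exact h.symm)⟩
      · intro y hy
        simp only [Finset.mem_filter, Finset.mem_univ, true_and] at hy
        have hy' : D.rev (D.rev y) ≠ D.rev y := fun h => hy.2 (by rw [D.rev_rev] at h; exact h.symm)
        refine ⟨D.rev y, ?_, D.rev_rev y⟩
        simp only [Finset.mem_filter, Finset.mem_univ, true_and]
        exact ⟨by rw [← D.vert_rev _ hy', D.rev_rev, hy.1], hy'⟩
    simp only [vertexSum, bdry, Sum.elim_inl, Sum.elim_inr, Finset.sum_sub_distrib, bdIncidence,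
      mul_sub, mul_ite, mul_one, mul_zero, ← Finset.sum_filter]
    rw [h1, h2, h3, h4]
    ring
  · simp only [cellSum, bdry, Sum.elim_inl, Finset.sum_sub_distrib]
    rw [sub_eq_zero]
    simp only [Finset.sum_filter]
    refine Fintype.sum_equiv D.nx.symm _ _ fun x => ?_
    rw [show D.cell (D.nx.symm x) = D.cell x by
      conv_rhs => rw [← D.nx.apply_symm_apply x, D.cell_nx]]

theorem faceCycle_mem (f : D.Face I J) (hf : f ≠ D.face I J none) :
    D.faceCycle I J f ∈ D.cycles I J := by
  refine D.bdry_mem_cycles _ (fun x hx => ?_) (fun x => ?_) (fun i hi => ?_)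
  · rw [show D.face I J (some (D.nx.symm x)) = D.face I J (some x) from
      Quot.sound (FaceAdj.spoke x hx)]
  · rw [show D.face I J (some (D.rev x)) = D.face I J (some x) from Quot.sound (FaceAdj.edge x)]
  · rw [show D.face I J (some (D.bd i)) = D.face I J none from Quot.sound (FaceAdj.exterior i hi),
      if_neg (Ne.symm hf)]

/-- The cycles are spanned by the boundaries of the faces other than the exterior. -/
theorem span_faceCycle [Fintype V] [Fintype C] :
    Submodule.span ℚ (Set.range fun f : {f // f ≠ D.face I J none} => D.faceCycle I J f.1) =
      D.cycles I J := by
  refine le_antisymm (Submodule.span_le.2 ?_) fun z hz => ?_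
  · rintro _ ⟨f, rfl⟩; exact D.faceCycle_mem f.1 f.2
  obtain ⟨h1, h2, h3, h4⟩ := hz
  obtain ⟨b, hrev, rfl⟩ := D.exists_bdry_eq z h3 h4
  -- A 2-chain whose boundary is supported on `I` and `J` does not jump across the other spokes and
  -- vanishes at the other boundary edges. Hence it descends to the faces, with value 0 on the
  -- exterior.
  let β : D.Face I J → ℚ := Quot.lift (fun x => x.elim 0 b) (by
    rintro _ _ (⟨x, hx⟩ | x | ⟨i, hi⟩)
    · have := h1 x hx
      simp only [bdry, Sum.elim_inl] at this
      simp only [Option.elim]; linarith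
    · exact hrev x
    · exact h2 i hi)
  have hβ0 : β (D.face I J none) = 0 := rfl
  have hβ : ∀ x, β (D.face I J (some x)) = b x := fun x => rfl
  have hz : D.bdry b = ∑ f, β f • D.faceCycle I J f := by
    ext e
    obtain x | i := e
    · simp [bdry, faceCycle, Finset.sum_apply, mul_sub, hβ]
    · simp [bdry, faceCycle, Finset.sum_apply, hβ]
  rw [hz]
  refine Submodule.sum_mem _ fun f _ => ?_
  by_cases hf : f = D.face I J none
  · rw [hf, hβ0, zero_smul]; exact Submodule.zero_mem _
  · exact Submodule.smul_mem _ _ (Submodule.subset_span ⟨⟨f, hf⟩, rfl⟩)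

/-- A lower bound for the dimension of the space of cycles of a graph. -/
theorem card_add_card_lt (S : Finset V) (T : Finset C) (hne : S.Nonempty ∨ T.Nonempty)
    (hS : ∀ x ∈ I, D.vert x ∈ S) (hT : ∀ x ∈ I, D.cell x ∈ T)
    (hJ : ∀ i ∈ J, D.corner i ∈ S ∧ D.corner (i + 1) ∈ S) :
    I.card + J.card + 1 ≤ Module.finrank ℚ (D.cycles I J) + S.card + T.card := by
  let ext : (I ⊕ J → ℚ) →ₗ[ℚ] (Φ ⊕ Fin 4 → ℚ) :=
    { toFun := fun z => Sum.elim (fun x => if h : x ∈ I then z (Sum.inl ⟨x, h⟩) else 0)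
        (fun i => if h : i ∈ J then z (Sum.inr ⟨i, h⟩) else 0)
      map_add' := fun z z' => by
        ext e; obtain x | i := e <;> simp <;> split_ifs <;> simp
      map_smul' := fun r z => by
        ext e; obtain x | i := e <;> simp }
  have hext : Function.Injective ext := by
    intro z z' h
    ext e
    obtain x | i := e
    · simpa [ext] using congrFun h (Sum.inl x.1)
    · simpa [ext] using congrFun h (Sum.inr i.1)
  let M : (Φ ⊕ Fin 4 → ℚ) →ₗ[ℚ] (S → ℚ) × (T → ℚ) :=
    { toFun := fun z => (fun v => D.vertexSum z v, fun c => D.cellSum z c)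
      map_add' := fun z z' => by
        ext x
        · simp [vertexSum, add_mul, Finset.sum_add_distrib]; ring
        · simp [cellSum, Finset.sum_add_distrib]
      map_smul' := fun r z => by
        ext x
        · simp [vertexSum, mul_assoc, Finset.mul_sum, mul_add]
        · simp [cellSum, Finset.mul_sum] }
  -- Each spoke contributes equally to the vertex sums and to the cell sums, and the two ends of a
  -- boundary edge cancel. This one relation among the boundaries is the `+ 1` of the statement;
  -- nonemptiness makes it nontrivial.
  let l : (S → ℚ) × (T → ℚ) →ₗ[ℚ] ℚ :=
    { toFun := fun y => ∑ v, y.1 v - ∑ c, y.2 c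
      map_add' := fun y y' => by simp [Finset.sum_add_distrib]; ring
      map_smul' := fun r y => by simp [Finset.mul_sum, mul_sub] }
  have hrange : LinearMap.range (M ∘ₗ ext) ≤ LinearMap.ker l := by
    rintro _ ⟨z, rfl⟩
    rw [LinearMap.mem_ker]
    set w := ext z with hw
    have hw1 : ∀ x, x ∉ I → w (Sum.inl x) = 0 := fun x hx => by simp [hw, ext, hx]
    have hw2 : ∀ i, i ∉ J → w (Sum.inr i) = 0 := fun i hi => by simp [hw, ext, hi]
    have hl : l (M w) = ∑ v : S, D.vertexSum w v - ∑ c : T, D.cellSum w c := rfl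
    rw [LinearMap.comp_apply, hl, Finset.sum_coe_sort S (D.vertexSum w),
      Finset.sum_coe_sort T (D.cellSum w)]
    simp only [vertexSum, cellSum, Finset.sum_filter, Finset.sum_add_distrib]
    rw [Finset.sum_comm, Finset.sum_comm (s := S), Finset.sum_comm (s := T)]
    have e1 : ∀ x, (∑ v ∈ S, if D.vert x = v then w (Sum.inl x) else 0) = w (Sum.inl x) := by
      intro x
      by_cases hx : x ∈ I
      · simp [hS x hx]
      · simp [hw1 x hx]
    have e2 : ∀ x, (∑ c ∈ T, if D.cell x = c then w (Sum.inl x) else 0) = w (Sum.inl x) := by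
      intro x
      by_cases hx : x ∈ I
      · simp [hT x hx]
      · simp [hw1 x hx]
    have e3 : ∀ i, ∑ v ∈ S, w (Sum.inr i) * D.bdIncidence i v = 0 := by
      intro i
      by_cases hi : i ∈ J
      · simp [bdIncidence, ← Finset.mul_sum, (hJ i hi).1, (hJ i hi).2]
      · simp [hw2 i hi]
    simp only [e1, e2, e3]
    simp
  have hl : LinearMap.range l = ⊤ := by
    rw [LinearMap.range_eq_top]
    refine LinearMap.surjective fun h => ?_
    obtain ⟨v, hv⟩ | ⟨c, hc⟩ := hne
    · have := LinearMap.congr_fun h (Pi.single ⟨v, hv⟩ 1, 0)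
      simp [l] at this
    · have := LinearMap.congr_fun h (0, Pi.single ⟨c, hc⟩ 1)
      simp [l] at this
  have d1 := LinearMap.finrank_range_add_finrank_ker l
  have d2 := LinearMap.finrank_range_add_finrank_ker (M ∘ₗ ext)
  have d3 := Submodule.finrank_mono hrange
  have d4 : Module.finrank ℚ (LinearMap.ker (M ∘ₗ ext)) ≤ Module.finrank ℚ (D.cycles I J) := by
    have hmem : ∀ z : LinearMap.ker (M ∘ₗ ext), ext z.1 ∈ D.cycles I J := by
      rintro ⟨z, hz⟩
      have hz : M (ext z) = 0 := hz
      have hw1 : ∀ x, x ∉ I → ext z (Sum.inl x) = 0 := fun x hx => by simp [ext, hx]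
      have hw2 : ∀ i, i ∉ J → ext z (Sum.inr i) = 0 := fun i hi => by simp [ext, hi]
      refine ⟨hw1, hw2, fun v => ?_, fun c => ?_⟩
      · by_cases hv : v ∈ S
        · exact congrFun (congrArg Prod.fst hz) ⟨v, hv⟩
        · have a1 : ∀ x ∈ Finset.univ.filter (fun x => D.vert x = v), ext z (Sum.inl x) = 0 :=
            fun x hx => hw1 x fun h => hv ((Finset.mem_filter.1 hx).2 ▸ hS x h)
          have a2 : ∀ i ∈ Finset.univ, ext z (Sum.inr i) * D.bdIncidence i v = 0 := by
            intro i _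
            by_cases hi : i ∈ J
            · have n1 : D.corner i ≠ v := fun h => hv (h ▸ (hJ i hi).1)
              have n2 : D.corner (i + 1) ≠ v := fun h => hv (h ▸ (hJ i hi).2)
              simp [bdIncidence, n1, n2]
            · rw [hw2 i hi, zero_mul]
          rw [vertexSum, Finset.sum_eq_zero a1, Finset.sum_eq_zero a2, add_zero]
      · by_cases hc : c ∈ T
        · exact congrFun (congrArg Prod.snd hz) ⟨c, hc⟩
        · exact Finset.sum_eq_zero fun x hx => hw1 x fun h => hc ((Finset.mem_filter.1 hx).2 ▸ hT x h)
    let g : LinearMap.ker (M ∘ₗ ext) →ₗ[ℚ] D.cycles I J :=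
      (ext ∘ₗ (LinearMap.ker (M ∘ₗ ext)).subtype).codRestrict (D.cycles I J) hmem
    refine LinearMap.finrank_le_finrank_of_injective (f := g) fun a b hab => ?_
    exact Subtype.ext (hext (congrArg Subtype.val hab))
  rw [hl, finrank_top] at d1
  simp only [Module.finrank_self, Module.finrank_prod, Module.finrank_fintype_fun_eq_card,
    Fintype.card_sum, Fintype.card_coe] at d1 d2
  omega

end QuadDisk
end

/-! ### Lengths of cycles and double counting over faces -/

noncomputable section

namespace QuadDisk

open scoped Classical Finset

variable {Φ V C : Type*} (D : QuadDisk Φ V C) [Fintype Φ] {I : Finset Φ} {J : Finset (Fin 4)}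

/-- The number of spokes in the support of a chain. -/
def spokeCount (z : Φ ⊕ Fin 4 → ℚ) : ℕ := #{x | z (Sum.inl x) ≠ 0}

/-- The number of boundary edges in the support of a chain. -/
def bdCount (z : Φ ⊕ Fin 4 → ℚ) : ℕ := #{i | z (Sum.inr i) ≠ 0}

theorem vertexSum_corner (z : Φ ⊕ Fin 4 → ℚ) (j : Fin 4) :
    D.vertexSum z (D.corner (j + 1)) =
      ∑ x with D.vert x = D.corner (j + 1), z (Sum.inl x) + (z (Sum.inr (j + 1)) - z (Sum.inr j)) := by
  simp [vertexSum, bdIncidence, D.corner_injective.eq_iff, mul_sub]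

theorem exists_ne_of_cell {z : Φ ⊕ Fin 4 → ℚ} (hz : z ∈ D.cycles I J) {x : Φ}
    (hx : z (Sum.inl x) ≠ 0) : ∃ y, y ≠ x ∧ D.cell y = D.cell x ∧ z (Sum.inl y) ≠ 0 := by
  by_contra! h
  have h1 := hz.2.2.2 (D.cell x)
  rw [cellSum, Finset.sum_eq_single x (fun y hy hyx => h y hyx (Finset.mem_filter.1 hy).2)
    (by simp)] at h1
  exact hx h1

theorem exists_ne_of_vert {z : Φ ⊕ Fin 4 → ℚ} (hz : z ∈ D.cycles I J)
    (hz0 : ∀ i, z (Sum.inr i) = 0) {x : Φ}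
    (hx : z (Sum.inl x) ≠ 0) : ∃ y, y ≠ x ∧ D.vert y = D.vert x ∧ z (Sum.inl y) ≠ 0 := by
  by_contra! h
  have h1 := hz.2.2.1 (D.vert x)
  simp only [vertexSum, hz0, zero_mul, Finset.sum_const_zero, add_zero] at h1
  rw [Finset.sum_eq_single x (fun y hy hyx => h y hyx (Finset.mem_filter.1 hy).2) (by simp)] at h1
  exact hx h1

theorem exists_vert_eq_corner {z : Φ ⊕ Fin 4 → ℚ} (hz : z ∈ D.cycles I J) {j : Fin 4}
    (hj : z (Sum.inr (j + 1)) ≠ z (Sum.inr j)) :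
    ∃ x, D.vert x = D.corner (j + 1) ∧ z (Sum.inl x) ≠ 0 := by
  by_contra! h
  have h1 := hz.2.2.1 (D.corner (j + 1))
  rw [vertexSum_corner, Finset.sum_eq_zero fun x hx => h x (Finset.mem_filter.1 hx).2, zero_add,
    sub_eq_zero] at h1
  exact hj h1

/-- Two cells share at most one vertex, as far as the flags in `I` are concerned. -/
def IsLinear (I : Finset Φ) : Prop :=
  ∀ x ∈ I, ∀ x' ∈ I, ∀ y ∈ I, ∀ y' ∈ I, D.vert x = D.vert x' → D.vert y = D.vert y' →
    D.cell x = D.cell y → D.cell x' = D.cell y' → D.vert x ≠ D.vert y → D.cell x = D.cell x'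

/-- Some cell contains the end points of the boundary edge `i`. -/
def IsShort (I : Finset Φ) (i : Fin 4) : Prop :=
  ∃ x ∈ I, ∃ y ∈ I, D.vert x = D.corner i ∧ D.vert y = D.corner (i + 1) ∧ D.cell x = D.cell y

/-- Without boundary edges the support has no free ends. From a spoke x₁ one finds x₂ at the same
vertex, x₃ and x₄ in the cells of x₁ and x₂, and x₅ and x₆ at the vertices of x₃ and x₄. These
vertices differ, since otherwise two cells would share two vertices. -/
theorem six_le_spokeCount (hI : D.IsLinear I) {z : Φ ⊕ Fin 4 → ℚ} (hz : z ∈ D.cycles I J)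
    (hne : z ≠ 0) (hz0 : ∀ i, z (Sum.inr i) = 0) : 6 ≤ spokeCount z := by
  have hmem : ∀ x, z (Sum.inl x) ≠ 0 → x ∈ I := fun x hx => by_contra fun h => hx (hz.1 x h)
  obtain ⟨x₁, h₁⟩ : ∃ x, z (Sum.inl x) ≠ 0 := by
    by_contra! h
    exact hne (by ext e; obtain x | i := e; exacts [h x, hz0 i])
  obtain ⟨x₂, n₂, v₂, h₂⟩ := D.exists_ne_of_vert hz hz0 h₁
  obtain ⟨x₃, n₃, c₃, h₃⟩ := D.exists_ne_of_cell hz h₁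
  obtain ⟨x₄, n₄, c₄, h₄⟩ := D.exists_ne_of_cell hz h₂
  obtain ⟨x₅, n₅, v₅, h₅⟩ := D.exists_ne_of_vert hz hz0 h₃
  obtain ⟨x₆, n₆, v₆, h₆⟩ := D.exists_ne_of_vert hz hz0 h₄
  have k1 : D.vert x₃ ≠ D.vert x₁ := fun h => n₃ (D.ext _ _ h c₃)
  have k2 : D.vert x₄ ≠ D.vert x₁ := fun h => n₄ (D.ext _ _ (h.trans v₂.symm) c₄)
  have k3 : D.vert x₃ ≠ D.vert x₄ := fun h => n₂ (D.ext _ _ v₂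
    (hI x₁ (hmem _ h₁) x₂ (hmem _ h₂) x₃ (hmem _ h₃) x₄ (hmem _ h₄) v₂.symm h c₃.symm c₄.symm
      k1.symm).symm)
  have hsub : ({x₁, x₂, x₃, x₄, x₅, x₆} : Finset Φ) ⊆ Finset.univ.filter fun x => z (Sum.inl x) ≠ 0 := by
    intro x hx
    simp only [Finset.mem_insert, Finset.mem_singleton] at hx
    simp only [Finset.mem_filter, Finset.mem_univ, true_and]
    obtain rfl | rfl | rfl | rfl | rfl | rfl := hx <;> assumption
  refine le_trans (le_of_eq ?_) (Finset.card_le_card hsub)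
  rw [Finset.card_insert_of_notMem, Finset.card_insert_of_notMem, Finset.card_insert_of_notMem,
    Finset.card_insert_of_notMem, Finset.card_insert_of_notMem, Finset.card_singleton] <;>
  simp only [Finset.mem_insert, Finset.mem_singleton] <;> grind

/-- A boundary edge weighs as much as two spokes, as if it were a path through an additional cell;
this restores the bound six. The exception is a boundary edge closed up by two spokes of one cell,
of weight four. -/
theorem weight_of_cycle (hI : D.IsLinear I) {z : Φ ⊕ Fin 4 → ℚ} (hz : z ∈ D.cycles I J)
    (hne : z ≠ 0) : 6 ≤ spokeCount z + 2 * bdCount z ∨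
      (4 ≤ spokeCount z + 2 * bdCount z ∧ ∃ i, z (Sum.inr i) ≠ 0 ∧ D.IsShort I i) := by
  have hmem : ∀ x, z (Sum.inl x) ≠ 0 → x ∈ I := fun x hx => by_contra fun h => hx (hz.1 x h)
  have hpair : ∀ x y, x ≠ y → z (Sum.inl x) ≠ 0 → z (Sum.inl y) ≠ 0 → 2 ≤ spokeCount z := by
    intro x y hxy hx hy
    rw [← Finset.card_pair hxy]
    refine Finset.card_le_card fun u hu => ?_
    simp only [Finset.mem_insert, Finset.mem_singleton] at hu
    simp only [Finset.mem_filter, Finset.mem_univ, true_and]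
    obtain rfl | rfl := hu <;> assumption
  by_cases h0 : ∀ i, z (Sum.inr i) = 0
  · left; have := D.six_le_spokeCount hI hz hne h0; omega
  push Not at h0
  obtain ⟨i₀, hi₀⟩ := h0
  by_cases h3 : 3 ≤ bdCount z
  · left; omega
  -- When fewer than three boundary edges are used, some used edge is followed by an unused one, so
  -- the cycle must leave the boundary along a spoke at the corner between them.
  obtain ⟨i, hi, hi1⟩ : ∃ i, z (Sum.inr i) ≠ 0 ∧ z (Sum.inr (i + 1)) = 0 := by
    by_contra! h
    have hall : ∀ j : Fin 4, z (Sum.inr j) ≠ 0 := by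
      intro j
      have : ∀ i j : Fin 4, j = i ∨ j = i + 1 ∨ j = i + 1 + 1 ∨ j = i + 1 + 1 + 1 := by decide
      obtain h' | h' | h' | h' := this i₀ j <;> rw [h']
      exacts [hi₀, h _ hi₀, h _ (h _ hi₀), h _ (h _ (h _ hi₀))]
    have : bdCount z = 4 := by simp [bdCount, hall]
    omega
  obtain ⟨y, hy, hzy⟩ := D.exists_vert_eq_corner hz (j := i) (by rw [hi1]; exact hi.symm)
  obtain ⟨y', hy', hcy', hzy'⟩ := D.exists_ne_of_cell hz hzy
  have hn := hpair _ _ hy' hzy' hzy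
  by_cases h2 : 2 ≤ bdCount z
  · left; omega
  have hsup : ∀ j, j ≠ i → z (Sum.inr j) = 0 := by
    intro j hj
    by_contra hzj
    refine h2 ?_
    rw [← Finset.card_pair hj]
    refine Finset.card_le_card fun u hu => ?_
    simp only [Finset.mem_insert, Finset.mem_singleton] at hu
    simp only [Finset.mem_filter, Finset.mem_univ, true_and]
    obtain rfl | rfl := hu <;> assumption
  have h1 : 1 ≤ bdCount z := Finset.card_pos.2 ⟨i, by simpa using hi⟩
  have hi3 : i + 3 + 1 = i := (by decide : ∀ i : Fin 4, i + 3 + 1 = i) i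
  obtain ⟨x, hx, hzx⟩ := D.exists_vert_eq_corner hz (j := i + 3) (by
    rw [hi3, hsup (i + 3) ((by decide : ∀ i : Fin 4, i + 3 ≠ i) i)]; exact hi)
  rw [hi3] at hx
  by_cases hc : D.cell x = D.cell y
  · right
    exact ⟨by omega, i, hi, x, hmem x hzx, y, hmem y hzy, hx, hy, hc⟩
  left
  obtain ⟨x', hx', hcx', hzx'⟩ := D.exists_ne_of_cell hz hzx
  have hsub : ({x, x', y, y'} : Finset Φ) ⊆ Finset.univ.filter fun x => z (Sum.inl x) ≠ 0 := by
    intro x hx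
    simp only [Finset.mem_insert, Finset.mem_singleton] at hx
    simp only [Finset.mem_filter, Finset.mem_univ, true_and]
    obtain rfl | rfl | rfl | rfl := hx <;> assumption
  have h4 : 4 ≤ spokeCount z := by
    refine le_trans (le_of_eq ?_) (Finset.card_le_card hsub)
    rw [Finset.card_insert_of_notMem, Finset.card_insert_of_notMem, Finset.card_insert_of_notMem,
      Finset.card_singleton] <;>
    simp only [Finset.mem_insert, Finset.mem_singleton] <;> grind
  omega

-- Extracting a basis from the spanning face boundaries makes the number of chosen faces equal to
-- the dimension of the cycle space, so that Euler's inequality becomes a count of faces.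
variable (I J) in
theorem exists_face_basis [Fintype V] [Fintype C] : ∃ B : Finset (D.Face I J),
    (∀ f ∈ B, D.faceCycle I J f ∈ D.cycles I J) ∧
    LinearIndependent ℚ (fun f : B => D.faceCycle I J f) ∧
    B.card = Module.finrank ℚ (D.cycles I J) := by
  obtain ⟨κ, a, ha, hspan, hli⟩ := exists_linearIndependent' ℚ
    (fun f : {f // f ≠ D.face I J none} => D.faceCycle I J f.1)
  have : Finite κ := Finite.of_injective a ha
  have := Fintype.ofFinite κ
  rw [D.span_faceCycle] at hspan
  have ha' : Function.Injective fun j => (a j).1 := Subtype.val_injective.comp ha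
  refine ⟨Finset.univ.image fun j => (a j).1, ?_, ?_, ?_⟩
  · intro f hf
    obtain ⟨j, -, rfl⟩ := Finset.mem_image.1 hf
    exact D.faceCycle_mem _ (a j).2
  · have hs : ∀ f : ↥(Finset.univ.image fun j => (a j).1), ∃ j, (a j).1 = f.1 := fun f => by
      obtain ⟨j, -, h⟩ := Finset.mem_image.1 f.2
      exact ⟨j, h⟩
    choose s hs using hs
    have := hli.comp s fun f g h => Subtype.ext (by rw [← hs f, ← hs g, h])
    have e : (fun f : ↥(Finset.univ.image fun j => (a j).1) => D.faceCycle I J f.1) =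
        ((fun f : {f // f ≠ D.face I J none} => D.faceCycle I J f.1) ∘ a) ∘ s :=
      funext fun f => by simp [hs f]
    rw [e]; exact this
  · rw [Finset.card_image_of_injective _ ha', ← hspan, finrank_span_eq_card hli, Finset.card_univ]

/-- A spoke borders at most two faces, one on each side. If both belong to `B`, their contributions
to the total boundary cancel, so a spoke surviving in the total is counted at most once among the
faces. -/
theorem sum_spokeCount_le (B : Finset (D.Face I J))
    (hB : ∀ f ∈ B, D.faceCycle I J f ∈ D.cycles I J) :
    spokeCount (∑ f ∈ B, D.faceCycle I J f) + ∑ f ∈ B, spokeCount (D.faceCycle I J f) ≤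
      2 * I.card := by
  have h1 : ∑ f ∈ B, spokeCount (D.faceCycle I J f) =
      ∑ x, (B.filter fun f => D.faceCycle I J f (Sum.inl x) ≠ 0).card := by
    simp only [spokeCount, Finset.card_filter]
    exact Finset.sum_comm
  rw [h1, spokeCount, Finset.card_filter, ← Finset.sum_add_distrib]
  have h2 : 2 * I.card = ∑ x, if x ∈ I then 2 else 0 := by simp [mul_comm]
  rw [h2]
  refine Finset.sum_le_sum fun x _ => ?_
  split_ifs with hw hx hx
  all_goals rw [Finset.sum_apply] at hw
  · set P := D.face I J (some (D.nx.symm x)) with hP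
    set Q := D.face I J (some x) with hQ
    by_contra hlt
    have hle : 2 ≤ (B.filter fun f => D.faceCycle I J f (Sum.inl x) ≠ 0).card := by omega
    have hsub : (B.filter fun f => D.faceCycle I J f (Sum.inl x) ≠ 0) ⊆ {P, Q} := by
      intro f hf
      have := D.faceCycle_inl_ne_zero (Finset.mem_filter.1 hf).2
      simp only [Finset.mem_insert, Finset.mem_singleton]
      exact this.imp Eq.symm Eq.symm
    have heq := Finset.eq_of_subset_of_card_le hsub (Finset.card_le_two.trans hle)
    have hPB : P ∈ B := by
      have : P ∈ ({P, Q} : Finset _) := by simp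
      rw [← heq] at this; exact (Finset.mem_filter.1 this).1
    have hQB : Q ∈ B := by
      have : Q ∈ ({P, Q} : Finset _) := by simp
      rw [← heq] at this; exact (Finset.mem_filter.1 this).1
    refine hw ?_
    simp only [faceCycle, bdry, Sum.elim_inl, Finset.sum_sub_distrib, ← hP, ← hQ]
    simp [hPB, hQB]
  · refine absurd (Finset.sum_eq_zero fun f hf => (hB f hf).1 x hx) hw
  · rw [zero_add]
    have hsub : (B.filter fun f => D.faceCycle I J f (Sum.inl x) ≠ 0) ⊆
        {D.face I J (some (D.nx.symm x)), D.face I J (some x)} := by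
      intro f hf
      have := D.faceCycle_inl_ne_zero (Finset.mem_filter.1 hf).2
      simp only [Finset.mem_insert, Finset.mem_singleton]
      exact this.imp Eq.symm Eq.symm
    exact (Finset.card_le_card hsub).trans Finset.card_le_two
  · rw [zero_add, Nat.le_zero, Finset.card_eq_zero, Finset.filter_eq_empty_iff]
    intro f hf h
    exact h ((hB f hf).1 x hx)

-- A boundary edge appears only in the boundary of the face of its own flag.
omit [Fintype Φ] in
theorem sum_bdCount_le (B : Finset (D.Face I J)) :
    ∑ f ∈ B, bdCount (D.faceCycle I J f) ≤ 4 := by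
  have h1 : ∑ f ∈ B, bdCount (D.faceCycle I J f) =
      ∑ i, (B.filter fun f => D.faceCycle I J f (Sum.inr i) ≠ 0).card := by
    simp only [bdCount, Finset.card_filter]
    exact Finset.sum_comm
  rw [h1]
  refine (Finset.sum_le_sum (g := fun _ => 1) fun i _ => ?_).trans (by simp)
  refine Finset.card_le_one.2 fun f hf g hg => ?_
  rw [← D.faceCycle_inr_ne_zero (Finset.mem_filter.1 hf).2,
    ← D.faceCycle_inr_ne_zero (Finset.mem_filter.1 hg).2]

end QuadDisk
end

/-! ### Existence of an element of degree at most two -/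

noncomputable section

namespace QuadDisk

open scoped Classical Finset

variable {Φ V C : Type*} (D : QuadDisk Φ V C) {I : Finset Φ}

/-- Each short edge has a flag at each of its two corners, in one cell. All these flags are
distinct: one used both as an end and as a start would put three consecutive corners in a cell. -/
theorem two_mul_card_isShort_le
    (h3 : ∀ i, ∀ x ∈ I, ∀ y ∈ I, ∀ w ∈ I, D.vert x = D.corner i → D.vert y = D.corner (i + 1) →
      D.vert w = D.corner (i + 1 + 1) → D.cell x = D.cell y → D.cell y = D.cell w → False) :
    2 * #{i | D.IsShort I i} ≤ #{x ∈ I | ∃ i, D.vert x = D.corner i} := by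
  have hch : ∀ i, ∃ x y, D.IsShort I i → x ∈ I ∧ y ∈ I ∧ D.vert x = D.corner i ∧
      D.vert y = D.corner (i + 1) ∧ D.cell x = D.cell y := by
    intro i
    by_cases h : D.IsShort I i
    · obtain ⟨x, hx, y, hy, h⟩ := h
      exact ⟨x, y, fun _ => ⟨hx, hy, h⟩⟩
    · exact ⟨D.bd 0, D.bd 0, fun h' => absurd h' h⟩
  choose a b hab using hch
  set s : Finset (Fin 4) := {i | D.IsShort I i} with hs
  have hs' : ∀ i ∈ s, D.IsShort I i := fun i hi => (Finset.mem_filter.1 hi).2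
  have ha : Set.InjOn a s := fun i hi j hj h => D.corner_injective (by
    rw [← (hab i (hs' i hi)).2.2.1, h, (hab j (hs' j hj)).2.2.1])
  have hb : Set.InjOn b s := fun i hi j hj h => add_right_cancel (D.corner_injective (by
    rw [← (hab i (hs' i hi)).2.2.2.1, h, (hab j (hs' j hj)).2.2.2.1]))
  have hdisj : Disjoint (s.image a) (s.image b) := by
    rw [Finset.disjoint_left]
    intro x hx hx'
    obtain ⟨i, hi, rfl⟩ := Finset.mem_image.1 hx
    obtain ⟨j, hj, h⟩ := Finset.mem_image.1 hx'
    obtain ⟨hi1, hi2, hi3, hi4, hi5⟩ := hab i (hs' i hi)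
    obtain ⟨hj1, hj2, hj3, hj4, hj5⟩ := hab j (hs' j hj)
    have hij : i = j + 1 := D.corner_injective (by rw [← hi3, ← h, hj4])
    subst hij
    exact h3 j (a j) hj1 (b j) hj2 _ hi2 hj3 hj4 hi4 hj5 (by rw [h, hi5])
  rw [two_mul]
  nth_rewrite 1 [← Finset.card_image_of_injOn ha]
  rw [← Finset.card_image_of_injOn hb, ← Finset.card_union_of_disjoint hdisj]
  refine Finset.card_le_card fun x hx => ?_
  rw [Finset.mem_filter]
  obtain hx | hx := Finset.mem_union.1 hx <;> obtain ⟨i, hi, rfl⟩ := Finset.mem_image.1 hx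
  · exact ⟨(hab i (hs' i hi)).1, i, (hab i (hs' i hi)).2.2.1⟩
  · exact ⟨(hab i (hs' i hi)).2.1, i + 1, (hab i (hs' i hi)).2.2.2.1⟩

variable [Fintype Φ]

/-- In a disk bounded by a quadrilateral, let `S₀` be a set of vertices other than the corners and
`T` a set of cells, two of which share at most one vertex of `S₀` or corner, none of which contains
three corners. Then some element of `S₀` or `T` has degree at most two in the incidence graph on
`S₀`, `T` and the corners. -/
theorem exists_card_le_two [Fintype V] [Fintype C] (S₀ : Finset V) (T : Finset C)
    (hne : S₀.Nonempty ∨ T.Nonempty) (hS₀ : ∀ v ∈ S₀, ∀ i, v ≠ D.corner i)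
    (hI : ∀ x, x ∈ I ↔ (D.vert x ∈ S₀ ∨ ∃ i, D.vert x = D.corner i) ∧ D.cell x ∈ T)
    (hlin : D.IsLinear I)
    (h3 : ∀ i, ∀ x ∈ I, ∀ y ∈ I, ∀ w ∈ I, D.vert x = D.corner i → D.vert y = D.corner (i + 1) →
      D.vert w = D.corner (i + 1 + 1) → D.cell x = D.cell y → D.cell y = D.cell w → False) :
    (∃ v ∈ S₀, #{x ∈ I | D.vert x = v} ≤ 2) ∨ ∃ c ∈ T, #{x ∈ I | D.cell x = c} ≤ 2 := by
  by_contra! hcon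
  obtain ⟨hv, hc⟩ := hcon
  set d := #{x ∈ I | ∃ i, D.vert x = D.corner i} with hd
  set d' := #{x ∈ I | ¬ ∃ i, D.vert x = D.corner i} with hd'
  have e1 : d + d' = I.card := Finset.card_filter_add_card_filter_not _
  have e2 : 3 * T.card ≤ I.card := by
    rw [Finset.card_eq_sum_card_fiberwise (f := D.cell) (t := T)
      (fun x hx => ((hI x).1 hx).2), mul_comm, ← smul_eq_mul]
    exact Finset.card_nsmul_le_sum _ _ _ fun c h => hc c h
  have e3 : 3 * S₀.card ≤ d' := by
    rw [hd', Finset.card_eq_sum_card_fiberwise (f := D.vert) (t := S₀)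
      (fun x hx => by
        have hx := Finset.mem_filter.1 hx
        exact ((hI x).1 hx.1).1.resolve_right hx.2), mul_comm, ← smul_eq_mul]
    refine Finset.card_nsmul_le_sum _ _ _ fun v h => (Nat.succ_le_of_lt (hv v h)).trans (Finset.card_le_card ?_)
    intro x hx
    have hx := Finset.mem_filter.1 hx
    refine Finset.mem_filter.2 ⟨Finset.mem_filter.2 ⟨hx.1, ?_⟩, hx.2⟩
    rintro ⟨i, hi⟩
    exact hS₀ v h i (hx.2 ▸ hi)
  -- For `d ≥ 3` all boundary edges are included. Euler gives |I| + 1 ≤ |B| + |S₀| + |T|, and the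
  -- weights give 6|B| ≤ 2|I| + 8 + 2t. With 3|T| ≤ |I| = d + d' and 3|S₀| ≤ d' this yields d ≤ 1 +
  -- t, and 2t ≤ d leaves only d ≤ 2.
  by_cases hd3 : 3 ≤ d
  · obtain ⟨B, hB, hli, hcard⟩ := D.exists_face_basis I Finset.univ
    have hdim := D.card_add_card_lt (I := I) (J := Finset.univ)
      (S₀ ∪ Finset.univ.image D.corner) T (Or.inl ⟨D.corner 0, by simp⟩)
      (fun x hx => by
        obtain h | ⟨i, hi⟩ := ((hI x).1 hx).1
        · exact Finset.mem_union_left _ h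
        · rw [hi]; simp)
      (fun x hx => ((hI x).1 hx).2) (fun i _ => by simp)
    have hScard : (S₀ ∪ Finset.univ.image D.corner).card ≤ S₀.card + 4 :=
      (Finset.card_union_le _ _).trans (by
        have := Finset.card_image_le (s := Finset.univ) (f := D.corner)
        simp only [Finset.card_univ, Fintype.card_fin] at this
        omega)
    have hs := D.sum_spokeCount_le B hB
    have hb := D.sum_bdCount_le B
    have ht := D.two_mul_card_isShort_le h3
    set t := #{i | D.IsShort I i} with htdef
    let bad : D.Face I Finset.univ → Prop := fun f =>
      ∃ i, D.faceCycle I Finset.univ f (Sum.inr i) ≠ 0 ∧ D.IsShort I i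
    -- Each boundary edge lies in only one face, so there are at most as many exceptional faces as
    -- short edges.
    have hbad : #{f ∈ B | bad f} ≤ t := by
      refine (Finset.card_le_card ?_).trans (Finset.card_image_le
        (s := Finset.univ.filter fun i => D.IsShort I i)
        (f := fun i => D.face I Finset.univ (some (D.bd i))))
      intro f hf
      obtain ⟨i, hi, hi'⟩ := (Finset.mem_filter.1 hf).2
      exact Finset.mem_image.2 ⟨i, by simpa using hi', D.faceCycle_inr_ne_zero hi⟩
    have hsum : ∑ f ∈ B, 6 ≤ ∑ f ∈ B, (spokeCount (D.faceCycle I Finset.univ f) +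
        2 * bdCount (D.faceCycle I Finset.univ f) + 2 * if bad f then 1 else 0) := by
      refine Finset.sum_le_sum fun f hf => ?_
      obtain h | ⟨h, h'⟩ := D.weight_of_cycle hlin (hB f hf)
        (hli.ne_zero (i := ⟨f, hf⟩))
      · omega
      · rw [if_pos h']; omega
    rw [Finset.sum_add_distrib, Finset.sum_add_distrib, ← Finset.mul_sum, ← Finset.mul_sum,
      ← Finset.card_filter, Finset.sum_const, smul_eq_mul] at hsum
    simp only [Finset.card_univ, Fintype.card_fin] at hdim
    omega
  -- For `d ≤ 2` no boundary edge is included and at most `d` corners occur, so |I| + 1 ≤ |B| + |S₀|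
  -- + d + |T|. If `B` is empty, the degree bounds already contradict this. Otherwise the sum of the
  -- basis faces is a nonzero cycle playing the role of the outer face, so 6|B| + 6 ≤ 2|I|, which
  -- forces d ≥ 3.
  · obtain ⟨B, hB, hli, hcard⟩ := D.exists_face_basis I ∅
    set K := (Finset.filter (fun x => ∃ i, D.vert x = D.corner i) I).image D.vert with hK
    have hKcard : K.card ≤ d := Finset.card_image_le
    have hdim := D.card_add_card_lt (I := I) (J := ∅) (S₀ ∪ K) T
      (hne.imp (fun h => h.mono Finset.subset_union_left) id)
      (fun x hx => by
        obtain h | h := ((hI x).1 hx).1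
        · exact Finset.mem_union_left _ h
        · exact Finset.mem_union_right _ (Finset.mem_image_of_mem _ (Finset.mem_filter.2 ⟨hx, h⟩)))
      (fun x hx => ((hI x).1 hx).2) (by simp)
    have hScard : (S₀ ∪ K).card ≤ S₀.card + K.card := Finset.card_union_le _ _
    rw [Finset.card_empty] at hdim
    have hN : 0 < S₀.card + T.card := by
      obtain h | h := hne
      · have := h.card_pos; omega
      · have := h.card_pos; omega
    obtain rfl | hBne := B.eq_empty_or_nonempty
    · rw [Finset.card_empty] at hcard
      omega
    have hs := D.sum_spokeCount_le B hB
    have hzero : ∀ z ∈ D.cycles I ∅, ∀ i, z (Sum.inr i) = 0 := fun z hz i => hz.2.1 i (by simp)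
    have hw : ∑ f ∈ B, D.faceCycle I ∅ f ∈ D.cycles I ∅ := Submodule.sum_mem _ hB
    have hw0 : ∑ f ∈ B, D.faceCycle I ∅ f ≠ 0 := by
      intro h
      have := Fintype.linearIndependent_iff.1 hli (fun _ => 1) (by
        simp only [one_smul]
        rw [Finset.sum_coe_sort B (fun f => D.faceCycle I ∅ f)]; exact h)
      obtain ⟨f, hf⟩ := hBne
      exact one_ne_zero (this ⟨f, hf⟩)
    have h6 := D.six_le_spokeCount hlin hw hw0 (hzero _ hw)
    have hsum : ∑ f ∈ B, 6 ≤ ∑ f ∈ B, spokeCount (D.faceCycle I ∅ f) :=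
      Finset.sum_le_sum fun f hf => D.six_le_spokeCount hlin (hB f hf)
        (hli.ne_zero (i := ⟨f, hf⟩)) (hzero _ (hB f hf))
    rw [Finset.sum_const, smul_eq_mul] at hsum
    omega

end QuadDisk
end

/-! ### The combinatorial disk of a generalized dissection -/

noncomputable section

namespace GeneralizedDissection

open scoped Classical

section Flags
variable {bdry : Cycle Plane} (D : GeneralizedDissection bdry)

/-- The cells of a generalized dissection. -/
def Cell : Type := {c : Cycle Plane // c ∈ D.triangles ∨ c ∈ D.constraints}

/-- The flags of a generalized dissection: a cell and one of its vertices. -/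
def Flag : Type := {x : D.Cell × D.Vertex // x.2.1 ∈ x.1.1}

instance : Finite D.Cell :=
  ((D.triangles.finite_toSet.union D.constraints.finite_toSet).subset
    (s := {c | c ∈ D.triangles ∨ c ∈ D.constraints}) fun _ h => h).to_subtype

instance : Finite D.Vertex := by
  have : {x : Plane | ∃ t ∈ D.triangles, x ∈ t} ⊆ ⋃ t ∈ D.triangles, (t.toFinset : Set Plane) := by
    rintro x ⟨t, ht, hx⟩
    refine Set.mem_biUnion ht ?_
    induction t using Quotient.inductionOn with | _ l
    exact List.mem_toFinset.2 hx
  exact ((D.triangles.finite_toSet.biUnion fun t _ => t.toFinset.finite_toSet).subset this).to_subtype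

instance : Fintype D.Cell := Fintype.ofFinite _

instance : Fintype D.Vertex := Fintype.ofFinite _

instance : Finite D.Flag := Subtype.finite

instance : Fintype D.Flag := Fintype.ofFinite _

variable {D}

theorem Cell.isPolygon (c : D.Cell) : IsPolygon c.1 := by
  obtain h | h := c.2
  exacts [(D.triangles_spec _ h).1, (D.constraints_spec _ h).1]

theorem Cell.exists_triangle (c : D.Cell) {v : Plane} (hv : v ∈ c.1) : ∃ t ∈ D.triangles, v ∈ t := by
  obtain h | h := c.2
  exacts [⟨c.1, h, hv⟩, D.constraints_vertices _ h v hv]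

/-- The flag of a vertex of a cell. -/
def Cell.flag (c : D.Cell) (v : Plane) (hv : v ∈ c.1) : D.Flag :=
  ⟨(c, ⟨v, c.exists_triangle hv⟩), hv⟩

variable (D) in
/-- The next flag in the same cell. -/
def nextFlag : Equiv.Perm D.Flag where
  toFun x := x.1.1.flag (x.1.1.1.next x.1.1.isPolygon.1 x.1.2.1 x.2) (Cycle.next_mem _ _ _ _)
  invFun x := x.1.1.flag (x.1.1.1.prev x.1.1.isPolygon.1 x.1.2.1 x.2) (Cycle.prev_mem _ _ _ _)
  left_inv _ := Subtype.ext (Prod.ext rfl (Subtype.ext (Cycle.prev_next _ _ _ _)))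
  right_inv _ := Subtype.ext (Prod.ext rfl (Subtype.ext (Cycle.next_prev _ _ _ _)))

theorem isEdge_nextFlag (x : D.Flag) : IsEdge x.1.1.1 x.1.2.1 (D.nextFlag x).1.2.1 :=
  isEdge_next _ (le_trans (by norm_num) x.1.1.isPolygon.2) _

theorem flag_ext {x y : D.Flag} (h1 : x.1.2 = y.1.2) (h2 : x.1.1 = y.1.1) : x = y :=
  Subtype.ext (Prod.ext h2 h1)

/-- By coherence a directed edge lies in at most one cell; in particular the flag across an edge is
unique. -/
theorem flag_eq_of_isEdge {x y : D.Flag} (h1 : x.1.2 = y.1.2)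
    (h2 : (D.nextFlag x).1.2 = (D.nextFlag y).1.2) : x = y := by
  refine flag_ext h1 (Subtype.ext ?_)
  have hx := isEdge_nextFlag x
  rw [h1, h2] at hx
  exact D.isOrientedDisk.coherent _ x.1.1.2 _ y.1.1.2 _ _ hx (isEdge_nextFlag y)

/-- The flags `x` and `y` lie on the two sides of an edge. -/
def IsOpposite (x y : D.Flag) : Prop :=
  y.1.2 = (D.nextFlag x).1.2 ∧ (D.nextFlag y).1.2 = x.1.2

theorem IsOpposite.symm {x y : D.Flag} (h : IsOpposite x y) : IsOpposite y x := ⟨h.2.symm, h.1.symm⟩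

theorem IsOpposite.unique {x y y' : D.Flag} (h : IsOpposite x y) (h' : IsOpposite x y') : y = y' :=
  flag_eq_of_isEdge (h.1.trans h'.1.symm) (h.2.trans h'.2.symm)

theorem IsOpposite.ne {x y : D.Flag} (h : IsOpposite x y) : y ≠ x := by
  rintro rfl
  exact (isEdge_nextFlag y).ne y.1.1.isPolygon.1 (congrArg Subtype.val h.1)

variable (D) in
/-- The flag on the other side of an edge, if there is one. -/
def revFlag (x : D.Flag) : D.Flag := if h : ∃ y, IsOpposite x y then h.choose else x

theorem revFlag_eq {x y : D.Flag} (h : IsOpposite x y) : D.revFlag x = y := by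
  have h' : ∃ y, IsOpposite x y := ⟨y, h⟩
  rw [revFlag, dif_pos h']
  exact h'.choose_spec.unique h

theorem isOpposite_revFlag {x : D.Flag} (h : D.revFlag x ≠ x) : IsOpposite x (D.revFlag x) := by
  by_cases h' : ∃ y, IsOpposite x y
  · obtain ⟨y, hy⟩ := h'
    rwa [revFlag_eq hy]
  · exact absurd (dif_neg h') h

theorem revFlag_revFlag (x : D.Flag) : D.revFlag (D.revFlag x) = x := by
  by_cases h : D.revFlag x = x
  · rw [h, h]
  · exact revFlag_eq (isOpposite_revFlag h).symm

/-- An edge has distinct ends, so no flag is opposite to itself. Hence `revFlag` fixes a flag only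
through its default value, when no cell lies across the edge. -/
theorem revFlag_eq_self_iff (x : D.Flag) :
    D.revFlag x = x ↔ IsEdge bdry x.1.2.1 (D.nextFlag x).1.2.1 := by
  rw [D.isOrientedDisk.boundary]
  constructor
  · intro h
    refine ⟨⟨_, x.1.1.2, isEdge_nextFlag x⟩, ?_⟩
    rintro ⟨c, hc, he⟩
    have hop : IsOpposite x (Cell.flag ⟨c, hc⟩ _ he.left_mem) :=
      ⟨rfl, Subtype.ext (he.next_eq (Cell.isPolygon ⟨c, hc⟩).1)⟩
    exact hop.ne ((revFlag_eq hop).symm.trans h)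
  · rintro ⟨-, h⟩
    by_contra hx
    have hop := isOpposite_revFlag hx
    refine h ⟨_, (D.revFlag x).1.1.2, ?_⟩
    have := isEdge_nextFlag (D.revFlag x)
    rwa [hop.2, hop.1] at this

/-- Cellular 1-cocycles with rational coefficients on a dissection are coboundaries. -/
theorem exists_rat_potential (α : D.Flag → ℚ)
    (hα : ∀ x, D.revFlag x ≠ x →
      α (D.nextFlag x) - α x = α (D.revFlag x) - α (D.nextFlag (D.revFlag x))) :
    ∃ (κ : D.Cell → ℚ) (H : D.Vertex → ℚ), ∀ x, α x = κ x.1.1 + H x.1.2 := by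
  -- A common denominator reduces the claim to integral cochains, for which the lifting argument
  -- works.
  obtain ⟨N, hN⟩ := IsLocalization.exist_integer_multiples_of_finite (nonZeroDivisors ℤ) α
  choose n hn using hN
  have hn' : ∀ x, (n x : ℚ) = N.1 * α x := fun x => by
    have := hn x
    simpa [Algebra.smul_def] using this
  have hN0 : (N.1 : ℚ) ≠ 0 := by exact_mod_cast nonZeroDivisors.ne_zero N.2
  let a : Cycle Plane → Plane → ℤ := fun c v =>
    if h : (c ∈ D.triangles ∨ c ∈ D.constraints) ∧ v ∈ c then n (Cell.flag ⟨c, h.1⟩ v h.2) else 0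
  have ha : ∀ c (hc : c ∈ D.triangles ∨ c ∈ D.constraints) v (hv : v ∈ c),
      (a c v : ℚ) = N.1 * α (Cell.flag ⟨c, hc⟩ v hv) := fun c hc v hv => by
    rw [← hn', show a c v = _ from dif_pos ⟨hc, hv⟩]
  obtain ⟨κ, H, h⟩ := exists_potential {c | c ∈ D.triangles ∨ c ∈ D.constraints}
    ((D.triangles.finite_toSet.union D.constraints.finite_toSet).subset fun _ h => h)
    (fun c hc => (Cell.isPolygon ⟨c, hc⟩).1) D.isOrientedDisk.coherent D.isOrientedDisk.disk a
    (by
      intro c hc c' hc' v w he he'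
      have hx : D.nextFlag (Cell.flag ⟨c, hc⟩ v he.left_mem) = Cell.flag ⟨c, hc⟩ w he.right_mem :=
        flag_ext (Subtype.ext (he.next_eq (Cell.isPolygon ⟨c, hc⟩).1)) rfl
      have hy : D.nextFlag (Cell.flag ⟨c', hc'⟩ w he'.left_mem) =
          Cell.flag ⟨c', hc'⟩ v he'.right_mem :=
        flag_ext (Subtype.ext (he'.next_eq (Cell.isPolygon ⟨c', hc'⟩).1)) rfl
      have hop : IsOpposite (Cell.flag ⟨c, hc⟩ v he.left_mem)
          (Cell.flag ⟨c', hc'⟩ w he'.left_mem) := by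
        refine ⟨?_, ?_⟩
        · rw [hx]; rfl
        · rw [hy]; rfl
      have h1 := hα (Cell.flag ⟨c, hc⟩ v he.left_mem) (by rw [revFlag_eq hop]; exact hop.ne)
      rw [revFlag_eq hop, hx, hy] at h1
      have h2 : ((a c w - a c v : ℤ) : ℚ) = (a c' w - a c' v : ℤ) := by
        push_cast
        rw [ha c hc w he.right_mem, ha c hc v he.left_mem, ha c' hc' w he'.left_mem,
          ha c' hc' v he'.right_mem, ← mul_sub, h1, mul_sub]
      exact_mod_cast h2)
  refine ⟨fun c => κ c.1 / N.1, fun v => H v.1 / N.1, fun x => ?_⟩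
  have h1 := h _ x.1.1.2 _ _ (isEdge_nextFlag x)
  have h2 := ha _ x.1.1.2 _ x.2
  rw [h1, show Cell.flag ⟨x.1.1.1, x.1.1.2⟩ x.1.2.1 x.2 = x from rfl] at h2
  push_cast at h2
  field_simp
  linarith

end Flags

section Quad
variable {p q r s : Plane} (D : GeneralizedDissection (quad p q r s))

/-- The four corners. -/
def corner : Fin 4 → D.Vertex := ![D.cornerP, D.cornerQ, D.cornerR, D.cornerS]

theorem isEdge_corner (i : Fin 4) :
    IsEdge (quad p q r s) (D.corner i).1 (D.corner (i + 1)).1 := by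
  fin_cases i
  · exact isEdge_quad p q r s
  · change IsEdge _ q r
    rw [quad_rotate]; exact isEdge_quad q r s p
  · change IsEdge _ r s
    rw [quad_rotate, quad_rotate]; exact isEdge_quad r s p q
  · change IsEdge _ s p
    rw [quad_rotate, quad_rotate, quad_rotate]; exact isEdge_quad s p q r

theorem corner_injective : Function.Injective D.corner := by
  have h := D.boundary_polygon.1
  simp only [quad, Cycle.nodup_coe_iff, List.nodup_cons, List.mem_cons, List.not_mem_nil, or_false,
    not_or, not_false_eq_true, List.nodup_nil, and_true] at h
  obtain ⟨⟨h1, h2, h3⟩, ⟨h4, h5⟩, h6⟩ := h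
  intro i j hij
  have hij : (D.corner i).1 = (D.corner j).1 := congrArg Subtype.val hij
  fin_cases i <;> fin_cases j <;> first | rfl | (exfalso; simp [corner, cornerP, cornerQ, cornerR, cornerS] at hij; first | contradiction | (exact absurd hij.symm (by assumption)))

theorem exists_corner_of_isEdge {v w : Plane} (h : IsEdge (quad p q r s) v w) :
    ∃ i, v = (D.corner i).1 ∧ w = (D.corner (i + 1)).1 := by
  have hv : v ∈ quad p q r s := h.left_mem
  have hi : ∃ i, v = (D.corner i).1 := by
    simp only [quad, Cycle.mem_coe_iff, List.mem_cons, List.not_mem_nil, or_false] at hv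
    obtain rfl | rfl | rfl | rfl := hv
    exacts [⟨0, rfl⟩, ⟨1, rfl⟩, ⟨2, rfl⟩, ⟨3, rfl⟩]
  obtain ⟨i, rfl⟩ := hi
  exact ⟨i, rfl, by
    rw [← h.next_eq D.boundary_polygon.1, (D.isEdge_corner i).next_eq D.boundary_polygon.1]⟩

theorem exists_corner_flag (i : Fin 4) :
    ∃ x : D.Flag, x.1.2 = D.corner i ∧ (D.nextFlag x).1.2 = D.corner (i + 1) := by
  obtain ⟨c, hc, he⟩ := ((D.isOrientedDisk.boundary _ _).1 (D.isEdge_corner i)).1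
  exact ⟨Cell.flag ⟨c, hc⟩ _ he.left_mem, rfl,
    Subtype.ext (he.next_eq (Cell.isPolygon ⟨c, hc⟩).1)⟩

/-- The combinatorial disk of a generalized dissection of a quadrilateral. -/
def quadDisk : QuadDisk D.Flag D.Vertex D.Cell where
  vert x := x.1.2
  cell x := x.1.1
  nx := D.nextFlag
  rev := D.revFlag
  bd i := (D.exists_corner_flag i).choose
  corner := D.corner
  cell_nx _ := rfl
  ext _ _ := flag_ext
  rev_rev := revFlag_revFlag
  vert_rev x hx := (isOpposite_revFlag hx).1
  rev_eq_self x := by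
    rw [revFlag_eq_self_iff]
    constructor
    · intro h
      obtain ⟨i, h1, h2⟩ := D.exists_corner_of_isEdge h
      have hs := (D.exists_corner_flag i).choose_spec
      exact ⟨i, flag_eq_of_isEdge ((Subtype.ext h1).trans hs.1.symm)
        ((Subtype.ext h2).trans hs.2.symm)⟩
    · rintro ⟨i, rfl⟩
      have hs := (D.exists_corner_flag i).choose_spec
      rw [hs.1, hs.2]
      exact D.isEdge_corner i
  vert_bd i := (D.exists_corner_flag i).choose_spec.1
  vert_nx_bd i := (D.exists_corner_flag i).choose_spec.2
  corner_injective := D.corner_injective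
  exact := exists_rat_potential

end Quad

end GeneralizedDissection
end

noncomputable section

/-! ## Varieties with a generic point in a purely transcendental extension -/

open scoped Classical
open MvPolynomial

section GenericPoint
variable {σ τ : Type*}

/-- The field of rational functions in variables indexed by `τ`. -/
abbrev RatFunField (τ : Type*) : Type _ := FractionRing (MvPolynomial τ ℂ)

/-- A variable, as a rational function. -/
def ratX (j : τ) : RatFunField τ := algebraMap (MvPolynomial τ ℂ) _ (X j)

/-- The variety with generic point `φ`. -/
def varietyOfGenericPoint {L : Type*} [Field L] [Algebra ℂ L] (φ : σ → L) : Set (σ → ℂ) :=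
  zeroLocus ℂ (RingHom.ker (aeval φ : MvPolynomial σ ℂ →ₐ[ℂ] L))

theorem algebraicIndependent_ratX (s : Set τ) :
    AlgebraicIndependent ℂ (fun j : s => ratX j.1) := by
  have h : AlgebraicIndependent ℂ (ratX : τ → RatFunField τ) := by
    have := (MvPolynomial.algebraicIndependent_X τ ℂ).map'
      (f := IsScalarTower.toAlgHom ℂ (MvPolynomial τ ℂ) (RatFunField τ))
      (IsFractionRing.injective _ _)
    exact this
  exact h.comp _ Subtype.val_injective

variable [Finite σ]

/-- Nullstellensatz: the kernel of a map to a field is prime, hence recovered from its zero locus.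
-/
theorem vanishingIdeal_varietyOfGenericPoint {L : Type*} [Field L] [Algebra ℂ L] (φ : σ → L) :
    vanishingIdeal ℂ (varietyOfGenericPoint φ) =
      RingHom.ker (aeval φ : MvPolynomial σ ℂ →ₐ[ℂ] L) := by
  have := RingHom.ker_isPrime (aeval φ : MvPolynomial σ ℂ →ₐ[ℂ] L)
  exact IsPrime.vanishingIdeal_zeroLocus _

theorem IsZariskiClosed.eq_zeroLocus_vanishingIdeal {σ : Type*} {A : Set (σ → ℂ)}
    (hA : IsZariskiClosed A) :
    A = zeroLocus ℂ (vanishingIdeal ℂ A) := by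
  obtain ⟨I, rfl⟩ := hA
  exact le_antisymm (zeroLocus_vanishingIdeal_le _)
    (zeroLocus_anti_mono (le_vanishingIdeal_zeroLocus I))

theorem isIrreducibleVariety_varietyOfGenericPoint {L : Type*} [Field L] [Algebra ℂ L]
    (φ : σ → L) : IsIrreducibleVariety (varietyOfGenericPoint φ) := by
  have hp := RingHom.ker_isPrime (aeval φ : MvPolynomial σ ℂ →ₐ[ℂ] L)
  have hv := vanishingIdeal_varietyOfGenericPoint φ
  refine ⟨⟨_, rfl⟩, ?_, ?_⟩
  · by_contra h
    rw [Set.not_nonempty_iff_eq_empty] at h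
    rw [h, vanishingIdeal_empty] at hv
    exact hp.ne_top hv.symm
  · intro A B hA hB hAB
    rw [hA.eq_zeroLocus_vanishingIdeal, hB.eq_zeroLocus_vanishingIdeal] at *
    have key : ∀ I : Ideal (MvPolynomial σ ℂ), I ≤ RingHom.ker (aeval φ : MvPolynomial σ ℂ →ₐ[ℂ] L) →
        varietyOfGenericPoint φ ⊆ zeroLocus ℂ I := fun I hI => zeroLocus_anti_mono hI
    by_contra! hcon
    obtain ⟨F, hF, hF'⟩ := SetLike.not_le_iff_exists.1 fun h => hcon.1 (key _ h)
    obtain ⟨G, hG, hG'⟩ := SetLike.not_le_iff_exists.1 fun h => hcon.2 (key _ h)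
    have : F * G ∈ RingHom.ker (aeval φ : MvPolynomial σ ℂ →ₐ[ℂ] L) := by
      rw [← hv]
      intro x hx
      rw [map_mul]
      obtain h | h := hAB hx
      · rw [h F hF, zero_mul]
      · rw [h G hG, mul_zero]
    exact (hp.mem_or_mem this).elim hF' hG'

omit [Finite σ] in
theorem nonempty_fractionRing_algEquiv_adjoin {A L : Type*} [CommRing A] [IsDomain A] [Algebra ℂ A]
    [Field L] [Algebra ℂ L] (g : A →ₐ[ℂ] L) (hg : Function.Injective g) (S : Set L)
    (hS : g.range = Algebra.adjoin ℂ S) :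
    Nonempty (FractionRing A ≃ₐ[ℂ] IntermediateField.adjoin ℂ S) := by
  let i := IsFractionRing.liftAlgHom (K := FractionRing A) (g := g) hg
  have hi : i.fieldRange = IntermediateField.adjoin ℂ S :=
    IsFractionRing.algHom_fieldRange_eq_of_comp_eq_of_range_eq (g := g) (f := i)
      (RingHom.ext fun a => IsFractionRing.lift_algebraMap hg a) hS
  exact ⟨(AlgEquiv.ofInjectiveField i).trans (IntermediateField.equivOfEq hi)⟩

omit [Finite σ] in
theorem nonempty_adjoin_ratX_algEquiv [Finite τ] (s : Set τ) :
    ∃ d : ℕ, Nonempty (IntermediateField.adjoin ℂ (ratX '' s : Set (RatFunField τ)) ≃ₐ[ℂ]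
      FractionRing (MvPolynomial (Fin d) ℂ)) := by
  have hs : (ratX '' s : Set (RatFunField τ)) = Set.range fun j : s => ratX j.1 := by
    ext y
    simp
  rw [hs]
  let e : FractionRing (MvPolynomial s ℂ) ≃ₐ[ℂ] FractionRing (MvPolynomial (Fin (Nat.card s)) ℂ) :=
    IsFractionRing.algEquivOfAlgEquiv (MvPolynomial.renameEquiv ℂ (Finite.equivFin s))
  exact ⟨Nat.card s, ⟨(algebraicIndependent_ratX s).aevalEquivField.symm.trans e⟩⟩

/-- The coordinate ring is ℂ[φ], so the function field is ℂ(φ). It does not suffice that this sits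
inside a field of rational functions; the hypothesis identifies it with the subfield generated by a
set of variables. -/
theorem nonempty_functionField_algEquiv [Finite τ] (φ : σ → RatFunField τ) (s : Set τ)
    (hs : IntermediateField.adjoin ℂ (Set.range φ) = IntermediateField.adjoin ℂ (ratX '' s)) :
    ∃ d : ℕ, Nonempty (VarietyFunctionField (varietyOfGenericPoint φ) ≃ₐ[ℂ]
      FractionRing (MvPolynomial (Fin d) ℂ)) := by
  set f : MvPolynomial σ ℂ →ₐ[ℂ] RatFunField τ := aeval φ with hf
  have hv := vanishingIdeal_varietyOfGenericPoint φ
  set P := vanishingIdeal ℂ (varietyOfGenericPoint φ)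
  have hp : P.IsPrime := by rw [hv]; exact RingHom.ker_isPrime f
  let g : (MvPolynomial σ ℂ ⧸ P) →ₐ[ℂ] RatFunField τ :=
    Ideal.Quotient.liftₐ P f fun a ha => by rw [hv] at ha; exact ha
  have hg : Function.Injective g := by
    rw [injective_iff_map_eq_zero]
    intro a ha
    obtain ⟨a, rfl⟩ := Ideal.Quotient.mk_surjective a
    rw [Ideal.Quotient.eq_zero_iff_mem, hv]
    exact ha
  have hgr : g.range = Algebra.adjoin ℂ (Set.range φ) := by
    rw [Algebra.adjoin_range_eq_range_aeval]
    ext y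
    constructor
    · rintro ⟨a, rfl⟩
      obtain ⟨a, rfl⟩ := Ideal.Quotient.mk_surjective a
      exact ⟨a, rfl⟩
    · rintro ⟨a, rfl⟩
      exact ⟨Ideal.Quotient.mk P a, rfl⟩
  obtain ⟨d, ⟨e⟩⟩ := nonempty_adjoin_ratX_algEquiv s
  rw [← hs] at e
  obtain ⟨e'⟩ := nonempty_fractionRing_algEquiv_adjoin g hg _ hgr
  exact ⟨d, ⟨e'.trans e⟩⟩

end GenericPoint

/-! ## Specialization of rational functions -/

section Specialization
variable {τ : Type*}

/-- The rational function `f` is defined at the point `c` and takes the value `z` there. -/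
def SpecializesTo (c : τ → ℂ) (f : RatFunField τ) (z : ℂ) : Prop :=
  ∃ a b : MvPolynomial τ ℂ, eval c b ≠ 0 ∧
    f = algebraMap _ (RatFunField τ) a / algebraMap _ (RatFunField τ) b ∧ z = eval c a / eval c b

variable {c : τ → ℂ} {f g : RatFunField τ} {y z : ℂ}

theorem algebraMap_ne_zero_of_eval {b : MvPolynomial τ ℂ} (hb : eval c b ≠ 0) :
    algebraMap _ (RatFunField τ) b ≠ 0 := by
  rw [ne_eq, FaithfulSMul.algebraMap_eq_zero_iff]
  rintro rfl
  simp at hb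

theorem specializesTo_ratX (c : τ → ℂ) (j : τ) : SpecializesTo c (ratX j) (c j) :=
  ⟨X j, 1, by simp, by simp [ratX], by simp⟩

theorem specializesTo_algebraMap (c : τ → ℂ) (r : ℂ) :
    SpecializesTo c (algebraMap ℂ (RatFunField τ) r) r :=
  ⟨C r, 1, by simp, by
    rw [map_one, div_one, ← MvPolynomial.algebraMap_eq, ← IsScalarTower.algebraMap_apply], by simp⟩

theorem SpecializesTo.add (hf : SpecializesTo c f y) (hg : SpecializesTo c g z) :
    SpecializesTo c (f + g) (y + z) := by
  obtain ⟨a, b, hb, rfl, rfl⟩ := hf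
  obtain ⟨a', b', hb', rfl, rfl⟩ := hg
  refine ⟨a * b' + b * a', b * b', by simp [hb, hb'], ?_, ?_⟩
  · rw [div_add_div _ _ (algebraMap_ne_zero_of_eval hb) (algebraMap_ne_zero_of_eval hb')]
    simp
  · rw [div_add_div _ _ hb hb']
    simp

theorem SpecializesTo.mul (hf : SpecializesTo c f y) (hg : SpecializesTo c g z) :
    SpecializesTo c (f * g) (y * z) := by
  obtain ⟨a, b, hb, rfl, rfl⟩ := hf
  obtain ⟨a', b', hb', rfl, rfl⟩ := hg
  refine ⟨a * a', b * b', by simp [hb, hb'], ?_, ?_⟩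
  · rw [div_mul_div_comm]; simp
  · rw [div_mul_div_comm]; simp

theorem SpecializesTo.neg (hf : SpecializesTo c f y) : SpecializesTo c (-f) (-y) := by
  obtain ⟨a, b, hb, rfl, rfl⟩ := hf
  exact ⟨-a, b, hb, by rw [map_neg]; exact (neg_div _ _).symm, by rw [map_neg, neg_div]⟩

theorem SpecializesTo.sub (hf : SpecializesTo c f y) (hg : SpecializesTo c g z) :
    SpecializesTo c (f - g) (y - z) := by
  simpa [sub_eq_add_neg] using hf.add hg.neg

theorem SpecializesTo.inv (hf : SpecializesTo c f y) (hy : y ≠ 0) : SpecializesTo c f⁻¹ y⁻¹ := by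
  obtain ⟨a, b, hb, rfl, rfl⟩ := hf
  refine ⟨b, a, fun h => hy (by simp [h]), by simp, by simp⟩

theorem SpecializesTo.div (hf : SpecializesTo c f y) (hg : SpecializesTo c g z) (hz : z ≠ 0) :
    SpecializesTo c (f / g) (y / z) := by
  simpa [div_eq_mul_inv] using hf.mul (hg.inv hz)

/-- A nonzero value at one point certifies that a rational function is nonzero. In this way a single
regular configuration justifies the generic denominators. -/
theorem SpecializesTo.ne_zero (hf : SpecializesTo c f y) (hy : y ≠ 0) : f ≠ 0 := by
  obtain ⟨a, b, hb, rfl, rfl⟩ := hf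
  exact div_ne_zero (algebraMap_ne_zero_of_eval (c := c) fun h => hy (by rw [h, zero_div]))
    (algebraMap_ne_zero_of_eval hb)

theorem SpecializesTo.aeval {σ : Type*} {φ : σ → RatFunField τ} {ρ : σ → ℂ}
    (h : ∀ j, SpecializesTo c (φ j) (ρ j)) (F : MvPolynomial σ ℂ) :
    SpecializesTo c (MvPolynomial.aeval φ F) (MvPolynomial.aeval ρ F) := by
  induction F using MvPolynomial.induction_on with
  | C a => simpa using specializesTo_algebraMap c a
  | add F G hF hG => simpa using hF.add hG
  | mul_X F j hF => simpa using hF.mul (h j)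

/-- A specialization of the generic point lies on the variety. -/
theorem mem_varietyOfGenericPoint {σ : Type*} {φ : σ → RatFunField τ} {ρ : σ → ℂ}
    (h : ∀ j, SpecializesTo c (φ j) (ρ j)) : ρ ∈ varietyOfGenericPoint φ := by
  intro F hF
  by_contra hne
  exact (SpecializesTo.aeval h F).ne_zero hne hF

end Specialization
end

noncomputable section

/-! ## Configurations of points and lines with an elimination order

A point `(x, y)` is recorded as the pair `(x, y)` and a line `y = m x + b` as the pair `(m, -b)`.
Then an incident pair `e`, `f` is characterized by the symmetric relation
`e.2 + f.2 = e.1 * f.1`. -/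

open scoped Classical Finset

namespace SimpleGraph

variable {W : Type*} (G : SimpleGraph W) (k : Fin 4 → W)

/-- The set `S` is obtained from the four corners by adding vertices one after the other, each of
which has at most two neighbours among the previous ones. -/
inductive Constructible : Finset W → Prop
  | base : Constructible (Finset.univ.image k)
  | step (S : Finset W) (e : W) (hS : Constructible S) (he : e ∉ S)
      (hcard : #{f ∈ S | G.Adj e f} ≤ 2) : Constructible (insert e S)

/-- A configuration on `S` with coordinates in `F`, in which the corners form a parallelogram. -/
structure IsConfig {F : Type*} [Field F] (S : Finset W) (x : W × Fin 2 → F) : Prop where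
  adj : ∀ e ∈ S, ∀ f ∈ S, G.Adj e f → x (e, 1) + x (f, 1) = x (e, 0) * x (f, 0)
  parallelogram : ∀ i, x (k 0, i) + x (k 2, i) = x (k 1, i) + x (k 3, i)

/-- Any two neighbours of a vertex have different first coordinates. -/
def IsRegularConfig {F : Type*} (S : Finset W) (x : W × Fin 2 → F) : Prop :=
  ∀ e ∈ S, ∀ f ∈ S, ∀ g ∈ S, G.Adj e f → G.Adj e g → f ≠ g → x (f, 0) ≠ x (g, 0)

variable {G k}

theorem IsConfig.mono {F : Type*} [Field F] {S S' : Finset W} {x : W × Fin 2 → F} (h : S ⊆ S')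
    (hx : G.IsConfig k S' x) : G.IsConfig k S x :=
  ⟨fun e he f hf => hx.adj e (h he) f (h hf), hx.parallelogram⟩

theorem IsRegularConfig.mono {F : Type*} {S S' : Finset W} {x : W × Fin 2 → F}
    (h : S ⊆ S') (hx : G.IsRegularConfig S' x) : G.IsRegularConfig S x :=
  fun e he f hf g hg => hx e (h he) f (h hf) g (h hg)

/-- A generic configuration on `S`, with parameters the variables in `s`. -/
structure IsGenericConfig (G : SimpleGraph W) (k : Fin 4 → W) (S : Finset W)
    (φ : W × Fin 2 → RatFunField (W × Fin 2)) (s : Set (W × Fin 2)) : Prop where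
  isConfig : G.IsConfig k S φ
  adjoin_eq : IntermediateField.adjoin ℂ (φ '' {j | j.1 ∈ S}) =
    IntermediateField.adjoin ℂ (ratX '' s)
  specializes : ∀ ρ, G.IsConfig k S ρ → G.IsRegularConfig S ρ →
    ∀ e ∈ S, ∀ i, SpecializesTo ρ (φ (e, i)) (ρ (e, i))

theorem Constructible.corner_mem {S : Finset W} (h : G.Constructible k S) (i : Fin 4) :
    k i ∈ S := by
  induction h with
  | base => simp
  | step S e _ _ _ ih => exact Finset.mem_insert_of_mem ih

/-- Three corners are free and the parallelogram equation gives the fourth. Variables are named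
after coordinates, so a configuration is the specialization at the point given by its own
coordinates. -/
theorem exists_isGenericConfig_base (hk : Function.Injective k) (hadj : ∀ i j, ¬ G.Adj (k i) (k j)) :
    ∃ φ s, IsGenericConfig G k (Finset.univ.image k) φ s := by
  let φ : W × Fin 2 → RatFunField (W × Fin 2) := fun j =>
    if j.1 = k 3 then ratX (k 0, j.2) + ratX (k 2, j.2) - ratX (k 1, j.2) else ratX j
  have h3 : ∀ i, φ (k 3, i) = ratX (k 0, i) + ratX (k 2, i) - ratX (k 1, i) := fun i => by simp [φ]
  have hj : ∀ j, j ≠ 3 → ∀ i, φ (k j, i) = ratX (k j, i) := fun j hj i => by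
    simp [φ, hk.eq_iff, hj]
  have hpar : ∀ i, φ (k 0, i) + φ (k 2, i) = φ (k 1, i) + φ (k 3, i) := fun i => by
    rw [h3, hj 0 (by decide), hj 1 (by decide), hj 2 (by decide)]; ring
  refine ⟨φ, {j | ∃ l, l ≠ 3 ∧ j.1 = k l}, ⟨?_, hpar⟩, ?_, ?_⟩
  · intro e he f hf hef
    obtain ⟨i, -, rfl⟩ := Finset.mem_image.1 he
    obtain ⟨j, -, rfl⟩ := Finset.mem_image.1 hf
    exact absurd hef (hadj i j)
  · have hX : ∀ l, l ≠ 3 → ∀ i, (ratX (k l, i) : RatFunField (W × Fin 2)) ∈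
        IntermediateField.adjoin ℂ (ratX '' {j | ∃ l, l ≠ 3 ∧ j.1 = k l}) := fun l hl i =>
      IntermediateField.subset_adjoin _ _ ⟨(k l, i), ⟨l, hl, rfl⟩, rfl⟩
    refine le_antisymm (IntermediateField.adjoin_le_iff.2 ?_) (IntermediateField.adjoin_le_iff.2 ?_)
    · rintro _ ⟨⟨e, i⟩, he, rfl⟩
      obtain ⟨l, -, rfl⟩ := Finset.mem_image.1 (show e ∈ Finset.univ.image k from he)
      by_cases hl : l = 3
      · subst hl
        rw [h3]
        exact sub_mem (add_mem (hX 0 (by decide) i) (hX 2 (by decide) i)) (hX 1 (by decide) i)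
      · rw [hj l hl]; exact hX l hl i
    · rintro _ ⟨⟨e, i⟩, ⟨l, hl, rfl⟩, rfl⟩
      exact IntermediateField.subset_adjoin _ _ ⟨(k l, i), by simp, hj l hl i⟩
  · intro ρ hρ _ e he i
    obtain ⟨l, -, rfl⟩ := Finset.mem_image.1 he
    by_cases hl : l = 3
    · subst hl
      rw [h3, show ρ (k 3, i) = ρ (k 0, i) + ρ (k 2, i) - ρ (k 1, i) by
        rw [hρ.parallelogram]; ring]
      exact ((specializesTo_ratX _ _).add (specializesTo_ratX _ _)).sub (specializesTo_ratX _ _)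
    · rw [hj l hl]; exact specializesTo_ratX _ _

/-- The common part of the three cases of the induction: `a` holds the coordinates of the new
element and `t` its new variables. By `hat` and `hta`, adjoining `a` enlarges the field exactly by
the variables in `t`. -/
theorem IsGenericConfig.extend {S : Finset W} {φ : W × Fin 2 → RatFunField (W × Fin 2)}
    {s : Set (W × Fin 2)} (h : IsGenericConfig G k S φ s) (hk : ∀ i, k i ∈ S) {e : W} (he : e ∉ S)
    (a : Fin 2 → RatFunField (W × Fin 2)) (t : Set (W × Fin 2))
    (hadj : ∀ f ∈ S, G.Adj e f → a 1 + φ (f, 1) = a 0 * φ (f, 0))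
    (hat : ∀ i, a i ∈ IntermediateField.adjoin ℂ (ratX '' (s ∪ t)))
    (hta : ∀ j ∈ t, ∃ i, ratX j = a i)
    (hspec : ∀ ρ, G.IsConfig k (insert e S) ρ → G.IsRegularConfig (insert e S) ρ →
      ∀ i, SpecializesTo ρ (a i) (ρ (e, i))) :
    ∃ φ, IsGenericConfig G k (insert e S) φ (s ∪ t) := by
  let ψ : W × Fin 2 → RatFunField (W × Fin 2) := fun j => if j.1 = e then a j.2 else φ j
  have he' : ∀ i, ψ (e, i) = a i := fun i => by simp [ψ]
  have hS : ∀ f ∈ S, ∀ i, ψ (f, i) = φ (f, i) := fun f hf i => by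
    have : f ≠ e := fun h => he (h ▸ hf)
    simp [ψ, this]
  refine ⟨ψ, ⟨?_, ?_⟩, ?_, ?_⟩
  · intro f hf g hg hfg
    obtain hfe | hf' := Finset.mem_insert.1 hf
    · subst hfe
      obtain hge | hg' := Finset.mem_insert.1 hg
      · exact absurd (hge ▸ hfg) G.irrefl
      · rw [he', he', hS g hg', hS g hg', hadj g hg' hfg]
    · obtain hge | hg' := Finset.mem_insert.1 hg
      · subst hge
        rw [he', he', hS f hf', hS f hf', add_comm, hadj f hf' hfg.symm, mul_comm]
      · rw [hS f hf', hS f hf', hS g hg', hS g hg', h.isConfig.adj f hf' g hg' hfg]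
  · intro i
    rw [hS _ (hk 0), hS _ (hk 1), hS _ (hk 2), hS _ (hk 3), h.isConfig.parallelogram]
  · have hle : IntermediateField.adjoin ℂ (ratX '' s) ≤
        IntermediateField.adjoin ℂ (ratX '' (s ∪ t)) :=
      IntermediateField.adjoin.mono _ _ _ (Set.image_mono Set.subset_union_left)
    refine le_antisymm (IntermediateField.adjoin_le_iff.2 ?_) (IntermediateField.adjoin_le_iff.2 ?_)
    · rintro _ ⟨⟨f, i⟩, hf, rfl⟩
      obtain rfl | hf := Finset.mem_insert.1 hf
      · rw [he']; exact hat i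
      · rw [hS f hf]
        refine hle ?_
        rw [← h.adjoin_eq]
        exact IntermediateField.subset_adjoin _ _ ⟨(f, i), hf, rfl⟩
    · rintro _ ⟨j, hj | hj, rfl⟩
      · have h1 : (ratX j : RatFunField (W × Fin 2)) ∈ IntermediateField.adjoin ℂ (ratX '' s) :=
          IntermediateField.subset_adjoin _ _ ⟨j, hj, rfl⟩
        rw [← h.adjoin_eq] at h1
        refine IntermediateField.adjoin_le_iff.2 ?_ h1
        rintro _ ⟨⟨f, i⟩, hf, rfl⟩
        exact IntermediateField.subset_adjoin _ _ ⟨(f, i), Finset.mem_insert_of_mem hf, hS f hf i⟩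
      · obtain ⟨i, hi⟩ := hta j hj
        rw [hi]
        exact IntermediateField.subset_adjoin _ _ ⟨(e, i), by simp, he' i⟩
  · intro ρ hρ hρ' f hf i
    obtain rfl | hf := Finset.mem_insert.1 hf
    · rw [he']; exact hspec ρ hρ hρ' i
    · rw [hS f hf]
      exact h.specializes ρ (hρ.mono (Finset.subset_insert _ _))
        (hρ'.mono (Finset.subset_insert _ _)) f hf i

theorem IsGenericConfig.mem_adjoin {S : Finset W} {φ : W × Fin 2 → RatFunField (W × Fin 2)}
    {s t : Set (W × Fin 2)} (h : IsGenericConfig G k S φ s) {f : W} (hf : f ∈ S) (i : Fin 2) :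
    φ (f, i) ∈ IntermediateField.adjoin ℂ (ratX '' (s ∪ t)) := by
  have h1 : φ (f, i) ∈ IntermediateField.adjoin ℂ (φ '' {j | j.1 ∈ S}) :=
    IntermediateField.subset_adjoin _ _ ⟨(f, i), hf, rfl⟩
  rw [h.adjoin_eq] at h1
  exact IntermediateField.adjoin.mono _ _ _ (Set.image_mono Set.subset_union_left) h1

/-- If `S` is constructible and carries some regular configuration, then it has a generic
configuration. -/
theorem Constructible.exists_isGenericConfig (hk : Function.Injective k)
    (hadj : ∀ i j, ¬ G.Adj (k i) (k j)) {S : Finset W} (hS : G.Constructible k S)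
    (hex : ∃ ρ : W × Fin 2 → ℂ, G.IsConfig k S ρ ∧ G.IsRegularConfig S ρ) :
    ∃ φ s, IsGenericConfig G k S φ s := by
  induction hS with
  | base => exact exists_isGenericConfig_base hk hadj
  | step S e hS he hcard ih =>
    obtain ⟨ρ₀, hρ₀, hρ₀'⟩ := hex
    have hsub := Finset.subset_insert e S
    obtain ⟨φ, s, h⟩ := ih ⟨ρ₀, hρ₀.mono hsub, hρ₀'.mono hsub⟩
    set N : Finset W := {f ∈ S | G.Adj e f} with hN
    have hNS : ∀ f, f ∈ N ↔ f ∈ S ∧ G.Adj e f := fun f => Finset.mem_filter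
    have hkS := hS.corner_mem
    have hcases : N.card = 0 ∨ N.card = 1 ∨ N.card = 2 := by omega
    obtain h0 | h1 | h2 := hcases
    -- No earlier neighbour: both coordinates are new variables.
    · rw [Finset.card_eq_zero] at h0
      obtain ⟨φ', h'⟩ := h.extend hkS he (fun i => ratX (e, i)) {j | j.1 = e}
        (fun f hf hef => by
          have := (hNS f).2 ⟨hf, hef⟩
          simp [h0] at this)
        (fun i => IntermediateField.subset_adjoin _ _ ⟨(e, i), Or.inr rfl, rfl⟩)
        (by rintro ⟨f, i⟩ hf; obtain rfl : f = e := hf; exact ⟨i, rfl⟩)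
        (fun ρ _ _ i => specializesTo_ratX _ _)
      exact ⟨φ', _, h'⟩
    -- One earlier neighbour: the first coordinate is free and incidence determines the second.
    · obtain ⟨f, hf⟩ := Finset.card_eq_one.1 h1
      have hfN : f ∈ S ∧ G.Adj e f := (hNS f).1 (by rw [hf]; simp)
      have hX : (ratX (e, 0) : RatFunField (W × Fin 2)) ∈
          IntermediateField.adjoin ℂ (ratX '' (s ∪ {(e, 0)})) :=
        IntermediateField.subset_adjoin _ _ ⟨(e, 0), Or.inr rfl, rfl⟩
      obtain ⟨φ', h'⟩ := h.extend hkS he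
        ![ratX (e, 0), ratX (e, 0) * φ (f, 0) - φ (f, 1)] {(e, 0)}
        (fun g hg heg => by
          have := (hNS g).2 ⟨hg, heg⟩
          rw [hf, Finset.mem_singleton] at this
          subst this
          simp)
        (fun i => by
          fin_cases i
          · exact hX
          · exact sub_mem (mul_mem hX (h.mem_adjoin hfN.1 0)) (h.mem_adjoin hfN.1 1))
        (by rintro _ rfl; exact ⟨0, rfl⟩)
        (fun ρ hρ hρ' i => by
          have hs := h.specializes ρ (hρ.mono hsub) (hρ'.mono hsub) f hfN.1
          fin_cases i
          · exact specializesTo_ratX _ _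
          · have := hρ.adj e (Finset.mem_insert_self _ _) f (hsub hfN.1) hfN.2
            change SpecializesTo ρ (ratX (e, 0) * φ (f, 0) - φ (f, 1)) (ρ (e, 1))
            rw [show ρ (e, 1) = ρ (e, 0) * ρ (f, 0) - ρ (f, 1) by rw [← this]; ring]
            exact ((specializesTo_ratX _ _).mul (hs 0)).sub (hs 1))
      exact ⟨φ', _, h'⟩
    -- Two earlier neighbours: the difference of the incidence equations gives the first coordinate,
    -- as a slope or dually as an abscissa. Its denominator is nonzero because it specializes to a
    -- nonzero number at the regular `ρ₀`.
    · obtain ⟨f, g, hfg, hfgN⟩ := Finset.card_eq_two.1 h2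
      have hfN : f ∈ S ∧ G.Adj e f := (hNS f).1 (by rw [hfgN]; simp)
      have hgN : g ∈ S ∧ G.Adj e g := (hNS g).1 (by rw [hfgN]; simp)
      have hreg : ∀ ρ : W × Fin 2 → ℂ, G.IsRegularConfig (insert e S) ρ →
          ρ (f, 0) - ρ (g, 0) ≠ 0 := fun ρ hρ =>
        sub_ne_zero.2 (hρ e (Finset.mem_insert_self _ _) f (hsub hfN.1) g (hsub hgN.1)
          hfN.2 hgN.2 hfg)
      have hs := fun ρ (hρ : G.IsConfig k (insert e S) ρ) hρ' =>
        h.specializes ρ (hρ.mono hsub) (IsRegularConfig.mono hsub hρ')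
      have hne : φ (f, 0) - φ (g, 0) ≠ 0 :=
        ((hs ρ₀ hρ₀ hρ₀' f hfN.1 0).sub (hs ρ₀ hρ₀ hρ₀' g hgN.1 0)).ne_zero (hreg ρ₀ hρ₀')
      set m := (φ (f, 1) - φ (g, 1)) / (φ (f, 0) - φ (g, 0)) with hm
      have hm' : m * (φ (f, 0) - φ (g, 0)) = φ (f, 1) - φ (g, 1) := div_mul_cancel₀ _ hne
      have hmem : ∀ j i, j ∈ S → φ (j, i) ∈ IntermediateField.adjoin ℂ (ratX '' (s ∪ ∅)) :=
        fun j i hj => h.mem_adjoin hj i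
      have hmm : m ∈ IntermediateField.adjoin ℂ (ratX '' (s ∪ ∅)) :=
        div_mem (sub_mem (hmem _ _ hfN.1) (hmem _ _ hgN.1))
          (sub_mem (hmem _ _ hfN.1) (hmem _ _ hgN.1))
      obtain ⟨φ', h'⟩ := h.extend hkS he ![m, m * φ (f, 0) - φ (f, 1)] ∅
        (fun j hj hej => by
          have := (hNS j).2 ⟨hj, hej⟩
          rw [hfgN, Finset.mem_insert, Finset.mem_singleton] at this
          obtain rfl | rfl := this
          · simp
          · simp only [Matrix.cons_val_zero, Matrix.cons_val_one]
            linear_combination hm')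
        (fun i => by
          fin_cases i
          · exact hmm
          · exact sub_mem (mul_mem hmm (hmem _ _ hfN.1)) (hmem _ _ hfN.1))
        (by simp)
        (fun ρ hρ hρ' i => by
          have af := hρ.adj e (Finset.mem_insert_self _ _) f (hsub hfN.1) hfN.2
          have ag := hρ.adj e (Finset.mem_insert_self _ _) g (hsub hgN.1) hgN.2
          have hsf := hs ρ hρ hρ' f hfN.1
          have hsg := hs ρ hρ hρ' g hgN.1
          have hms : SpecializesTo ρ m (ρ (e, 0)) := by
            rw [show ρ (e, 0) = (ρ (f, 1) - ρ (g, 1)) / (ρ (f, 0) - ρ (g, 0)) by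
              rw [eq_div_iff (hreg ρ hρ')]; linear_combination ag - af]
            exact ((hsf 1).sub (hsg 1)).div ((hsf 0).sub (hsg 0)) (hreg ρ hρ')
          fin_cases i
          · exact hms
          · change SpecializesTo ρ (m * φ (f, 0) - φ (f, 1)) (ρ (e, 1))
            rw [show ρ (e, 1) = ρ (e, 0) * ρ (f, 0) - ρ (f, 1) by rw [← af]; ring]
            exact (hms.mul (hsf 0)).sub (hsf 1))
      exact ⟨φ', _, h'⟩

/-- A set is constructible if in each intermediate set some vertex other than a corner has at most
two neighbours. -/
theorem constructible_of_forall (S : Finset W) (hkS : ∀ i, k i ∈ S)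
    (h : ∀ S' ⊆ S, (∀ i, k i ∈ S') → S' ≠ Finset.univ.image k →
      ∃ e ∈ S', (∀ i, e ≠ k i) ∧ #{f ∈ S' | G.Adj e f} ≤ 2) : G.Constructible k S := by
  induction hn : S.card generalizing S with
  | zero =>
    rw [Finset.card_eq_zero] at hn
    exact absurd (hkS 0) (by simp [hn])
  | succ n ih =>
    by_cases hS : S = Finset.univ.image k
    · rw [hS]; exact .base
    · obtain ⟨e, he, hek, hcard⟩ := h S subset_rfl hkS hS
      rw [← Finset.insert_erase he]
      refine .step _ e (ih _ (fun i => Finset.mem_erase.2 ⟨(hek i).symm, hkS i⟩)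
        (fun S' hS' => h S' (hS'.trans (Finset.erase_subset _ _)))
        (by rw [Finset.card_erase_of_mem he, hn]; rfl)) (by simp) ?_
      exact (Finset.card_le_card (Finset.filter_subset_filter _ (Finset.erase_subset _ _))).trans hcard

end SimpleGraph
end

noncomputable section

/-! ## Zariski dense open subsets of irreducible varieties are dense in the usual topology -/

open Filter Topology

section Density

theorem Multiset.pow_card_le_prod_of_forall_le {c : ℝ} (hc : 0 ≤ c) (m : Multiset ℝ)
    (hm : ∀ x ∈ m, c ≤ x) : c ^ card m ≤ m.prod := by
  induction m using Multiset.induction_on with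
  | empty => simp
  | cons a m ih =>
    rw [card_cons, prod_cons, pow_succ']
    have h1 := ih fun x hx => hm x (mem_cons_of_mem hx)
    have h2 := hm a (mem_cons_self a m)
    exact mul_le_mul h2 h1 (pow_nonneg hc _) (hc.trans h2)

/-- A monic complex polynomial with a small value at `z` has a root near `z`. -/
theorem Polynomial.exists_root_norm_sub_pow_le {p : Polynomial ℂ} (hp : p.Monic)
    (hd : p.natDegree ≠ 0) (z : ℂ) :
    ∃ t, p.eval t = 0 ∧ ‖z - t‖ ^ p.natDegree ≤ ‖p.eval z‖ := by
  have hsplit := IsAlgClosed.splits p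
  have hcard : p.roots.card = p.natDegree := hsplit.natDegree_eq_card_roots.symm
  have hne : p.roots.toFinset.Nonempty := by
    rw [Multiset.toFinset_nonempty]
    intro h
    rw [h] at hcard
    exact hd hcard.symm
  obtain ⟨t, ht, hmin⟩ := p.roots.toFinset.exists_min_image (fun t => ‖z - t‖) hne
  rw [Multiset.mem_toFinset] at ht
  refine ⟨t, (Polynomial.mem_roots'.1 ht).2, ?_⟩
  have heval : p.eval z = (p.roots.map fun a => z - a).prod := by
    conv_lhs => rw [hsplit.eq_prod_roots_of_monic hp]
    rw [Polynomial.eval_multiset_prod, Multiset.map_map]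
    simp
  have hnorm : ‖p.eval z‖ = (p.roots.map fun a => ‖z - a‖).prod := by
    rw [heval, show ‖(p.roots.map fun a => z - a).prod‖ = _ from map_multiset_prod (normHom (α := ℂ)) _, Multiset.map_map]
    rfl
  rw [hnorm, ← hcard, ← Multiset.card_map (fun a => ‖z - a‖)]
  refine Multiset.pow_card_le_prod_of_forall_le (norm_nonneg _) _ fun x hx => ?_
  obtain ⟨a, ha, rfl⟩ := Multiset.mem_map.1 hx
  exact hmin a (Multiset.mem_toFinset.2 ha)

/-- The roots of a monic complex polynomial are bounded in terms of its coefficients. -/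
theorem Polynomial.norm_root_le {p : Polynomial ℂ} (hp : p.Monic) {t : ℂ} (ht : p.eval t = 0) :
    ‖t‖ ≤ ∑ i ∈ Finset.range p.natDegree, ‖p.coeff i‖ + 1 := by
  have h1 : (‖t‖₊ : ℝ) ≤ p.cauchyBound :=
    NNReal.coe_le_coe.2 (Polynomial.IsRoot.norm_lt_cauchyBound hp.ne_zero ht).le
  refine h1.trans ?_
  rw [Polynomial.cauchyBound, hp.leadingCoeff, nnnorm_one, div_one, NNReal.coe_add, NNReal.coe_one]
  gcongr
  have : (Finset.range p.natDegree).sup (fun i => ‖p.coeff i‖₊) ≤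
      ∑ i ∈ Finset.range p.natDegree, ‖p.coeff i‖₊ :=
    Finset.sup_le fun i hi => Finset.single_le_sum (f := fun i => ‖p.coeff i‖₊)
      (fun _ _ => zero_le) hi
  calc _ ≤ ((∑ i ∈ Finset.range p.natDegree, ‖p.coeff i‖₊ : NNReal) : ℝ) := NNReal.coe_le_coe.2 this
    _ = _ := by push_cast; rfl

namespace MvPolynomial

theorem continuous_aeval' {σ : Type*} (F : MvPolynomial σ ℂ) :
    Continuous fun x : σ → ℂ => aeval x F := by
  simpa [aeval_eq_eval] using continuous_eval F

/-- The set where a nonzero polynomial does not vanish is dense. -/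
theorem dense_setOf_eval_ne_zero {σ : Type*} {a : MvPolynomial σ ℂ} (ha : a ≠ 0) :
    Dense {y : σ → ℂ | aeval y a ≠ 0} := by
  intro y₀
  obtain ⟨y₁, hy₁⟩ : ∃ y₁ : σ → ℂ, aeval y₁ a ≠ 0 := by
    by_contra! h
    exact ha (MvPolynomial.funext fun y => by simpa [aeval_eq_eval] using h y)
  -- On the line joining `y₀` to `y₁` the polynomial has finitely many zeros, so `y₀` is a limit of
  -- other points of that line.
  let l : σ → Polynomial ℂ := fun i =>
    Polynomial.C (y₀ i) + Polynomial.X * Polynomial.C (y₁ i - y₀ i)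
  let q : Polynomial ℂ := aeval l a
  have hq : ∀ t : ℂ, q.eval t = aeval (fun i => y₀ i + t * (y₁ i - y₀ i)) a := by
    intro t
    have h := MvPolynomial.map_aeval l (Polynomial.evalRingHom t) a
    rw [Polynomial.coe_evalRingHom] at h
    rw [show q.eval t = Polynomial.eval t (aeval l a) from rfl, h,
      show (Polynomial.evalRingHom t).comp (algebraMap ℂ (Polynomial ℂ)) = algebraMap ℂ ℂ by
        ext; simp,
      show (fun i => Polynomial.eval t (l i)) = fun i => y₀ i + t * (y₁ i - y₀ i) by
        funext i; simp [l]]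
    rfl
  have hq0 : q ≠ 0 := by
    intro h
    have := hq 1
    rw [h] at this
    simp only [Polynomial.eval_zero, one_mul, add_sub_cancel] at this
    exact hy₁ this.symm
  have hfin : {t : ℂ | q.eval t = 0}.Finite := by
    refine (q.roots.toFinset.finite_toSet).subset fun t ht => ?_
    simpa [hq0] using ht
  have hd : Dense {t : ℂ | q.eval t = 0}ᶜ := hfin.countable.dense_compl ℂ
  have hc : Continuous fun t : ℂ => fun i => y₀ i + t * (y₁ i - y₀ i) := by fun_prop
  have := map_mem_closure (t := {y : σ → ℂ | aeval y a ≠ 0}) hc (hd 0)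
    (fun t ht => by rw [Set.mem_ofPred_eq, ← hq]; exact ht)
  simpa using this

end MvPolynomial

/-- Lying over for points: a root of the specialized minimal polynomial of an integral element is
the value of that element at some point. -/
theorem exists_maximal_of_root {A R : Type*} [CommRing A] [IsDomain A] [IsIntegrallyClosed A]
    [CommRing R] [IsDomain R] [Algebra A R] [FaithfulSMul A R] [Algebra.IsIntegral A R] (θ : R)
    (f : A →+* ℂ) (t : ℂ) (ht : ((minpoly A θ).map f).eval t = 0) :
    ∃ Q : Ideal R, Q.IsMaximal ∧ (∀ a, f a = 0 → algebraMap A R a ∈ Q) ∧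
      ∀ a, f a = t → θ - algebraMap A R a ∈ Q := by
  have hθ : IsIntegral A θ := Algebra.IsIntegral.isIntegral θ
  have ht' : (minpoly A θ).eval₂ f t = 0 := by rwa [Polynomial.eval_map] at ht
  -- Since `A` is integrally closed, A[θ] is A[T] modulo the minimal polynomial, so `f` extends by θ
  -- ↦ t. Lying over transfers the kernel to the integral extension `R`.
  let χ : Algebra.adjoin A {θ} →+* ℂ :=
    (AdjoinRoot.lift f t ht').comp
      (minpoly.equivAdjoin hθ).symm.toRingEquiv.toRingHom
  have hχa : ∀ a, χ (algebraMap A _ a) = f a := fun a => by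
    change AdjoinRoot.lift f t ht' ((minpoly.equivAdjoin hθ).symm (algebraMap A _ a)) = f a
    rw [AlgEquiv.commutes, AdjoinRoot.algebraMap_eq, AdjoinRoot.lift_of]
  have hχθ : χ ⟨θ, Algebra.self_mem_adjoin_singleton A θ⟩ = t := by
    change AdjoinRoot.lift f t ht' ((minpoly.equivAdjoin hθ).symm _) = t
    have : (minpoly.equivAdjoin hθ) (AdjoinRoot.root _) =
        ⟨θ, Algebra.self_mem_adjoin_singleton A θ⟩ := by
      apply Subtype.ext
      simp
    rw [← this, AlgEquiv.symm_apply_apply, AdjoinRoot.lift_root]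
  have hp : (RingHom.ker χ).IsPrime := RingHom.ker_isPrime χ
  have : Algebra.IsIntegral (Algebra.adjoin A {θ}) R := Algebra.IsIntegral.tower_top A
  obtain ⟨Q, -, hQ, hcomap⟩ := Ideal.exists_ideal_over_prime_of_isIntegral (S := R)
    (RingHom.ker χ) ⊥ (by
      rw [← RingHom.ker_eq_comap_bot]
      intro x hx
      have : x = 0 := Subtype.ext hx
      rw [this]; exact Ideal.zero_mem _)
  obtain ⟨M, hM, hQM⟩ := Q.exists_le_maximal hQ.ne_top
  have key : ∀ b : Algebra.adjoin A {θ}, χ b = 0 → (b : R) ∈ M := fun b hb => by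
    have : b ∈ Q.comap (algebraMap (Algebra.adjoin A {θ}) R) := by rw [hcomap]; exact hb
    exact hQM this
  refine ⟨M, hM, fun a ha => key (algebraMap A _ a) (by rw [hχa, ha]), fun a ha => ?_⟩
  exact key (⟨θ, Algebra.self_mem_adjoin_singleton A θ⟩ - algebraMap A _ a)
    (by rw [map_sub, hχθ, hχa, ha, sub_self])

end Density
end

noncomputable section

open Filter Topology MvPolynomial

/-- A nonempty Zariski open subset of an irreducible affine variety is dense in the usual
topology. -/
theorem MvPolynomial.zeroLocus_subset_closure {σ : Type*} [Fintype σ] (P : Ideal (MvPolynomial σ ℂ))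
    [P.IsPrime] {h : MvPolynomial σ ℂ} (hP : h ∉ P) :
    zeroLocus ℂ P ⊆ closure {x | x ∈ zeroLocus ℂ P ∧ aeval x h ≠ 0} := by
  intro z hz
  set R := MvPolynomial σ ℂ ⧸ P
  -- Noether normalization. Points approaching `π z` off a hypersurface are lifted along the finite
  -- map `π`; the difficulty is to choose lifts that approach `z` rather than another point of its
  -- fiber.
  obtain ⟨s, g, hg, hgint⟩ := exists_integral_inj_algHom_of_fg ℂ R
  let A := MvPolynomial (Fin s) ℂ
  let : Algebra A R := g.toRingHom.toAlgebra
  have hgA : ∀ a, algebraMap A R a = g a := fun _ => rfl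
  have : Algebra.IsIntegral A R := ⟨hgint⟩
  have : FaithfulSMul A R := (faithfulSMul_iff_algebraMap_injective A R).2 hg
  -- the finite projection
  choose G hG using fun j => Ideal.Quotient.mk_surjective (I := P) (g (X j))
  let π : (σ → ℂ) → (Fin s → ℂ) := fun x j => aeval x (G j)
  have hπ : Continuous π := continuous_pi fun j => continuous_aeval' (G j)
  let ψ : ∀ x, x ∈ zeroLocus ℂ P → (R →ₐ[ℂ] ℂ) := fun x hx =>
    Ideal.Quotient.liftₐ P (aeval x) fun a ha => hx a ha
  have hψ : ∀ x hx F, ψ x hx (Ideal.Quotient.mk P F) = aeval x F := fun x hx F => rfl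
  have hψg : ∀ x hx (a : A), ψ x hx (algebraMap A R a) = aeval (π x) a := by
    intro x hx a
    have : (ψ x hx).comp g = aeval (π x) := by
      refine MvPolynomial.algHom_ext fun j => ?_
      rw [AlgHom.comp_apply, ← hG, hψ, aeval_X]
    exact DFunLike.congr_fun this a
  -- monic equations
  have hroot : ∀ x hx (r : R), (((minpoly A r).map (aeval (π x) : A →ₐ[ℂ] ℂ).toRingHom)).eval
      (ψ x hx r) = 0 := by
    intro x hx r
    have h1 := congrArg (ψ x hx).toRingHom (minpoly.aeval A r)
    rw [map_zero, Polynomial.aeval_def, Polynomial.hom_eval₂] at h1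
    rw [Polynomial.eval_map]
    rw [show (aeval (π x) : A →ₐ[ℂ] ℂ).toRingHom = (ψ x hx).toRingHom.comp (algebraMap A R) from
      RingHom.ext fun a => (hψg x hx a).symm]
    exact h1
  have hmonic : ∀ r : R, (minpoly A r).Monic := fun r => minpoly.monic (Algebra.IsIntegral.isIntegral r)
  -- the bad locus downstairs
  obtain ⟨a, ha0, b, hab⟩ : ∃ a : A, a ≠ 0 ∧ (Ideal.Quotient.mk P h) ∣ algebraMap A R a := by
    have hh : Ideal.Quotient.mk P h ≠ 0 := by rwa [ne_eq, Ideal.Quotient.eq_zero_iff_mem]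
    exact (Algebra.IsIntegral.isIntegral (R := A) (Ideal.Quotient.mk P h)).isAlgebraic.exists_nonzero_dvd
      (mem_nonZeroDivisors_of_ne_zero hh)
  -- Since `h` divides `a` on the variety, any lift of a point with `a ≠ 0` satisfies `h ≠ 0`.
  obtain ⟨y, hy, hylim⟩ := mem_closure_iff_seq_limit.1 (dense_setOf_eval_ne_zero ha0 (π z))
  -- a bound for the coordinates
  let bound : σ → (Fin s → ℂ) → ℝ := fun i y =>
    ∑ j ∈ Finset.range (minpoly A (Ideal.Quotient.mk P (X i))).natDegree,
      ‖aeval y ((minpoly A (Ideal.Quotient.mk P (X i) : R)).coeff j)‖ + 1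
  have hbc : ∀ i, Continuous (bound i) := fun i =>
    (continuous_finsetSum _ fun j _ => (continuous_aeval' _).norm).add continuous_const
  have hb : ∀ i x, x ∈ zeroLocus ℂ P → ‖x i‖ ≤ bound i (π x) := by
    intro i x hx
    have h1 := Polynomial.norm_root_le ((hmonic _).map _) (hroot x hx (Ideal.Quotient.mk P (X i)))
    rw [hψ, aeval_X, (hmonic _).natDegree_map] at h1
    refine h1.trans_eq ?_
    simp only [bound, Polynomial.coeff_map]
    rfl
  -- a function separating `z` from the other points of its fiber
  have hfiber : {x | x ∈ zeroLocus ℂ P ∧ π x = π z}.Finite := by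
    refine (Set.Finite.pi' (t := fun i => {t : ℂ | ((minpoly A (Ideal.Quotient.mk P (X i) : R)).map
      (aeval (π z) : A →ₐ[ℂ] ℂ).toRingHom).eval t = 0}) fun i => ?_).subset ?_
    · refine (Finset.finite_toSet (Polynomial.roots ((minpoly A (Ideal.Quotient.mk P (X i) : R)).map
        (aeval (π z) : A →ₐ[ℂ] ℂ).toRingHom)).toFinset).subset fun t ht => ?_
      simpa [((hmonic _).map _).ne_zero] using ht
    · rintro x ⟨hx, hxz⟩ i
      have h1 := hroot x hx (Ideal.Quotient.mk P (X i))
      rw [hψ, aeval_X, hxz] at h1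
      exact h1
  obtain ⟨Θ, hΘ⟩ : ∃ Θ : MvPolynomial σ ℂ, ∀ x ∈ zeroLocus ℂ P, π x = π z →
      aeval x Θ = aeval z Θ → x = z := by
    have := (hfiber.subset (Set.sdiff_subset (t := {z}))).to_subtype
    -- A linear form that is nonzero on the finitely many differences `x - z` within the fiber.
    obtain ⟨f, hf⟩ := Module.exists_dual_forall_apply_ne_zero (K := ℂ)
      (fun x : ↥({x | x ∈ zeroLocus ℂ P ∧ π x = π z} \ {z}) => x.1 - z)
      (fun x => sub_ne_zero.2 x.2.2)
    classical
    refine ⟨∑ i, C (f (Pi.single i 1)) * X i, fun x hx hxz heq => ?_⟩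
    have hev : ∀ x : σ → ℂ, aeval x (∑ i, C (f (Pi.single i 1)) * X i) = f x := by
      intro x
      rw [LinearMap.pi_apply_eq_sum_univ f x]
      simp only [map_sum, map_mul, aeval_X, smul_eq_mul, algHom_C, Algebra.algebraMap_self,
        RingHom.id_apply]
      refine Finset.sum_congr rfl fun i _ => ?_
      rw [mul_comm]
      congr 2
      funext j
      simp [Pi.single_apply, eq_comm]
    rw [hev, hev] at heq
    by_contra hne
    exact hf ⟨x, ⟨hx, hxz⟩, hne⟩ (by rw [map_sub, heq, sub_self])
  -- lifting
  set θ : R := Ideal.Quotient.mk P Θ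
  set q := minpoly A θ
  have hd : q.natDegree ≠ 0 := (minpoly.natDegree_pos (Algebra.IsIntegral.isIntegral θ)).ne'
  -- The minimal polynomial of `θ`, specialized at `π z`, vanishes at `Θ(z)`. Specialized at `y k`
  -- it is small there, so it has a nearby root, and lying over realizes this root as the value of
  -- `Θ` at a point above `y k`.
  have hlift : ∀ k, ∃ x ∈ zeroLocus ℂ P, π x = y k ∧
      ‖aeval z Θ - aeval x Θ‖ ^ q.natDegree ≤
        ‖(q.map (aeval (y k) : A →ₐ[ℂ] ℂ).toRingHom).eval (aeval z Θ)‖ := by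
    intro k
    obtain ⟨t, ht, htn⟩ := Polynomial.exists_root_norm_sub_pow_le
      ((hmonic θ).map (aeval (y k) : A →ₐ[ℂ] ℂ).toRingHom)
      (by rw [(hmonic θ).natDegree_map]; exact hd) (aeval z Θ)
    rw [(hmonic θ).natDegree_map] at htn
    obtain ⟨Q, hQ, hQ1, hQ2⟩ := exists_maximal_of_root θ (aeval (y k) : A →ₐ[ℂ] ℂ).toRingHom t ht
    have hQ' : (Q.comap (Ideal.Quotient.mk P)).IsMaximal :=
      Ideal.comap_isMaximal_of_surjective _ Ideal.Quotient.mk_surjective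
    obtain ⟨x, hx⟩ := eq_vanishingIdeal_singleton_of_isMaximal ℂ hQ'
    have hmem : ∀ F, Ideal.Quotient.mk P F ∈ Q → aeval x F = 0 := by
      intro F hF
      have : F ∈ Q.comap (Ideal.Quotient.mk P) := hF
      rw [hx, mem_vanishingIdeal_singleton_iff] at this
      exact this
    have hxP : x ∈ zeroLocus ℂ P := fun F hF => hmem F (by
      rw [Ideal.Quotient.eq_zero_iff_mem.2 hF]; exact Q.zero_mem)
    have hxt : aeval x Θ = t := by
      have h1 := hmem (Θ - C t) (by
        have := hQ2 (C t) (by simp)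
        rw [hgA, show g (C t) = Ideal.Quotient.mk P (C t) from g.commutes t] at this
        rwa [map_sub])
      rw [map_sub, sub_eq_zero] at h1
      simpa using h1
    refine ⟨x, hxP, ?_, by rw [hxt]; exact htn⟩
    funext j
    have h1 := hmem (G j - C (y k j)) (by
      have := hQ1 (X j - C (y k j)) (by simp)
      rwa [hgA, map_sub, show g (C (y k j)) = Ideal.Quotient.mk P (C (y k j)) from g.commutes _,
        ← hG, ← map_sub] at this)
    rw [map_sub, sub_eq_zero] at h1
    simpa [π] using h1
  choose x hxP hxy hxΘ using hlift
  -- convergence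
  have hqcont : Continuous fun y : Fin s → ℂ =>
      (q.map (aeval y : A →ₐ[ℂ] ℂ).toRingHom).eval (aeval z Θ) := by
    have : (fun y : Fin s → ℂ => (q.map (aeval y : A →ₐ[ℂ] ℂ).toRingHom).eval (aeval z Θ)) =
        fun y => ∑ i ∈ Finset.range (q.natDegree + 1), aeval y (q.coeff i) * (aeval z Θ) ^ i := by
      funext y
      rw [Polynomial.eval_eq_sum_range, (hmonic θ).natDegree_map]
      simp only [Polynomial.coeff_map]
      rfl
    rw [this]
    exact continuous_finsetSum _ fun i _ => (continuous_aeval' _).mul continuous_const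
  have hΘlim : Tendsto (fun k => aeval (x k) Θ) atTop (𝓝 (aeval z Θ)) := by
    have h0 : Tendsto (fun k => ‖(q.map (aeval (y k) : A →ₐ[ℂ] ℂ).toRingHom).eval (aeval z Θ)‖)
        atTop (𝓝 0) := by
      have h1 := ((hqcont.tendsto (π z)).comp hylim).norm
      have h2 : (q.map (aeval (π z) : A →ₐ[ℂ] ℂ).toRingHom).eval (aeval z Θ) = 0 := hroot z hz θ
      rw [h2, norm_zero] at h1
      exact h1
    have h1 : Tendsto (fun k => ‖aeval z Θ - aeval (x k) Θ‖ ^ q.natDegree) atTop (𝓝 0) :=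
      squeeze_zero (fun k => by positivity) hxΘ h0
    have h2 : Tendsto (fun k => ‖aeval z Θ - aeval (x k) Θ‖) atTop (𝓝 0) := by
      have h3 := h1.rpow_const (p := ((q.natDegree : ℝ)⁻¹)) (Or.inr (by positivity))
      rw [Real.zero_rpow (by positivity)] at h3
      refine h3.congr fun k => ?_
      exact Real.pow_rpow_inv_natCast (norm_nonneg _) hd
    rw [tendsto_iff_norm_sub_tendsto_zero]
    refine h2.congr fun k => norm_sub_rev _ _
  obtain ⟨M, hM⟩ : ∃ M : ℝ, ∀ᶠ k in atTop, ∀ i, ‖x k i‖ ≤ M := by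
    refine ⟨∑ i, (bound i (π z) + 1), ?_⟩
    have h1 : ∀ i, ∀ᶠ k in atTop, bound i (y k) < bound i (π z) + 1 := fun i =>
      ((hbc i).tendsto (π z)).comp hylim |>.eventually_lt_const (lt_add_one _)
    filter_upwards [eventually_all.2 h1] with k hk i
    have h2 := hb i (x k) (hxP k)
    rw [hxy] at h2
    refine (h2.trans (hk i).le).trans ?_
    refine Finset.single_le_sum (f := fun i => bound i (π z) + 1) (fun j _ => ?_) (Finset.mem_univ i)
    simp only [bound]
    positivity
  -- The lifts are bounded, so a subsequence converges. The limit lies over `π z` and has the same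
  -- `Θ` as `z`, hence equals `z`.
  obtain ⟨w, -, φ, hφ, hw⟩ := tendsto_subseq_of_frequently_bounded
    (s := {x : σ → ℂ | ∀ i, ‖x i‖ ≤ M}) (x := x) (by
      rw [Metric.isBounded_iff_subset_closedBall 0]
      refine ⟨max M 0, fun v hv => ?_⟩
      rw [mem_closedBall_zero_iff, pi_norm_le_iff_of_nonneg (le_max_right _ _)]
      exact fun i => (hv i).trans (le_max_left _ _)) hM.frequently
  have hφt := hφ.tendsto_atTop
  have hwP : w ∈ zeroLocus ℂ P := by
    intro F hF
    have h1 := ((continuous_aeval' F).tendsto w).comp hw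
    refine tendsto_nhds_unique h1 (tendsto_const_nhds.congr fun k => ?_)
    exact (hxP (φ k) F hF).symm
  have hwz : w = z := by
    refine hΘ w hwP ?_ ?_
    · have h1 := (hπ.tendsto w).comp hw
      refine tendsto_nhds_unique h1 ((hylim.comp hφt).congr fun k => ?_)
      exact (hxy (φ k)).symm
    · exact tendsto_nhds_unique (((continuous_aeval' Θ).tendsto w).comp hw) (hΘlim.comp hφt)
  rw [hwz] at hw
  refine mem_closure_of_tendsto hw (Eventually.of_forall fun k => ⟨hxP _, fun h0 => ?_⟩)
  change aeval (x (φ k)) h = 0 at h0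
  have h1 := congrArg (ψ (x (φ k)) (hxP _)) hab
  rw [hψg, map_mul, hψ, h0, zero_mul, hxy] at h1
  exact hy (φ k) h1
end

noncomputable section

/-! ## Collinearity and genericity in coordinates -/

section Area
variable {V R : Type*} [CommRing R]

/-- Twice the signed area of the triangle with vertices labelled `u`, `v`, `w`. -/
def area (x : V × Fin 2 → R) (u v w : V) : R :=
  (x (v, 0) - x (u, 0)) * (x (w, 1) - x (u, 1)) - (x (v, 1) - x (u, 1)) * (x (w, 0) - x (u, 0))

theorem map_area {S F : Type*} [CommRing S] [FunLike F R S] [RingHomClass F R S] (f : F)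
    (x : V × Fin 2 → R) (u v w : V) : f (area x u v w) = area (fun j => f (x j)) u v w := by
  simp [area]

theorem collinear_image_iff (x : V × Fin 2 → ℂ) (s : Set V) :
    Collinear ℂ (Function.curry x '' s) ↔ ∀ u ∈ s, ∀ v ∈ s, ∀ w ∈ s, area x u v w = 0 := by
  rw [collinear_iff_exists_forall_eq_smul_vadd]
  constructor
  · rintro ⟨a, d, h⟩ u hu v hv w hw
    have key : ∀ u ∈ s, ∃ r : ℂ, ∀ i, x (u, i) = r * d i + a i := fun u hu => by
      obtain ⟨r, hr⟩ := h _ ⟨u, hu, rfl⟩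
      exact ⟨r, fun i => congrFun hr i⟩
    obtain ⟨ru, hu⟩ := key u hu
    obtain ⟨rv, hv⟩ := key v hv
    obtain ⟨rw, hw⟩ := key w hw
    rw [area, hu, hu, hv, hv, hw, hw]
    ring
  · intro h
    by_cases hs : ∃ u ∈ s, ∃ v ∈ s, Function.curry x u ≠ Function.curry x v
    · obtain ⟨u, hu, v, hv, hne⟩ := hs
      refine ⟨Function.curry x u, Function.curry x v - Function.curry x u, ?_⟩
      rintro _ ⟨w, hw, rfl⟩
      have ha := h u hu v hv w hw
      rw [area] at ha
      obtain ⟨i, hi⟩ := Function.ne_iff.1 hne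
      fin_cases i
      · have hi : x (v, 0) - x (u, 0) ≠ 0 := sub_ne_zero.2 (Ne.symm hi)
        refine ⟨(x (w, 0) - x (u, 0)) / (x (v, 0) - x (u, 0)), funext fun j => ?_⟩
        fin_cases j
        · change x (w, 0) = (x (w, 0) - x (u, 0)) / (x (v, 0) - x (u, 0)) *
            (x (v, 0) - x (u, 0)) + x (u, 0)
          field_simp
          ring
        · change x (w, 1) = (x (w, 0) - x (u, 0)) / (x (v, 0) - x (u, 0)) *
            (x (v, 1) - x (u, 1)) + x (u, 1)
          field_simp
          linear_combination ha
      · have hi : x (v, 1) - x (u, 1) ≠ 0 := sub_ne_zero.2 (Ne.symm hi)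
        refine ⟨(x (w, 1) - x (u, 1)) / (x (v, 1) - x (u, 1)), funext fun j => ?_⟩
        fin_cases j
        · change x (w, 0) = (x (w, 1) - x (u, 1)) / (x (v, 1) - x (u, 1)) *
            (x (v, 0) - x (u, 0)) + x (u, 0)
          field_simp
          linear_combination -ha
        · change x (w, 1) = (x (w, 1) - x (u, 1)) / (x (v, 1) - x (u, 1)) *
            (x (v, 1) - x (u, 1)) + x (u, 1)
          field_simp
          ring
    · push Not at hs
      obtain rfl | ⟨u, hu⟩ := s.eq_empty_or_nonempty
      · exact ⟨0, 0, by simp⟩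
      · refine ⟨Function.curry x u, 0, ?_⟩
        rintro _ ⟨w, hw, rfl⟩
        exact ⟨0, by simpa using (hs u hu w hw).symm⟩

theorem collinear_triple_iff (x : V × Fin 2 → ℂ) (u v w : V) :
    Collinear ℂ {Function.curry x u, Function.curry x v, Function.curry x w} ↔
      area x u v w = 0 := by
  have h := collinear_image_iff x {u, v, w}
  rw [Set.image_insert_eq, Set.image_pair] at h
  rw [h]
  constructor
  · intro h
    exact h u (by simp) v (by simp) w (by simp)
  · intro h a ha b hb c hc
    simp only [area] at h ⊢
    rcases ha with rfl | rfl | rfl <;> rcases hb with rfl | rfl | rfl <;>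
      rcases hc with rfl | rfl | rfl <;>
      first | ring1 | linear_combination h | linear_combination -h

end Area

/-- This turns the distinctness of two lines into the nonvanishing of some area, which is a
polynomial condition. -/
theorem affineSpan_ne_iff_not_collinear_union {E : Type*} [AddCommGroup E] [Module ℂ E] {s t : Set E}
    (hs : Collinear ℂ s) (ht : Collinear ℂ t) (hs' : s.Nontrivial) (ht' : t.Nontrivial) :
    affineSpan ℂ s ≠ affineSpan ℂ t ↔ ¬ Collinear ℂ (s ∪ t) := by
  rw [not_iff_not]
  constructor
  · intro h
    have : affineSpan ℂ (s ∪ t) = affineSpan ℂ s := by rw [AffineSubspace.span_union, ← h, sup_idem]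
    rw [Collinear, ← direction_affineSpan, this, direction_affineSpan]
    exact hs
  · intro h
    obtain ⟨a, ha, b, hb, hab⟩ := hs'
    obtain ⟨c, hc, d, hd, hcd⟩ := ht'
    rw [← hs.affineSpan_eq_of_ne ha hb hab, ← ht.affineSpan_eq_of_ne hc hd hcd,
      h.affineSpan_eq_of_ne (Or.inl ha) (Or.inl hb) hab,
      h.affineSpan_eq_of_ne (Or.inr hc) (Or.inr hd) hcd]

theorem isNondegenerate_quad_iff (a b c d : Plane) : IsNondegenerate (quad a b c d) ↔
    ¬ Collinear ℂ {a, b, c} ∧ ¬ Collinear ℂ {b, c, d} ∧ ¬ Collinear ℂ {c, d, a} ∧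
      ¬ Collinear ℂ {d, a, b} := by
  constructor
  · intro h
    refine ⟨h a b c [d] rfl, h b c d [a] ?_, h c d a [b] ?_, h d a b [c] ?_⟩
    · exact GeneralizedDissection.quad_rotate _ _ _ _
    · exact (GeneralizedDissection.quad_rotate _ _ _ _).trans
        (GeneralizedDissection.quad_rotate _ _ _ _)
    · exact (GeneralizedDissection.quad_rotate d a b c).symm
  · rintro ⟨h1, h2, h3, h4⟩ x y z l h
    obtain ⟨n, hn, h⟩ := List.isRotated_iff_mod.1 (Cycle.coe_eq_coe.1 h)
    simp only [List.length_cons, List.length_nil] at hn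
    interval_cases n <;> simp [List.rotate] at h <;> obtain ⟨rfl, rfl, rfl, -⟩ := h <;> assumption

namespace GeneralizedDissection

theorem exists_ne_mem_constraint {bdry : Cycle Plane} (D : GeneralizedDissection bdry)
    {C : Cycle Plane} (hC : C ∈ D.constraints) :
    {v : D.Vertex | v.1 ∈ C}.Nontrivial := by
  obtain ⟨h1, h2⟩ := (D.constraints_spec C hC).1
  have hv := D.constraints_vertices C hC
  have : C.Nontrivial := by
    induction C using Quotient.inductionOn with | _ l
    exact (Cycle.nontrivial_coe_nodup_iff h1).2 (le_trans (by norm_num) h2)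
  obtain ⟨a, b, hab, ha, hb⟩ := this
  exact ⟨⟨a, hv a ha⟩, ha, ⟨b, hv b hb⟩, hb, fun h => hab (congrArg Subtype.val h)⟩

variable {p q r s : Plane} (D : GeneralizedDissection (quad p q r s))

theorem isDrawing_curry_iff (x : D.Vertex × Fin 2 → ℂ) : D.IsDrawing (Function.curry x) ↔
    (∀ C ∈ D.constraints, ∀ u : D.Vertex, u.1 ∈ C → ∀ v : D.Vertex, v.1 ∈ C →
      ∀ w : D.Vertex, w.1 ∈ C → area x u v w = 0) ∧
    ∀ i, x (D.corner 0, i) + x (D.corner 2, i) = x (D.corner 1, i) + x (D.corner 3, i) := by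
  constructor
  · intro h
    exact ⟨fun C hC => (collinear_image_iff x _).1 (h.constraint_collinear C hC),
      fun i => congrFun h.parallelogram i⟩
  · intro h
    exact ⟨fun C hC => (collinear_image_iff x _).2 (h.1 C hC), funext h.2⟩

theorem isGenericDrawing_curry_iff (x : D.Vertex × Fin 2 → ℂ) :
    D.IsGenericDrawing (Function.curry x) ↔ D.IsDrawing (Function.curry x) ∧
      (∀ i, area x (D.corner i) (D.corner (i + 1)) (D.corner (i + 1 + 1)) ≠ 0) ∧
      (∀ u v w : D.Vertex, (([u.1, v.1, w.1] : List Plane) : Cycle Plane) ∈ D.triangles →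
        area x u v w ≠ 0) ∧
      (∀ u v : D.Vertex, u ≠ v → ∃ i, x (u, i) ≠ x (v, i)) ∧
      ∀ C ∈ D.constraints, ∀ C' ∈ D.constraints, C ≠ C' → (∃ v, v ∈ C ∧ v ∈ C') →
        ∃ u v w : D.Vertex, (u.1 ∈ C ∨ u.1 ∈ C') ∧ (v.1 ∈ C ∨ v.1 ∈ C') ∧ (w.1 ∈ C ∨ w.1 ∈ C') ∧
          area x u v w ≠ 0 := by
  have hb : IsNondegenerate (quad (Function.curry x D.cornerP) (Function.curry x D.cornerQ)
      (Function.curry x D.cornerR) (Function.curry x D.cornerS)) ↔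
      ∀ i, area x (D.corner i) (D.corner (i + 1)) (D.corner (i + 1 + 1)) ≠ 0 := by
    rw [isNondegenerate_quad_iff, Fin.forall_fin_succ, Fin.forall_fin_succ, Fin.forall_fin_succ,
      Fin.forall_fin_one]
    simp only [collinear_triple_iff]
    rfl
  have hl : D.IsDrawing (Function.curry x) → Function.Injective (Function.curry x) →
      ∀ C ∈ D.constraints, ∀ C' ∈ D.constraints,
      (affineSpan ℂ (D.constraintImage (Function.curry x) C) ≠
        affineSpan ℂ (D.constraintImage (Function.curry x) C') ↔
      ∃ u v w : D.Vertex, (u.1 ∈ C ∨ u.1 ∈ C') ∧ (v.1 ∈ C ∨ v.1 ∈ C') ∧ (w.1 ∈ C ∨ w.1 ∈ C') ∧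
          area x u v w ≠ 0) := by
    intro hd hi C hC C' hC'
    rw [affineSpan_ne_iff_not_collinear_union (hd.constraint_collinear C hC)
      (hd.constraint_collinear C' hC') ((D.exists_ne_mem_constraint hC).image hi)
      ((D.exists_ne_mem_constraint hC').image hi), constraintImage, constraintImage,
      ← Set.image_union, collinear_image_iff]
    push Not
    constructor
    · rintro ⟨u, hu, v, hv, w, hw, h⟩; exact ⟨u, v, w, hu, hv, hw, h⟩
    · rintro ⟨u, v, w, hu, hv, hw, h⟩; exact ⟨u, hu, v, hv, w, hw, h⟩
  have hinj : Function.Injective (Function.curry x) ↔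
      ∀ u v : D.Vertex, u ≠ v → ∃ i, x (u, i) ≠ x (v, i) := by
    constructor
    · intro h u v huv
      exact Function.ne_iff.1 (h.ne huv)
    · intro h u v huv
      by_contra hne
      obtain ⟨i, hi⟩ := h u v hne
      exact hi (congrFun huv i)
  constructor
  · intro h
    exact ⟨h.toIsDrawing, hb.1 h.boundary_nondegenerate,
      fun u v w ht => (collinear_triple_iff x u v w).not.1 (h.living_nondegenerate u v w ht),
      hinj.1 h.injective, fun C hC C' hC' hne hv =>
        (hl h.toIsDrawing h.injective C hC C' hC').1 (h.lines_ne C hC C' hC' hne hv)⟩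
  · rintro ⟨h1, h2, h3, h4, h5⟩
    exact ⟨h1, hb.2 h2, fun u v w ht => (collinear_triple_iff x u v w).not.2 (h3 u v w ht),
      hinj.2 h4, fun C hC C' hC' hne hv =>
        (hl h1 (hinj.2 h4) C hC C' hC').2 (h5 C hC C' hC' hne hv)⟩

/-- Being generic is implied by the non-vanishing of a suitable polynomial. -/
theorem exists_aeval_ne_zero_imp_isGenericDrawing {x₀ : D.Vertex × Fin 2 → ℂ}
    (h₀ : D.IsGenericDrawing (Function.curry x₀)) :
    ∃ h : MvPolynomial (D.Vertex × Fin 2) ℂ, MvPolynomial.aeval x₀ h ≠ 0 ∧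
      ∀ x ∈ D.drawingSpace, MvPolynomial.aeval x h ≠ 0 → D.IsGenericDrawing (Function.curry x) := by
  have hall : ∀ {ι : Type} [Finite ι] (P : ι → (D.Vertex × Fin 2 → ℂ) → Prop),
      (∀ i, ∃ h : MvPolynomial (D.Vertex × Fin 2) ℂ, MvPolynomial.aeval x₀ h ≠ 0 ∧
        ∀ x, MvPolynomial.aeval x h ≠ 0 → P i x) →
      ∃ h : MvPolynomial (D.Vertex × Fin 2) ℂ, MvPolynomial.aeval x₀ h ≠ 0 ∧
        ∀ x, MvPolynomial.aeval x h ≠ 0 → ∀ i, P i x := by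
    intro ι _ P hP
    cases nonempty_fintype ι
    choose h hh hP using hP
    refine ⟨∏ i, h i, ?_, fun x hx i => hP i x ?_⟩
    · rw [map_prod]; exact Finset.prod_ne_zero_iff.2 fun i _ => hh i
    · rw [map_prod] at hx; exact Finset.prod_ne_zero_iff.1 hx i (Finset.mem_univ i)
  have himp : ∀ (Q : Prop) (P : (D.Vertex × Fin 2 → ℂ) → Prop),
      (Q → ∃ h : MvPolynomial (D.Vertex × Fin 2) ℂ, MvPolynomial.aeval x₀ h ≠ 0 ∧
        ∀ x, MvPolynomial.aeval x h ≠ 0 → P x) →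
      ∃ h : MvPolynomial (D.Vertex × Fin 2) ℂ, MvPolynomial.aeval x₀ h ≠ 0 ∧
        ∀ x, MvPolynomial.aeval x h ≠ 0 → Q → P x := by
    intro Q P h
    by_cases hQ : Q
    · obtain ⟨f, hf, hP⟩ := h hQ
      exact ⟨f, hf, fun x hx _ => hP x hx⟩
    · exact ⟨1, by simp, fun _ _ h => absurd h hQ⟩
  have harea : ∀ u v w : D.Vertex, area x₀ u v w ≠ 0 →
      ∃ h : MvPolynomial (D.Vertex × Fin 2) ℂ, MvPolynomial.aeval x₀ h ≠ 0 ∧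
        ∀ x : D.Vertex × Fin 2 → ℂ, MvPolynomial.aeval x h ≠ 0 → area x u v w ≠ 0 := fun u v w h =>
    ⟨area MvPolynomial.X u v w, by simpa [map_area] using h, fun x hx => by
      simpa [map_area] using hx⟩
  -- Each condition holds at `x₀` through some nonzero area or coordinate difference. The product of
  -- these witnesses is a sufficient, not a necessary, test for genericity.
  obtain ⟨-, h1, h2, h3, h4⟩ := (D.isGenericDrawing_curry_iff x₀).1 h₀
  obtain ⟨f1, hf1, H1⟩ := hall (fun i x => area x (D.corner i) (D.corner (i + 1))
    (D.corner (i + 1 + 1)) ≠ 0) fun i => harea _ _ _ (h1 i)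
  obtain ⟨f2, hf2, H2⟩ := hall (fun (t : D.Vertex × D.Vertex × D.Vertex) x =>
    (([t.1.1, t.2.1.1, t.2.2.1] : List Plane) : Cycle Plane) ∈ D.triangles →
      area x t.1 t.2.1 t.2.2 ≠ 0) fun t => himp _ _ fun ht => harea _ _ _ (h2 _ _ _ ht)
  obtain ⟨f3, hf3, H3⟩ := hall (fun (t : D.Vertex × D.Vertex) x =>
    t.1 ≠ t.2 → ∃ i, x (t.1, i) ≠ x (t.2, i)) fun t => himp _ _ fun ht => by
      obtain ⟨i, hi⟩ := h3 _ _ ht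
      exact ⟨MvPolynomial.X (t.1, i) - MvPolynomial.X (t.2, i), by simpa [sub_eq_zero] using hi,
        fun x hx => ⟨i, by simpa [sub_eq_zero] using hx⟩⟩
  obtain ⟨f4, hf4, H4⟩ := hall (fun (t : D.constraints × D.constraints) x =>
    t.1.1 ≠ t.2.1 → (∃ v, v ∈ t.1.1 ∧ v ∈ t.2.1) → ∃ u v w : D.Vertex,
      (u.1 ∈ t.1.1 ∨ u.1 ∈ t.2.1) ∧ (v.1 ∈ t.1.1 ∨ v.1 ∈ t.2.1) ∧ (w.1 ∈ t.1.1 ∨ w.1 ∈ t.2.1) ∧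
          area x u v w ≠ 0) fun t => himp _ _ fun ht => himp _ _ fun hv => by
      obtain ⟨u, v, w, hu, hv, hw, ha⟩ := h4 _ t.1.2 _ t.2.2 ht hv
      obtain ⟨f, hf, hP⟩ := harea u v w ha
      exact ⟨f, hf, fun x hx => ⟨u, v, w, hu, hv, hw, hP x hx⟩⟩
  refine ⟨f1 * f2 * f3 * f4, by
    simp only [map_mul]
    exact mul_ne_zero (mul_ne_zero (mul_ne_zero hf1 hf2) hf3) hf4, fun x hx hf => ?_⟩
  simp only [map_mul, mul_ne_zero_iff] at hf
  obtain ⟨⟨⟨g1, g2⟩, g3⟩, g4⟩ := hf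
  exact (D.isGenericDrawing_curry_iff x).2 ⟨hx, H1 x g1, fun u v w => H2 x g2 (u, v, w),
    fun u v => H3 x g3 (u, v), fun C hC C' hC' => H4 x g4 (⟨C, hC⟩, ⟨C', hC'⟩)⟩

/-- A shear has determinant 1. -/
theorem area_shear (x : D.Vertex × Fin 2 → ℂ) (ε : ℂ) (u v w : D.Vertex) :
    area (fun j => if j.2 = 0 then x (j.1, 0) + ε * x (j.1, 1) else x j) u v w = area x u v w := by
  simp [area]
  ring

theorem IsGenericDrawing.shear {D : GeneralizedDissection (quad p q r s)}
    {x : D.Vertex × Fin 2 → ℂ} (h : D.IsGenericDrawing (Function.curry x)) (ε : ℂ) :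
    D.IsGenericDrawing (Function.curry fun j : D.Vertex × Fin 2 =>
      if j.2 = 0 then x (j.1, 0) + ε * x (j.1, 1) else x j) := by
  rw [isGenericDrawing_curry_iff, isDrawing_curry_iff] at h ⊢
  simp only [area_shear]
  obtain ⟨⟨h1, h2⟩, h3, h4, h5, h6⟩ := h
  refine ⟨⟨h1, ?_⟩, h3, h4, ?_, h6⟩
  · intro i
    fin_cases i
    · simp only [Fin.zero_eta, if_true]
      linear_combination h2 0 + ε * h2 1
    · simpa using h2 1
  · intro u v huv
    by_contra! hc
    have e0 := hc 0
    have e1 := hc 1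
    simp only [if_true, one_ne_zero, if_false] at e0 e1
    obtain ⟨i, hi⟩ := h5 u v huv
    fin_cases i
    · exact hi (show x (u, 0) = x (v, 0) by linear_combination e0 - ε * e1)
    · exact hi e1

/-- Generic drawings are limits of generic drawings whose vertices have different first
coordinates. -/
theorem IsGenericDrawing.mem_closure {D : GeneralizedDissection (quad p q r s)}
    {x : D.Vertex × Fin 2 → ℂ} (h : D.IsGenericDrawing (Function.curry x)) :
    x ∈ closure {y : D.Vertex × Fin 2 → ℂ | D.IsGenericDrawing (Function.curry y) ∧
      ∀ u v : D.Vertex, u ≠ v → y (u, 0) ≠ y (v, 0)} := by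
  let f : ℂ → D.Vertex × Fin 2 → ℂ := fun ε j =>
    if j.2 = 0 then x (j.1, 0) + ε * x (j.1, 1) else x j
  have hf : Continuous f := by
    refine continuous_pi fun j => ?_
    by_cases hj : j.2 = 0
    · simp only [f, hj, if_true]; fun_prop
    · simp only [f, hj, if_false]; fun_prop
  have hf0 : f 0 = x := by
    ext ⟨v, i⟩
    fin_cases i <;> simp [f]
  -- For two distinct vertices at most one `ε` is bad: two bad values would make both coordinates of
  -- the vertices agree, against injectivity.
  have hbad : (⋃ t : D.Vertex × D.Vertex,
      {ε : ℂ | t.1 ≠ t.2 ∧ f ε (t.1, 0) = f ε (t.2, 0)}).Finite := by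
    refine Set.finite_iUnion fun t => Set.Subsingleton.finite ?_
    rintro ε ⟨hne, hε⟩ δ ⟨-, hδ⟩
    simp only [f, if_true] at hε hδ
    by_contra hεδ
    have h1 : x (t.1, 1) = x (t.2, 1) := by
      have : (ε - δ) * (x (t.1, 1) - x (t.2, 1)) = 0 := by linear_combination hε - hδ
      exact sub_eq_zero.1 ((mul_eq_zero.1 this).resolve_left (sub_ne_zero.2 hεδ))
    obtain ⟨i, hi⟩ := ((D.isGenericDrawing_curry_iff x).1 h).2.2.2.1 _ _ hne
    fin_cases i
    · exact hi (show x (t.1, 0) = x (t.2, 0) by linear_combination hε - ε * h1)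
    · exact hi h1
  have hd := hbad.countable.dense_compl ℂ (E := ℂ)
  have := map_mem_closure hf (hd 0) (t := {y : D.Vertex × Fin 2 → ℂ |
    D.IsGenericDrawing (Function.curry y) ∧ ∀ u v : D.Vertex, u ≠ v → y (u, 0) ≠ y (v, 0)}) ?_
  · rwa [hf0] at this
  · intro ε hε
    refine ⟨h.shear ε, fun u v huv he => hε (Set.mem_iUnion.2 ⟨(u, v), huv, he⟩)⟩

end GeneralizedDissection
end

/-! ### Incidences of vertices and constraints -/

noncomputable section

namespace GeneralizedDissection

open scoped Classical Finset

/-- The elements of the configuration of a dissection: its vertices and its constraints. -/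
abbrev Element {bdry : Cycle Plane} (D : GeneralizedDissection bdry) : Type :=
  D.Vertex ⊕ {C // C ∈ D.constraints}

/-- The bipartite graph of incidences between vertices and constraints. -/
def incidenceGraph {bdry : Cycle Plane} (D : GeneralizedDissection bdry) :
    SimpleGraph D.Element where
  Adj e f := (∃ v C, e = .inl v ∧ f = .inr C ∧ v.1 ∈ C.1) ∨ ∃ v C, e = .inr C ∧ f = .inl v ∧ v.1 ∈ C.1
  symm := ⟨by
    rintro e f (⟨v, C, rfl, rfl, h⟩ | ⟨v, C, rfl, rfl, h⟩)
    exacts [Or.inr ⟨v, C, rfl, rfl, h⟩, Or.inl ⟨v, C, rfl, rfl, h⟩]⟩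
  loopless := ⟨by rintro e (⟨v, C, rfl, h, -⟩ | ⟨v, C, rfl, h, -⟩) <;> cases h⟩

section Incidence
variable {bdry : Cycle Plane} (D : GeneralizedDissection bdry)

theorem incidenceGraph_adj_inl_inl (v w : D.Vertex) :
    ¬ D.incidenceGraph.Adj (.inl v) (.inl w) := by
  simp [incidenceGraph]

theorem incidenceGraph_adj_inr_inr (C C' : {C // C ∈ D.constraints}) :
    ¬ D.incidenceGraph.Adj (.inr C) (.inr C') := by
  simp [incidenceGraph]

theorem incidenceGraph_adj_inl_inr (v : D.Vertex) (C : {C // C ∈ D.constraints}) :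
    D.incidenceGraph.Adj (.inl v) (.inr C) ↔ v.1 ∈ C.1 := by
  simp [incidenceGraph]

theorem incidenceGraph_adj_inr_inl (v : D.Vertex) (C : {C // C ∈ D.constraints}) :
    D.incidenceGraph.Adj (.inr C) (.inl v) ↔ v.1 ∈ C.1 := by
  rw [SimpleGraph.adj_comm, incidenceGraph_adj_inl_inr]

instance : Fintype D.Element := Fintype.ofFinite _

end Incidence

theorem mem_image_univ {ι W : Type*} [Fintype ι] (k : ι → W) (f : W) :
    f ∈ Finset.univ.image k ↔ ∃ i, k i = f := by
  simp

variable {p q r s : Plane} (D : GeneralizedDissection (quad p q r s))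

/-- The corners, as elements of the configuration. -/
def cornerElement (i : Fin 4) : D.Element := .inl (D.corner i)

theorem cornerElement_injective : Function.Injective D.cornerElement :=
  Sum.inl_injective.comp D.corner_injective

variable {D}

/-- If no constraint contains three consecutive corners, then the configuration of vertices and
constraints can be built from the corners step by step, with at most two incidences at a time. -/
theorem constructible_incidenceGraph
    (h3 : ∀ C ∈ D.constraints, ∀ i, (D.corner i).1 ∈ C → (D.corner (i + 1)).1 ∈ C →
      (D.corner (i + 1 + 1)).1 ∉ C) :
    D.incidenceGraph.Constructible D.cornerElement Finset.univ := by
  refine SimpleGraph.constructible_of_forall _ (fun _ => Finset.mem_univ _) ?_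
  intro S' _ hk hne
  -- The set `S'` is translated to the disk: its non-corner vertices, its constraints as cells, and
  -- their incidences as flags. Triangles contribute no incidences and serve only to complete the
  -- disk.
  set S₀ : Finset D.Vertex := {v | Sum.inl v ∈ S' ∧ ∀ i, v ≠ D.corner i} with hS₀
  set T : Finset D.Cell := {c | ∃ h : c.1 ∈ D.constraints, Sum.inr ⟨c.1, h⟩ ∈ S'} with hT
  set I : Finset D.Flag := {x | (x.1.2 ∈ S₀ ∨ ∃ i, x.1.2 = D.corner i) ∧ x.1.1 ∈ T} with hI
  have hmemT : ∀ c : D.Cell, c ∈ T ↔ ∃ h : c.1 ∈ D.constraints, Sum.inr ⟨c.1, h⟩ ∈ S' := fun c => by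
    simp only [hT, Finset.mem_filter, Finset.mem_univ, true_and]
  have hvc : ∀ x : D.Flag, x.1.2.1 ∈ x.1.1.1 := fun x => x.2
  have hmemI : ∀ (v : D.Vertex) (C : {C // C ∈ D.constraints}) (hv : v.1 ∈ C.1),
      Sum.inl v ∈ S' → Sum.inr C ∈ S' → Cell.flag ⟨C.1, Or.inr C.2⟩ v.1 hv ∈ I := by
    intro v C hv hvS hCS
    simp only [hI, Finset.mem_filter, Finset.mem_univ, true_and, hS₀, hT]
    refine ⟨?_, C.2, hCS⟩
    by_cases hc : ∃ i, v = D.corner i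
    · exact Or.inr hc
    · exact Or.inl ⟨hvS, fun i hi => hc ⟨i, hi⟩⟩
  have hIT : ∀ x ∈ I, x.1.1.1 ∈ D.constraints := fun x hx => by
    simp only [hI, hT, Finset.mem_filter, Finset.mem_univ, true_and] at hx
    exact hx.2.1
  have hmain := D.quadDisk.exists_card_le_two (I := I) S₀ T ?_ ?_ ?_ ?_ ?_
  · obtain ⟨v, hv, hc⟩ | ⟨c, hc, hcard⟩ := hmain
    · simp only [hS₀, Finset.mem_filter, Finset.mem_univ, true_and] at hv
      refine ⟨.inl v, hv.1, fun i hi => hv.2 i (Sum.inl_injective hi), le_trans ?_ hc⟩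
      refine Finset.card_le_card_of_forall_subsingleton
        (fun f (x : D.Flag) => ∃ h, f = Sum.inr ⟨x.1.1.1, h⟩) ?_ ?_
      · rintro (w | C) hf
        · exact absurd (Finset.mem_filter.1 hf).2 (D.incidenceGraph_adj_inl_inl v w)
        · obtain ⟨hCS, hadj⟩ := Finset.mem_filter.1 hf
          exact ⟨_, Finset.mem_filter.2 ⟨hmemI v C ((D.incidenceGraph_adj_inl_inr v C).1 hadj) hv.1 hCS,
            rfl⟩, C.2, rfl⟩
      · rintro x - f ⟨-, h, rfl⟩ g ⟨-, h', rfl⟩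
        rfl
    · simp only [hT, Finset.mem_filter, Finset.mem_univ, true_and] at hc
      obtain ⟨hcc, hcS⟩ := hc
      refine ⟨_, hcS, fun _ => Sum.inr_ne_inl, le_trans ?_ hcard⟩
      refine Finset.card_le_card_of_forall_subsingleton
        (fun f (x : D.Flag) => f = Sum.inl x.1.2) ?_ ?_
      · rintro (w | C) hf
        · obtain ⟨hwS, hadj⟩ := Finset.mem_filter.1 hf
          exact ⟨_, Finset.mem_filter.2 ⟨hmemI w ⟨c.1, hcc⟩
            ((D.incidenceGraph_adj_inr_inl w ⟨c.1, hcc⟩).1 hadj) hwS hcS, rfl⟩, rfl⟩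
        · exact absurd (Finset.mem_filter.1 hf).2 (D.incidenceGraph_adj_inr_inr _ C)
      · rintro x - f ⟨-, rfl⟩ g ⟨-, rfl⟩
        rfl
  · by_contra! h
    obtain ⟨h1, h2⟩ := h
    refine hne (Finset.Subset.antisymm ?_ ?_)
    · rintro (v | C) hf
      · refine (mem_image_univ D.cornerElement _).2 ?_
        by_contra! hv
        refine (Finset.eq_empty_iff_forall_notMem.1 h1) v ?_
        simp only [hS₀, Finset.mem_filter, Finset.mem_univ, true_and]
        exact ⟨hf, fun i hi => hv i (congrArg Sum.inl hi.symm)⟩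
      · exact absurd ((hmemT ⟨C.1, Or.inr C.2⟩).2 ⟨C.2, hf⟩)
          ((Finset.eq_empty_iff_forall_notMem.1 h2) _)
    · intro f hf
      obtain ⟨i, rfl⟩ := (mem_image_univ D.cornerElement _).1 hf
      exact hk i
  · intro v hv
    exact (Finset.mem_filter.1 hv).2.2
  · intro x
    simp only [hI, Finset.mem_filter, Finset.mem_univ, true_and]
    rfl
  · intro x hx x' hx' y hy y' hy' h1 h2 h3 h4 h5
    by_contra hne'
    refine h5 (Subtype.ext (D.constraints_inter _ (hIT x hx) _ (hIT x' hx')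
      (fun h => hne' (Subtype.ext h)) _ _ x.2 ?_ ?_ ?_))
    · have := x'.2
      rwa [show x'.1.2 = x.1.2 from h1.symm] at this
    · have := y.2
      rwa [show y.1.1 = x.1.1 from h3.symm] at this
    · have := y'.2
      rwa [show y'.1.1 = x'.1.1 from h4.symm, show y'.1.2 = y.1.2 from h2.symm] at this
  · intro i x hx y hy w hw h1 h2 h3' h4 h5
    refine h3 _ (hIT x hx) i ?_ ?_ ?_
    · have := hvc x
      rwa [show x.1.2 = D.corner i from h1] at this
    · have := hvc y
      rwa [show y.1.2 = D.corner (i + 1) from h2, ← show x.1.1 = y.1.1 from h4] at this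
    · have := hvc w
      rwa [show w.1.2 = D.corner (i + 1 + 1) from h3', ← show x.1.1 = w.1.1 from h4.trans h5]
        at this

/-- Three consecutive corners in a constraint would have collinear images, against nondegeneracy of
the parallelogram. So one generic drawing supplies the hypothesis of `constructible_incidenceGraph`.
-/
theorem IsGenericDrawing.corner_notMem {x : D.Vertex × Fin 2 → ℂ}
    (h : D.IsGenericDrawing (Function.curry x)) : ∀ C ∈ D.constraints, ∀ i, (D.corner i).1 ∈ C →
      (D.corner (i + 1)).1 ∈ C → (D.corner (i + 1 + 1)).1 ∉ C := by
  intro C hC i h1 h2 h3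
  rw [isGenericDrawing_curry_iff, isDrawing_curry_iff] at h
  exact h.2.1 i (h.1.1 C hC _ h1 _ h2 _ h3)

/-- A generic drawing whose vertices have different first coordinates extends to a regular
configuration of points and lines. -/
theorem IsGenericDrawing.exists_isConfig {x : D.Vertex × Fin 2 → ℂ}
    (h : D.IsGenericDrawing (Function.curry x))
    (hx : ∀ u v : D.Vertex, u ≠ v → x (u, 0) ≠ x (v, 0)) :
    ∃ ρ : D.Element × Fin 2 → ℂ, D.incidenceGraph.IsConfig D.cornerElement Finset.univ ρ ∧
      D.incidenceGraph.IsRegularConfig Finset.univ ρ ∧ ∀ v i, ρ (.inl v, i) = x (v, i) := by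
  rw [isGenericDrawing_curry_iff, isDrawing_curry_iff] at h
  obtain ⟨⟨hC, hpar⟩, -, -, -, hl⟩ := h
  have hline : ∀ C : {C // C ∈ D.constraints}, ∃ l : Fin 2 → ℂ, ∀ v : D.Vertex, v.1 ∈ C.1 →
      x (v, 1) + l 1 = x (v, 0) * l 0 := by
    intro C
    obtain ⟨a, ha, b, hb, hab⟩ := D.exists_ne_mem_constraint C.2
    have hab' := sub_ne_zero.2 (hx b a hab.symm)
    -- The slope and the negated intercept of the line through `a` and `b`.
    refine ⟨![(x (b, 1) - x (a, 1)) / (x (b, 0) - x (a, 0)),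
      (x (b, 1) - x (a, 1)) / (x (b, 0) - x (a, 0)) * x (a, 0) - x (a, 1)], fun v hv => ?_⟩
    have := hC C.1 C.2 a ha b hb v hv
    simp only [area] at this
    simp only [Matrix.cons_val_zero, Matrix.cons_val_one]
    field_simp
    linear_combination this
  choose l hl' using hline
  refine ⟨fun j => Sum.elim (fun v => x (v, j.2)) (fun C => l C j.2) j.1, ⟨?_, hpar⟩, ?_,
    fun _ _ => rfl⟩
  · rintro (v | C) - (w | C') - hadj
    · exact absurd hadj (D.incidenceGraph_adj_inl_inl _ _)
    · exact hl' C' v ((D.incidenceGraph_adj_inl_inr _ _).1 hadj)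
    · have := hl' C w ((D.incidenceGraph_adj_inr_inl _ _).1 hadj)
      simp only [Sum.elim_inl, Sum.elim_inr]
      rw [add_comm, this, mul_comm]
    · exact absurd hadj (D.incidenceGraph_adj_inr_inr _ _)
  · rintro (v | C) - (w | C') - (w' | C'') - hadj hadj' hne
    · exact absurd hadj (D.incidenceGraph_adj_inl_inl _ _)
    · exact absurd hadj (D.incidenceGraph_adj_inl_inl _ _)
    · exact absurd hadj' (D.incidenceGraph_adj_inl_inl _ _)
    -- Two lines through `v` with equal slopes coincide, so all vertices of both constraints would
    -- be collinear, contrary to genericity.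
    · intro heq
      have heq : l C' 0 = l C'' 0 := heq
      have h1 := (D.incidenceGraph_adj_inl_inr _ _).1 hadj
      have h2 := (D.incidenceGraph_adj_inl_inr _ _).1 hadj'
      obtain ⟨a, b, c, ha, hb, hc, habc⟩ := hl C'.1 C'.2 C''.1 C''.2
        (fun h => hne (congrArg Sum.inr (Subtype.ext h))) ⟨v.1, h1, h2⟩
      have key : ∀ u : D.Vertex, u.1 ∈ C'.1 ∨ u.1 ∈ C''.1 →
          x (u, 1) + l C' 1 = x (u, 0) * l C' 0 := by
        rintro u (hu | hu)
        · exact hl' C' u hu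
        · linear_combination hl' C'' u hu + hl' C' v h1 - hl' C'' v h2 +
            (x (v, 0) - x (u, 0)) * heq
      refine habc ?_
      rw [area]
      linear_combination (x (b, 0) - x (a, 0)) * (key c hc - key a ha) -
        (x (c, 0) - x (a, 0)) * (key b hb - key a ha)
    · exact hx _ _ fun h => hne (congrArg Sum.inl h)
    · exact absurd hadj' (D.incidenceGraph_adj_inr_inr _ _)
    · exact absurd hadj (D.incidenceGraph_adj_inr_inr _ _)
    · exact absurd hadj (D.incidenceGraph_adj_inr_inr _ _)

end GeneralizedDissection
end

/-! ### The variety of the generic configuration, and conclusion -/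

noncomputable section

open scoped Classical

namespace GeneralizedDissection

variable {p q r s : Plane} {D : GeneralizedDissection (quad p q r s)}

/-- The first coordinates of two neighbours of a vertex are different in a generic configuration. -/
theorem _root_.SimpleGraph.IsGenericConfig.isRegularConfig {W : Type*} {G : SimpleGraph W}
    {k : Fin 4 → W} {S : Finset W} {φ : W × Fin 2 → RatFunField (W × Fin 2)} {t : Set (W × Fin 2)}
    (h : SimpleGraph.IsGenericConfig G k S φ t) {ρ : W × Fin 2 → ℂ} (hρ : G.IsConfig k S ρ)
    (hρ' : G.IsRegularConfig S ρ) : G.IsRegularConfig S φ := by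
  intro e he f hf g hg hef heg hfg heq
  exact ((h.specializes ρ hρ hρ' f hf 0).sub (h.specializes ρ hρ hρ' g hg 0)).ne_zero
    (sub_ne_zero.2 (hρ' e he f hf g hg hef heg hfg)) (sub_eq_zero.2 heq)

/-- The coordinates of the vertices generate the field of all coordinates of a configuration. -/
theorem adjoin_vertex_coordinates {L : Type*} [Field L] [Algebra ℂ L]
    {φ : D.Element × Fin 2 → L}
    (hφ : D.incidenceGraph.IsConfig D.cornerElement Finset.univ φ)
    (hφ' : D.incidenceGraph.IsRegularConfig Finset.univ φ) :
    IntermediateField.adjoin ℂ (Set.range fun j : D.Vertex × Fin 2 => φ (.inl j.1, j.2)) =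
      IntermediateField.adjoin ℂ (Set.range φ) := by
  refine le_antisymm (IntermediateField.adjoin.mono _ _ _ ?_) (IntermediateField.adjoin_le_iff.2 ?_)
  · rintro _ ⟨j, rfl⟩
    exact ⟨_, rfl⟩
  · have hv : ∀ (v : D.Vertex) i, φ (.inl v, i) ∈ IntermediateField.adjoin ℂ
        (Set.range fun j : D.Vertex × Fin 2 => φ (.inl j.1, j.2)) := fun v i =>
      IntermediateField.subset_adjoin _ _ ⟨(v, i), rfl⟩
    rintro _ ⟨⟨v | C, i⟩, rfl⟩
    · exact hv v i
    -- Two vertices of a constraint determine slope and intercept of its line rationally.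
    · obtain ⟨a, ha, b, hb, hab⟩ := D.exists_ne_mem_constraint C.2
      have ha' := (D.incidenceGraph_adj_inr_inl a C).2 ha
      have hb' := (D.incidenceGraph_adj_inr_inl b C).2 hb
      have h1 := hφ.adj _ (Finset.mem_univ _) _ (Finset.mem_univ _) ha'
      have h2 := hφ.adj _ (Finset.mem_univ _) _ (Finset.mem_univ _) hb'
      have hne := sub_ne_zero.2 (hφ' _ (Finset.mem_univ _) _ (Finset.mem_univ _) _ (Finset.mem_univ _)
        ha' hb' (fun h => hab (Sum.inl_injective h)))
      have e0 : φ (.inr C, 0) = (φ (.inl a, 1) - φ (.inl b, 1)) / (φ (.inl a, 0) - φ (.inl b, 0)) := by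
        rw [eq_div_iff hne]
        linear_combination h2 - h1
      have e1 : φ (.inr C, 1) = φ (.inr C, 0) * φ (.inl a, 0) - φ (.inl a, 1) := by
        linear_combination h1
      have m0 : φ (.inr C, 0) ∈ IntermediateField.adjoin ℂ
          (Set.range fun j : D.Vertex × Fin 2 => φ (.inl j.1, j.2)) := by
        rw [e0]
        exact div_mem (sub_mem (hv a 1) (hv b 1)) (sub_mem (hv a 0) (hv b 0))
      fin_cases i
      · exact m0
      · change φ (.inr C, 1) ∈ _
        rw [e1]
        exact sub_mem (mul_mem m0 (hv a 0)) (hv a 1)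

/-- Points of the variety of a generic configuration are drawings. -/
theorem varietyOfGenericPoint_subset_drawingSpace {L : Type*} [Field L] [Algebra ℂ L]
    {φ : D.Element × Fin 2 → L}
    (hφ : D.incidenceGraph.IsConfig D.cornerElement Finset.univ φ) :
    varietyOfGenericPoint (fun j : D.Vertex × Fin 2 => φ (.inl j.1, j.2)) ⊆ D.drawingSpace := by
  intro x hx
  have hx : ∀ f, f ∈ RingHom.ker (MvPolynomial.aeval (R := ℂ)
      fun j : D.Vertex × Fin 2 => φ (.inl j.1, j.2)) → MvPolynomial.aeval x f = 0 := fun f hf =>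
    hx f hf
  refine (D.isDrawing_curry_iff x).2 ⟨fun C hC u hu v hv w hw => ?_, fun i => ?_⟩
  · have := hx (area MvPolynomial.X u v w) ?_
    · rw [map_area] at this
      simpa only [MvPolynomial.aeval_X] using this
    · rw [RingHom.mem_ker, map_area]
      simp only [MvPolynomial.aeval_X]
      have key : ∀ u : D.Vertex, u.1 ∈ C → φ (.inr ⟨C, hC⟩, 1) + φ (.inl u, 1) =
          φ (.inr ⟨C, hC⟩, 0) * φ (.inl u, 0) := fun u hu =>
        hφ.adj _ (Finset.mem_univ _) _ (Finset.mem_univ _)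
          ((D.incidenceGraph_adj_inr_inl u ⟨C, hC⟩).2 hu)
      rw [area]
      linear_combination (φ (.inl v, 0) - φ (.inl u, 0)) * (key w hw - key u hu) -
        (φ (.inl w, 0) - φ (.inl u, 0)) * (key v hv - key u hu)
  · have := hx (MvPolynomial.X (D.corner 0, i) + MvPolynomial.X (D.corner 2, i) -
      (MvPolynomial.X (D.corner 1, i) + MvPolynomial.X (D.corner 3, i))) ?_
    · simpa [sub_eq_zero] using this
    · rw [RingHom.mem_ker]
      simp only [map_sub, map_add, MvPolynomial.aeval_X]
      exact sub_eq_zero.2 (hφ.parallelogram i)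

end GeneralizedDissection

theorem IsZariskiClosed.isClosed {σ : Type*} {X : Set (σ → ℂ)} (h : IsZariskiClosed X) :
    IsClosed X := by
  obtain ⟨I, rfl⟩ := h
  have : MvPolynomial.zeroLocus ℂ I = ⋂ f ∈ I, {x | MvPolynomial.aeval x f = 0} := by
    ext x
    simp [MvPolynomial.mem_zeroLocus_iff]
  rw [this]
  exact isClosed_biInter fun f _ => isClosed_eq (MvPolynomial.continuous_aeval' f) continuous_const

theorem isZariskiClosed_setOf_aeval_eq_zero {σ : Type*} (f : MvPolynomial σ ℂ) :
    IsZariskiClosed {x : σ → ℂ | MvPolynomial.aeval x f = 0} :=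
  ⟨Ideal.span {f}, by ext x; simp [MvPolynomial.zeroLocus_span]⟩

end

theorem mainTheorem11 (p q r s : Plane) (D : GeneralizedDissection (quad p q r s)) :
    D.deformationSpace = ∅ ∨
      (IsRationalVariety D.deformationSpace ∧
        IsIrreducibleComponent D.deformationSpace D.drawingSpace) := by
  by_cases hU : ∃ x : D.Vertex × Fin 2 → ℂ, D.IsGenericDrawing (Function.curry x)
  swap
  · left
    rw [GeneralizedDissection.deformationSpace, show {x | D.IsGenericDrawing (Function.curry x)} = ∅
      from Set.eq_empty_iff_forall_notMem.2 fun x hx => hU ⟨x, hx⟩, closure_empty]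
  right
  obtain ⟨x₀, hx₀⟩ := hU
  -- Distinct first coordinates make every constraint line non-vertical, so that this drawing
  -- extends to a regular configuration.
  obtain ⟨x₁, hx₁, hx₁'⟩ := (closure_nonempty_iff.1 ⟨x₀, hx₀.mem_closure⟩)
  obtain ⟨ρ₁, hρ₁, hρ₁', -⟩ := hx₁.exists_isConfig hx₁'
  obtain ⟨φ, t, hφ⟩ := (GeneralizedDissection.constructible_incidenceGraph
    hx₀.corner_notMem).exists_isGenericConfig D.cornerElement_injective
    (fun _ _ => D.incidenceGraph_adj_inl_inl _ _) ⟨ρ₁, hρ₁, hρ₁'⟩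
  set ψ := fun j : D.Vertex × Fin 2 => φ (.inl j.1, j.2) with hψ
  have hZirr : IsIrreducibleVariety (varietyOfGenericPoint ψ) :=
    isIrreducibleVariety_varietyOfGenericPoint ψ
  have hZd : varietyOfGenericPoint ψ ⊆ D.drawingSpace :=
    GeneralizedDissection.varietyOfGenericPoint_subset_drawingSpace hφ.isConfig
  have hUZ : {x | D.IsGenericDrawing (Function.curry x)} ⊆ varietyOfGenericPoint ψ := by
    intro x hx
    refine closure_minimal ?_ hZirr.isZariskiClosed.isClosed hx.mem_closure
    rintro y ⟨hy, hy'⟩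
    obtain ⟨ρ, hρ, hρ', hρy⟩ := hy.exists_isConfig hy'
    refine mem_varietyOfGenericPoint (c := ρ) fun j => ?_
    rw [show y j = ρ (.inl j.1, j.2) from (hρy _ _).symm]
    exact hφ.specializes ρ hρ hρ' _ (Finset.mem_univ _) _
  obtain ⟨h, hh₀, hh⟩ := D.exists_aeval_ne_zero_imp_isGenericDrawing hx₀
  have hX : D.deformationSpace = varietyOfGenericPoint ψ := by
    -- For the reverse inclusion, `h` is not in the prime ideal because `x₀` lies on the variety and
    -- `h` is nonzero there. Hence the points with `h ≠ 0` are dense, and they are generic drawings.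
    refine Set.Subset.antisymm (closure_minimal hUZ hZirr.isZariskiClosed.isClosed) ?_
    have hP : h ∉ RingHom.ker (MvPolynomial.aeval (R := ℂ) ψ) := fun hP => hh₀ (hUZ hx₀ h hP)
    have : (RingHom.ker (MvPolynomial.aeval (R := ℂ) ψ)).IsPrime := RingHom.ker_isPrime _
    refine (MvPolynomial.zeroLocus_subset_closure _ hP).trans (closure_mono ?_)
    rintro x ⟨hx, hxh⟩
    exact hh x (hZd hx) hxh
  rw [hX]
  refine ⟨⟨hZirr, nonempty_functionField_algEquiv ψ t ?_⟩, ⟨hZirr, hZd⟩, ?_⟩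
  · rw [hψ, GeneralizedDissection.adjoin_vertex_coordinates hφ.isConfig
      (hφ.isRegularConfig hρ₁ hρ₁'), ← hφ.adjoin_eq]
    simp
  · rintro Y ⟨hY, hYd⟩ hXY
    -- A drawing in `Y` with `h ≠ 0` is generic and hence on the variety; `x₀` prevents `Y` from
    -- lying in the zero set of `h`.
    refine (hY.irreducible _ _ hZirr.isZariskiClosed (isZariskiClosed_setOf_aeval_eq_zero h)
      fun y hy => ?_).resolve_right fun hYh => hh₀ (hYh (hXY (hUZ hx₀)))
    by_cases hyh : MvPolynomial.aeval y h = 0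
    · exact Or.inr hyh
    · exact Or.inl (hUZ (hh y (hYd hy) hyh))
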